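/- Let $\mathbb{T}=\mathbb{R}/2\pi\mathbb{Z}$ and let $X$ be the Hilbert space of complex-valued functions $f(x,y)$ on $\mathbb{T}\times\mathbb{R}$ with $\|f\|_X^2:=\|f\|_{L^2}^2+\|yf\|_{L^2}^2<\infty$. For $\nu>0$ let $$\mathcal{L}=-y^2\partial_x+2\partial_x\Delta^{-1}+\nu\Delta,$$ regarded as an unbounded operator on $X$ with domain $\{f\in X:\mathcal{L}f\in X\}$, where $\mathcal{L}f$ is understood in the sense of distributions on $\mathbb{T}\times\mathbb{R}$ and $\partial_x\Delta^{-1}f$ is the unique $h\in X$ with $\Delta h=\partial_x f$. For an integer $k\ge1$ let $\mathbb{P}_k$ be the projection of $X$ onto the sum of the $\pm k$-th Fourier modes in $x$, that is, onto the functions of the form $a(y)e^{ikx}+b(y)e^{-ikx}$. There exist absolute constants $\varepsilon_0\geq\frac{1}{20}$ and $C_0\in(1,10)$ such that for every $\nu\in(0,1)$ the operator $\mathcal{L}$ generates a strongly continuous semigroup $(e^{\mathcal{L}t})_{t\ge0}$ on $X$, and for every integer $k\geq1$ and every $t\ge0$ $$\|e^{\mathcal{L}t}\mathbb{P}_k\|_{X\to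 X}\leq C_0\,e^{-\varepsilon_0\lambda_{\nu,k}t},\qquad \lambda_{\nu,k}=\frac{\nu^{1/2}|k|^{1/2}}{1+|\log\nu|+\log|k|}.$$ -/

import Mathlib

open MeasureTheory Filter Topology
open scoped NNReal ContDiff

noncomputable section

namespace Poiseuille

/-- The torus `𝕋 = ℝ / 2πℤ`, carrying Lebesgue measure, of total mass `2π`. -/
abbrev Torus : Type := AddCircle (2 * Real.pi)

instance fact_two_pi_pos : Fact (0 < 2 * Real.pi) := ⟨Real.two_pi_pos⟩

/-- The measure `(1 + y²) dx dy` on `𝕋 × ℝ`. -/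
def weight : Measure (Torus × ℝ) :=
  (volume : Measure (Torus × ℝ)).withDensity (fun p => ENNReal.ofReal (1 + p.2 ^ 2))

/-- The space `X` of (complex valued) functions on `𝕋 × ℝ` with
`‖f‖²_X = ∫ |f|² (1 + y²) dx dy = ‖f‖²_{L²} + ‖y f‖²_{L²}`. -/
abbrev X : Type := Lp ℂ 2 weight

/-! ### Distributions on `𝕋 × ℝ` -/

/-- `∂ₓ φ` for a function on `𝕋 × ℝ`. -/
def dx (φ : Torus × ℝ → ℂ) (p : Torus × ℝ) : ℂ :=
  deriv (fun s : ℝ => φ (p.1 + (s : Torus), p.2)) 0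

/-- `∂_y φ` for a function on `𝕋 × ℝ`. -/
def dy (φ : Torus × ℝ → ℂ) (p : Torus × ℝ) : ℂ :=
  deriv (fun s : ℝ => φ (p.1, s)) p.2

/-- `Δ φ = ∂ₓₓ φ + ∂_yy φ`. -/
def lap (φ : Torus × ℝ → ℂ) (p : Torus × ℝ) : ℂ :=
  dx (dx φ) p + dy (dy φ) p

/-- Test functions: smooth, compactly supported functions on `𝕋 × ℝ`; smoothness is smoothness of
the `2π`-periodic lift to `ℝ × ℝ`. -/
def IsTest (φ : Torus × ℝ → ℂ) : Prop :=
  ContDiff ℝ ∞ (fun q : ℝ × ℝ => φ ((q.1 : Torus), q.2)) ∧ HasCompactSupport φ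

/-- `h = ∂ₓ Δ⁻¹ f`: the function `h ∈ X` solves `Δ h = ∂ₓ f` in the sense of distributions.
There is at most one such `h`, since a harmonic function in `L²(𝕋 × ℝ)` vanishes.
If `ψ` is a stream function of `f` (`Δ ψ = f`), then `h = ∂ₓ ψ`. -/
def IsDxInvLap (f h : X) : Prop :=
  ∀ φ : Torus × ℝ → ℂ, IsTest φ → ∫ p, h p * lap φ p = -∫ p, f p * dx φ p

/-- `g = 𝓛 f = -y² ∂ₓ f + 2 ∂ₓ Δ⁻¹ f + ν Δ f` in the sense of distributions, with `f, g ∈ X`.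
This is the graph of `𝓛` as an unbounded operator on `X`, with domain `{f ∈ X : 𝓛 f ∈ X}`. -/
def IsLinOp (ν : ℝ) (f g : X) : Prop :=
  ∃ h : X, IsDxInvLap f h ∧
    ∀ φ : Torus × ℝ → ℂ, IsTest φ →
      ∫ p, g p * φ p =
        (∫ p, f p * ((p.2 : ℂ) ^ 2 * dx φ p)) + 2 * (∫ p, h p * φ p) + ν * ∫ p, f p * lap φ p

/-! ### Semigroups -/

/-- `S` is a strongly continuous semigroup of bounded operators on `E`. -/
structure IsC0Semigroup {E : Type*} [NormedAddCommGroup E] [NormedSpace ℂ E]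
    (S : ℝ≥0 → E →L[ℂ] E) : Prop where
  map_zero : S 0 = ContinuousLinearMap.id ℂ E
  map_add : ∀ s t : ℝ≥0, S (s + t) = (S s).comp (S t)
  tendsto_zero : ∀ f : E, Tendsto (fun t : ℝ≥0 => S t f) (𝓝 0) (𝓝 f)

/-- `S` is the strongly continuous semigroup generated by the unbounded operator with graph
`A f g` (read `g = A f`): `(S h f - f) / h → g` as `h → 0⁺` exactly when `f` lies in the domain of
the operator and is mapped to `g`. -/
def IsGeneratedBy {E : Type*} [NormedAddCommGroup E] [NormedSpace ℂ E]
    (S : ℝ≥0 → E →L[ℂ] E) (A : E → E → Prop) : Prop :=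
  IsC0Semigroup S ∧
    ∀ f g : E,
      Tendsto (fun h : ℝ≥0 => ((h : ℝ) : ℂ)⁻¹ • (S h f - f)) (𝓝[>] 0) (𝓝 g) ↔ A f g

/-! ### Fourier modes in `x` -/

/-- The functions in `X` of the form `a(y) e^{ikx} + b(y) e^{-ikx}`. -/
def modes (k : ℕ) : Submodule ℂ X where
  carrier := {f | ∃ a b : ℝ → ℂ,
    ∀ᵐ p ∂weight, f p = a p.2 * fourier (k : ℤ) p.1 + b p.2 * fourier (-(k : ℤ)) p.1}
  zero_mem' := by
    refine ⟨0, 0, ?_⟩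
    filter_upwards [Lp.coeFn_zero ℂ 2 weight] with p hp
    change _ = (0 : ℂ) * _ + (0 : ℂ) * _
    rw [zero_mul, zero_mul, add_zero]
    exact hp
  add_mem' := by
    rintro f g ⟨a, b, hf⟩ ⟨a', b', hg⟩
    refine ⟨a + a', b + b', ?_⟩
    filter_upwards [hf, hg, Lp.coeFn_add f g] with p h1 h2 h3
    rw [h3, Pi.add_apply, h1, h2, Pi.add_apply, Pi.add_apply]
    ring
  smul_mem' := by
    rintro c f ⟨a, b, hf⟩
    refine ⟨c • a, c • b, ?_⟩
    filter_upwards [hf, Lp.coeFn_smul c f] with p h1 h2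
    rw [h2, Pi.smul_apply, h1, Pi.smul_apply, Pi.smul_apply, smul_eq_mul, smul_eq_mul, smul_eq_mul]
    ring

/-- The projection `ℙ_k` onto the sum of the `±k`-th Fourier modes in `x`. Distinct modes are
orthogonal in `X`, because the weight depends on `y` only, so this is an orthogonal projection. -/
def proj (k : ℕ) : X →L[ℂ] X := (modes k).topologicalClosure.starProjection

/-- The decay rate `λ_{ν,k} = ν^{1/2} |k|^{1/2} / (1 + |log ν| + log |k|)`. -/
def rate (ν : ℝ) (k : ℕ) : ℝ :=
  Real.sqrt ν * Real.sqrt k / (1 + |Real.log ν| + Real.log k)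

end Poiseuille

end

/-!
The operator acts on each Fourier mode in `x` separately. The space `X` is the Hilbert sum of copies
of the weighted space `Y = L²((1 + y²) dy)`, embedded by `v ↦ (2π)^{-1/2} e^{ijx} v(y)`
(`isHilbertSum_modeEmb`), and on the `j`-th mode the operator reads
`ν (∂_y² - j²) u - i j y² u + 2 i j ψ`, where `(∂_y² - j²) ψ = u`.

**Generation.** On a mode, the local part `ν (∂_y² - j²) - i j y²` satisfies a resolvent estimate on
test functions, and `l - ν (∂_y² - j²) + i j y²` has dense range there (`denseRange_schr`). The
density amounts to a Liouville property: a distributional solution of `w'' = q w` with `Re q ≥ 0` is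
classical, its squared modulus is convex, and hence it is constant as soon as `|w|² / (1 + y²)` is
integrable (`ae_eq_const_of_weak_solution`). The same property gives uniqueness for the
distributional equation, so the distributional domain is the range of the resolvent. The stream
function term is bounded by `2` uniformly in `j` (`norm_velMode_le`) and is added by a Neumann
series. Summing the modes gives `‖(l - 𝓛)⁻¹‖ ≤ 1 / (l - 5)` for `l > 5`
(`isQuasiDissipative_linOpGraph`), and the Hille–Yosida theorem
(`IsQuasiDissipative.exists_semigroup`) yields the semigroup.

**Decay of a mode** `j ≠ 0`, with `k = |j|`. The energy `‖u‖² + ‖y u‖² + 2 ‖∇ψ‖²` does not increase,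
because the nonlocal contribution to `‖y u‖²` cancels the transport contribution to `2 ‖∇ψ‖²`
(`rin_genMode_energyOp_nonpos`). With `d = √(ν / k)` and `σ` the sign of `j`, the hypocoercive form
`½ ‖u‖² + (d/8) ‖u'‖² + (σ/8) Re ⟨i y u, u'⟩ + (1/4d) (½ ‖y u‖² + ‖∇ψ‖²)` decays at the rate
`d k / 5 = √(ν k) / 5` (`hypo_dissipation`, `rin_genMode_hypoOp_le`). This form contains `u'`, which
is not controlled by the norm of `X`; but viscosity makes it finite after the time `1 / √(ν k)`, as a
time-weighted functional shows, at the price of a factor of order `1 / d`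
(`IsModeSolution.energy_decay`). With `Λ = 1 + |log ν| + log k` one has `1 / d = e^{(Λ - 1) / 2}`, so
this factor is absorbed by slowing the decay from the rate `√(ν k)` to `√(ν k) / Λ`, which is where
the logarithms come from (`decay_rate_le`). The constants are `ε₀ = 1/20` and `C₀ = 9`.

It is enough to treat the dense set of data in the domain of the generator. They give solutions `v`
that are right differentiable in `Y` and stay in the domain, but the preimage of `v t` under the
resolvent is only known to be continuous in `t`. The two forms are
`⟨v, B v⟩` with `B` unbounded and symmetric, and symmetry lets them be differentiated using the
derivative of `v` alone (`hasDerivWithinAt_quad`). All identities for the forms are proved for test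
functions and extended to the domain by density (`shiftMode_induction`).

After the projection only the modes `±k` are present, and absent modes remain absent, so Parseval's
identity (`norm_le_of_coeff_le`) carries the bound from the modes to `X`.
-/

noncomputable section

namespace Poiseuille

/-! ### Resolvents and Yosida approximations -/

section HilleYosida

variable {E : Type*} [NormedAddCommGroup E] [NormedSpace ℂ E]

/-- `A` is the graph of an unbounded operator for which every real `l > β` lies in the resolvent
set, with resolvent of norm at most `1 / (l - β)`. -/
structure IsQuasiDissipative (A : Submodule ℂ (E × E)) (β : ℝ) : Prop where
  bound : ∀ l : ℝ, β < l → ∀ f g : E, (f, g) ∈ A → (l - β) * ‖f‖ ≤ ‖(l : ℂ) • f - g‖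
  surj : ∀ l : ℝ, β < l → ∀ g : E, ∃ f : E, (f, (l : ℂ) • f - g) ∈ A

variable {A : Submodule ℂ (E × E)} {β : ℝ}

theorem IsQuasiDissipative.exists_resolvent (hA : IsQuasiDissipative A β) {l : ℝ} (hl : β < l) :
    ∃ R : E →L[ℂ] E, (∀ g, (R g, (l : ℂ) • R g - g) ∈ A) ∧
      (∀ f g, (f, g) ∈ A → R ((l : ℂ) • f - g) = f) ∧ ∀ g, (l - β) * ‖R g‖ ≤ ‖g‖ := by
  have hpos : 0 < l - β := sub_pos.2 hl
  choose r hr using hA.surj l hl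
  have huniq : ∀ f g h : E, (f, (l : ℂ) • f - h) ∈ A → (g, (l : ℂ) • g - h) ∈ A → f = g := by
    intro f g h hf hg
    have h1 := hA.bound l hl _ _ (A.sub_mem hf hg)
    have h2 : (l : ℂ) • (f - g) - ((l : ℂ) • f - h - ((l : ℂ) • g - h)) = 0 := by
      rw [smul_sub]; abel
    simp only [h2, norm_zero] at h1
    have h3 : ‖f - g‖ ≤ 0 := by
      by_contra! h4
      nlinarith
    exact sub_eq_zero.1 (norm_le_zero_iff.1 h3)
  have hbd : ∀ g, (l - β) * ‖r g‖ ≤ ‖g‖ := by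
    intro g
    have := hA.bound l hl _ _ (hr g)
    simpa using this
  let R : E →ₗ[ℂ] E :=
    { toFun := r
      map_add' := by
        intro x y
        apply huniq _ _ (x + y) (hr _)
        have := A.add_mem (hr x) (hr y)
        simp only [Prod.mk_add_mk] at this
        convert this using 2
        rw [smul_add]; abel
      map_smul' := by
        intro c x
        apply huniq _ _ (c • x) (hr _)
        have := A.smul_mem c (hr x)
        simp only [Prod.smul_mk, smul_sub, smul_comm c (l : ℂ)] at this
        exact this }
  refine ⟨R.mkContinuous (1 / (l - β)) fun g => ?_, fun g => hr g, fun f g hfg => ?_, fun g => hbd g⟩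
  · rw [one_div, ← div_eq_inv_mul, le_div_iff₀ hpos, mul_comm]
    exact hbd g
  · refine huniq _ _ _ (hr _) ?_
    simpa using hfg

variable [CompleteSpace E]

theorem hasDerivAt_exp_smul_apply (B : E →L[ℂ] E) (f : E) (t : ℝ) :
    HasDerivAt (fun s : ℝ => NormedSpace.exp (s • B) f) (NormedSpace.exp (t • B) (B f)) t := by
  have h := hasDerivAt_exp_smul_const (𝕂 := ℝ) B t
  exact (((ContinuousLinearMap.apply ℂ E f).restrictScalars ℝ).hasFDerivAt.comp_hasDerivAt t h)

/-- A bounded operator of the form `l² R - l` with `‖R‖ ≤ 1 / (l - β)` generates a semigroup of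
growth at most `l β / (l - β) ≤ 2 β`. -/
theorem norm_exp_yosida_le {R : E →L[ℂ] E} {l : ℝ} (hβ : 0 ≤ β) (hl : 2 * β < l)
    (hR : ∀ g, (l - β) * ‖R g‖ ≤ ‖g‖) (f : E) {t : ℝ} (ht : 0 ≤ t) :
    ‖NormedSpace.exp (t • ((l : ℂ) ^ 2 • R - (l : ℂ) • (1 : E →L[ℂ] E))) f‖ ≤
      Real.exp (2 * β * t) * ‖f‖ := by
  set B := (l : ℂ) ^ 2 • R - (l : ℂ) • (1 : E →L[ℂ] E) with hB
  have hl0 : 0 < l := by linarith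
  have hlβ : 0 < l - β := by linarith
  set u : ℝ → E := fun s => Real.exp (l * s) • NormedSpace.exp (s • B) f with hu
  have hcomm : ∀ s : ℝ, NormedSpace.exp (s • B) (B f) = B (NormedSpace.exp (s • B) f) := by
    intro s
    have : Commute B (NormedSpace.exp (s • B)) :=
      ((Commute.refl B).smul_right s).exp_right
    exact (congrArg (fun T : E →L[ℂ] E => T f) this.eq).symm
  have hd : ∀ s : ℝ, HasDerivAt u ((l : ℂ) ^ 2 • R (u s)) s := by
    intro s
    have h1 := hasDerivAt_exp_smul_apply B f s
    have h2 : HasDerivAt (fun s : ℝ => Real.exp (l * s)) (l * Real.exp (l * s)) s := by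
      have := ((hasDerivAt_id s).const_mul l).exp
      simpa [mul_comm] using this
    convert! h2.smul h1 using 1
    rw [hcomm, hu, hB]
    simp only [sub_apply, smul_apply, one_apply_eq_self]
    have hre : ∀ (a : ℝ) (v : E), a • v = (a : ℂ) • v := fun a v => rfl
    simp only [hre, Complex.ofReal_mul, ContinuousLinearMap.map_smul]
    module
  have hg := norm_le_gronwallBound_of_norm_deriv_right_le (f := u) (K := l ^ 2 / (l - β)) (ε := 0)
    (δ := ‖f‖) (a := 0) (b := t) (fun s _ => (hd s).continuousAt.continuousWithinAt)
    (fun s _ => (hd s).hasDerivWithinAt) (by simp [hu])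
    (fun s _ => by
      rw [norm_smul, add_zero, div_mul_eq_mul_div, le_div_iff₀ hlβ]
      have := hR (u s)
      have h3 : ‖((l : ℂ) ^ 2)‖ = l ^ 2 := by simp
      rw [h3]
      nlinarith [sq_nonneg l]) t ⟨ht, le_rfl⟩
  rw [gronwallBound_ε0, sub_zero] at hg
  have h4 : ‖u t‖ = Real.exp (l * t) * ‖NormedSpace.exp (t • B) f‖ := by
    rw [hu, norm_smul, Real.norm_eq_abs, abs_of_pos (Real.exp_pos _)]
  rw [h4] at hg
  have h5 : Real.exp (l ^ 2 / (l - β) * t) ≤ Real.exp (l * t) * Real.exp (2 * β * t) := by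
    rw [← Real.exp_add]
    apply Real.exp_le_exp.2
    rw [← add_mul]
    apply mul_le_mul_of_nonneg_right _ ht
    rw [div_le_iff₀ hlβ]
    nlinarith
  have h6 : Real.exp (l * t) * ‖NormedSpace.exp (t • B) f‖ ≤
      Real.exp (l * t) * (Real.exp (2 * β * t) * ‖f‖) := by
    calc _ ≤ _ := hg
      _ ≤ ‖f‖ * (Real.exp (l * t) * Real.exp (2 * β * t)) := by gcongr
      _ = _ := by ring
  exact le_of_mul_le_mul_left h6 (Real.exp_pos _)

theorem exp_add_smul_apply (B : E →L[ℂ] E) (s t : ℝ) (f : E) :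
    NormedSpace.exp ((s + t) • B) f = NormedSpace.exp (s • B) (NormedSpace.exp (t • B) f) := by
  let _ : NormedAlgebra ℚ (E →L[ℂ] E) := NormedAlgebra.restrictScalars ℚ ℝ _
  rw [add_smul, NormedSpace.exp_add_of_commute]
  · rfl
  · exact ((Commute.refl B).smul_left s).smul_right t

/-- Duhamel comparison of the semigroups of two commuting bounded operators. -/
theorem norm_exp_sub_exp_le {B C : E →L[ℂ] E} (hBC : Commute B C) {M : ℝ} (t : ℝ) (ht : 0 ≤ t)
    (hB : ∀ s, 0 ≤ s → ∀ f, ‖NormedSpace.exp (s • B) f‖ ≤ Real.exp (M * s) * ‖f‖)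
    (hC : ∀ s, 0 ≤ s → ∀ f, ‖NormedSpace.exp (s • C) f‖ ≤ Real.exp (M * s) * ‖f‖) (f : E) :
    ‖NormedSpace.exp (t • B) f - NormedSpace.exp (t • C) f‖ ≤
      Real.exp (M * t) * ‖B f - C f‖ * t := by
  set u : ℝ → E := fun s => NormedSpace.exp (s • B) (NormedSpace.exp ((t - s) • C) f) with hu
  have hd : ∀ s : ℝ, HasDerivAt u
      (NormedSpace.exp (s • B) (NormedSpace.exp ((t - s) • C) (B f - C f))) s := by
    intro s
    have h1 := hasDerivAt_exp_smul_const (𝕂 := ℝ) B s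
    have h2 : HasDerivAt (fun s : ℝ => NormedSpace.exp ((t - s) • C) f)
        (-(NormedSpace.exp ((t - s) • C) (C f))) s := by
      have := (hasDerivAt_exp_smul_apply C f (t - s)).scomp s ((hasDerivAt_id s).const_sub t)
      simpa using! this
    have h3 := HasDerivAt.clm_apply (𝕜 := ℝ)
      (c := fun s : ℝ => (NormedSpace.exp (s • B)).restrictScalars ℝ)
      (c' := (NormedSpace.exp (s • B) * B).restrictScalars ℝ) (x := s)
      (u := fun s : ℝ => NormedSpace.exp ((t - s) • C) f) ?_ h2
    · convert! h3 using 1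
      have hc : B (NormedSpace.exp ((t - s) • C) f) = NormedSpace.exp ((t - s) • C) (B f) := by
        have : Commute B (NormedSpace.exp ((t - s) • C)) := (hBC.smul_right _).exp_right
        exact (congrArg (fun T : E →L[ℂ] E => T f) this.eq)
      simp only [ContinuousLinearMap.coe_restrictScalars', mul_apply_eq_comp, hc,
        map_sub, map_neg]
      abel
    · exact (ContinuousLinearMap.restrictScalarsL ℂ E E ℝ ℝ).hasFDerivAt.comp_hasDerivAt s h1
  have hmain := norm_image_sub_le_of_norm_deriv_right_le_segment (f := u) (a := 0) (b := t)
    (C := Real.exp (M * t) * ‖B f - C f‖)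
    (fun s _ => (hd s).continuousAt.continuousWithinAt)
    (fun s _ => (hd s).hasDerivWithinAt) (fun s hs => by
      calc _ ≤ Real.exp (M * s) * (Real.exp (M * (t - s)) * ‖B f - C f‖) :=
            (hB s hs.1 _).trans (by gcongr; exact hC _ (by linarith [hs.2]) _)
        _ = _ := by rw [← mul_assoc, ← Real.exp_add]; ring_nf) t ⟨ht, le_rfl⟩
  simpa [hu] using hmain

end HilleYosida

/-! ### Strongly continuous semigroups -/

section C0Semigroup

variable {E : Type*} [NormedAddCommGroup E] [NormedSpace ℂ E]

/-- A family of operators that is bounded along a filter and tends to zero on a dense set tends to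
zero everywhere. -/
theorem tendsto_zero_of_dense {ι : Type*} {l : Filter ι} (T : ι → E →L[ℂ] E) (M : ℝ)
    (hM : ∀ᶠ i in l, ∀ f, ‖T i f‖ ≤ M * ‖f‖) {D : Set E} (hD : Dense D)
    (h : ∀ f ∈ D, Tendsto (fun i => T i f) l (𝓝 0)) (f : E) :
    Tendsto (fun i => T i f) l (𝓝 0) := by
  rw [NormedAddGroup.tendsto_nhds_zero]
  intro ε hε
  have hK : 0 < |M| + 1 := by positivity
  obtain ⟨g, hg, hfg⟩ := hD.exists_dist_lt f (show 0 < ε / 2 / (|M| + 1) by positivity)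
  have h1 := (NormedAddGroup.tendsto_nhds_zero.1 (h g hg)) (ε / 2) (half_pos hε)
  filter_upwards [h1, hM] with i hi hMi
  rw [dist_eq_norm, lt_div_iff₀ hK] at hfg
  have h2 := hMi (f - g)
  have h3 : T i f = T i (f - g) + T i g := by simp
  have h4 : M * ‖f - g‖ ≤ |M| * ‖f - g‖ := by gcongr; exact le_abs_self M
  calc ‖T i f‖ ≤ ‖T i (f - g)‖ + ‖T i g‖ := by rw [h3]; exact norm_add_le _ _
    _ < ε := by nlinarith [norm_nonneg (f - g)]

variable {S : ℝ≥0 → E →L[ℂ] E}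

/-- By Banach–Steinhaus: otherwise `‖S tₙ‖ → ∞` along some `tₙ → 0`, although every orbit
converges. -/
theorem IsC0Semigroup.exists_bound_near_zero [CompleteSpace E] (hS : IsC0Semigroup S) :
    ∃ δ : ℝ≥0, 0 < δ ∧ ∃ M : ℝ, ∀ t ≤ δ, ‖S t‖ ≤ M := by
  by_contra! hcon
  have h1 : ∀ n : ℕ, ∃ t : ℝ≥0, t ≤ 1 / ((n : ℝ≥0) + 1) ∧ (n : ℝ) < ‖S t‖ := fun n => by
    obtain ⟨t, ht, h⟩ := hcon (1 / ((n : ℝ≥0) + 1)) (by positivity) n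
    exact ⟨t, ht, h⟩
  choose t ht hn using h1
  have htend : Tendsto t atTop (𝓝 0) :=
    tendsto_of_tendsto_of_tendsto_of_le_of_le tendsto_const_nhds
      tendsto_one_div_add_atTop_nhds_zero_nat (fun _ => zero_le) ht
  obtain ⟨C, hC⟩ := banach_steinhaus (g := fun n => S (t n)) (fun f => by
    have h2 := ((hS.tendsto_zero f).comp htend).norm.bddAbove_range
    obtain ⟨C, hC⟩ := h2
    exact ⟨C, fun n => hC ⟨n, rfl⟩⟩)
  obtain ⟨n, hn'⟩ := exists_nat_gt C
  linarith [hn n, hC n]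

theorem IsC0Semigroup.exists_bound [CompleteSpace E] (hS : IsC0Semigroup S) (T : ℝ≥0) :
    ∃ M : ℝ, 0 ≤ M ∧ ∀ t ≤ T, ‖S t‖ ≤ M := by
  obtain ⟨δ, hδ, M, hM⟩ := hS.exists_bound_near_zero
  have hM0 : 0 ≤ M := (norm_nonneg _).trans (hM 0 hδ.le)
  have key : ∀ n : ℕ, ∃ K : ℝ, 0 ≤ K ∧ ∀ t ≤ n * δ, ‖S t‖ ≤ K := by
    intro n
    induction n with
    | zero => exact ⟨M, hM0, fun t ht => hM t (by simp at ht; simp [ht])⟩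
    | succ n ih =>
      obtain ⟨K, hK, hb⟩ := ih
      refine ⟨max K (M * K), le_max_of_le_left hK, fun t ht => ?_⟩
      by_cases h : t ≤ n * δ
      · exact (hb t h).trans (le_max_left _ _)
      · push Not at h
        have h1 : t = (t - n * δ) + n * δ := (tsub_add_cancel_of_le h.le).symm
        rw [h1, hS.map_add]
        refine (ContinuousLinearMap.opNorm_comp_le _ _).trans (le_trans ?_ (le_max_right _ _))
        gcongr
        · apply hM
          rw [tsub_le_iff_left]
          calc t ≤ _ := ht
            _ = _ := by push_cast; ring
        · exact hb _ le_rfl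
  obtain ⟨n, hn⟩ := exists_nat_ge (T / δ)
  obtain ⟨K, hK, hb⟩ := key n
  exact ⟨K, hK, fun t ht => hb t (ht.trans ((div_le_iff₀ hδ).1 hn))⟩

theorem IsC0Semigroup.continuous [CompleteSpace E] (hS : IsC0Semigroup S) (f : E) :
    Continuous fun t : ℝ≥0 => S t f := by
  rw [continuous_iff_continuousAt]
  intro t
  obtain ⟨M, hM0, hM⟩ := hS.exists_bound (t + 1)
  have h0 : Tendsto (fun s : ℝ≥0 => M * ‖S (nndist s t) f - f‖) (𝓝 t) (𝓝 0) := by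
    have h1 : Tendsto (fun s : ℝ≥0 => nndist s t) (𝓝 t) (𝓝 0) := by
      have : Continuous fun s : ℝ≥0 => nndist s t := by fun_prop
      simpa using this.tendsto t
    have h2 := (((hS.tendsto_zero f).comp h1).sub_const f).norm.const_mul M
    simpa using h2
  rw [ContinuousAt, tendsto_iff_norm_sub_tendsto_zero]
  refine squeeze_zero' (Eventually.of_forall fun _ => norm_nonneg _) ?_ h0
  filter_upwards [Iio_mem_nhds (show t < t + 1 by simp)] with s hs
  rcases le_total t s with h | h
  · have h1 : s = t + nndist s t := by
      rw [NNReal.nndist_eq]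
      simp [tsub_eq_zero_of_le h, add_tsub_cancel_of_le h]
    have h2 : S s f = S t (S (nndist s t) f) := by
      conv_lhs => rw [h1, hS.map_add]
      rfl
    rw [h2, ← map_sub]
    exact ((S t).le_opNorm _).trans (by gcongr; exact hM t (by simp))
  · have h1 : t = s + nndist s t := by
      rw [NNReal.nndist_eq]
      simp [tsub_eq_zero_of_le h, add_tsub_cancel_of_le h]
    have h2 : S t f = S s (S (nndist s t) f) := by
      conv_lhs => rw [h1, hS.map_add]
      rfl
    rw [h2, norm_sub_rev, ← map_sub]
    exact ((S s).le_opNorm _).trans (by gcongr; exact hM s (le_of_lt hs))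

/-- The orbit of a point at which the semigroup has right derivative `g` at time `0` is right
differentiable at all times. -/
theorem IsC0Semigroup.hasDerivWithinAt (hS : IsC0Semigroup S) {f g : E}
    (h : Tendsto (fun h : ℝ≥0 => ((h : ℝ) : ℂ)⁻¹ • (S h f - f)) (𝓝[>] 0) (𝓝 g)) (t : ℝ)
    (ht : 0 ≤ t) :
    HasDerivWithinAt (fun s : ℝ => S s.toNNReal f) (S t.toNNReal g) (Set.Ici t) t := by
  rw [← hasDerivWithinAt_Ioi_iff_Ici, hasDerivWithinAt_iff_tendsto_slope' (by simp)]
  have h1 : Tendsto (fun s : ℝ => (s - t).toNNReal) (𝓝[>] t) (𝓝[>] 0) := by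
    apply tendsto_nhdsWithin_of_tendsto_nhds_of_eventually_within
    · have : Continuous fun s : ℝ => (s - t).toNNReal := by fun_prop
      have h2 := this.tendsto t
      simp only [sub_self, Real.toNNReal_zero] at h2
      exact h2.mono_left nhdsWithin_le_nhds
    · filter_upwards [self_mem_nhdsWithin] with s hs
      simpa using hs
  have h2 := ((S t.toNNReal).continuous.tendsto g).comp (h.comp h1)
  refine h2.congr' ?_
  filter_upwards [self_mem_nhdsWithin] with s hs
  have hs' : t < s := hs
  have h3 : s.toNNReal = t.toNNReal + (s - t).toNNReal := by
    rw [← Real.toNNReal_add ht (by linarith)]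
    congr 1; ring
  have h4 : ((s - t).toNNReal : ℝ) = s - t := Real.coe_toNNReal _ (by linarith)
  simp only [Function.comp_apply, slope_def_module, h4, map_smul, map_sub]
  conv_rhs => rw [h3, hS.map_add]
  rw [← Complex.ofReal_inv]
  rfl

theorem IsC0Semigroup.tendsto_orbit (hS : IsC0Semigroup S) {f g : E}
    (h : Tendsto (fun h : ℝ≥0 => ((h : ℝ) : ℂ)⁻¹ • (S h f - f)) (𝓝[>] 0) (𝓝 g)) (t : ℝ≥0) :
    Tendsto (fun h : ℝ≥0 => ((h : ℝ) : ℂ)⁻¹ • (S h (S t f) - S t f)) (𝓝[>] 0) (𝓝 (S t g)) := by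
  have h2 := ((S t).continuous.tendsto g).comp h
  refine h2.congr fun s => ?_
  have h3 : S s (S t f) = S t (S s f) := by
    change ((S s).comp (S t)) f = ((S t).comp (S s)) f
    rw [← hS.map_add, ← hS.map_add, add_comm]
  simp [h3]

end C0Semigroup

section Generation

variable {E : Type*} [NormedAddCommGroup E] [NormedSpace ℂ E] [CompleteSpace E]
  {A : Submodule ℂ (E × E)} {β : ℝ}

/-- **Hille–Yosida theorem**: a densely defined operator whose resolvent satisfies
`‖(l - A)⁻¹‖ ≤ 1 / (l - β)` for all real `l > β` generates a strongly continuous semigroup, obtained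
as the limit of the semigroups of its Yosida approximations. -/
theorem IsQuasiDissipative.exists_semigroup (hA : IsQuasiDissipative A β) (hβ : 0 ≤ β)
    (hdense : Dense {f : E | ∃ g, (f, g) ∈ A}) :
    ∃ S : ℝ≥0 → E →L[ℂ] E, IsGeneratedBy S (fun f g => (f, g) ∈ A) := by
  set l : ℕ → ℝ := fun n => 2 * β + n + 1 with hl
  have hl2 : ∀ n, 2 * β < l n := fun n => by
    have : (0 : ℝ) ≤ n := n.cast_nonneg
    simp only [hl]; linarith
  have hlpos : ∀ n, 0 < l n := fun n => by linarith [hl2 n]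
  have hlβ : ∀ n, β < l n := fun n => by linarith [hl2 n]
  have hltop : Tendsto l atTop atTop := by
    have h1 : Tendsto (fun n : ℕ => (n : ℝ)) atTop atTop := tendsto_natCast_atTop_atTop
    exact tendsto_atTop_mono (fun n => by simp only [hl]; linarith) h1
  choose R hRmem hRinv hRbd using fun n => hA.exists_resolvent (hlβ n)
  set B : ℕ → E →L[ℂ] E := fun n =>
    (l n : ℂ) ^ 2 • R n - (l n : ℂ) • (1 : E →L[ℂ] E) with hB
  -- On the domain the Yosida approximation is `B n f = l R g`.
  have hBapp : ∀ n f g, (f, g) ∈ A → B n f = (l n : ℂ) • R n g := by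
    intro n f g hfg
    have h1 := hRinv n f g hfg
    rw [map_sub, map_smul] at h1
    have h2 : R n g = (l n : ℂ) • R n f - f := by
      rw [sub_eq_iff_eq_add.1 h1]; abel
    rw [h2]
    simp only [hB, sub_apply, smul_apply, one_apply_eq_self]
    module
  have hlR : ∀ n g, ‖(l n : ℂ) • R n g‖ ≤ 2 * ‖g‖ := by
    intro n g
    rw [norm_smul, Complex.norm_real, Real.norm_eq_abs, abs_of_pos (hlpos n)]
    have := hRbd n g
    nlinarith [norm_nonneg (R n g), hl2 n]
  have hlRtend : ∀ g, Tendsto (fun n => (l n : ℂ) • R n g) atTop (𝓝 g) := by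
    intro g
    have := tendsto_zero_of_dense (l := atTop)
      (fun n => (l n : ℂ) • R n - ContinuousLinearMap.id ℂ E) 3
      (Eventually.of_forall fun n f => ?_) hdense (fun f hf => ?_) g
    · rw [tendsto_iff_norm_sub_tendsto_zero]
      simpa using this.norm
    · calc _ ≤ ‖(l n : ℂ) • R n f‖ + ‖f‖ := norm_sub_le _ _
        _ ≤ _ := by linarith [hlR n f]
    · obtain ⟨g, hfg⟩ := hf
      have h1 : ∀ n, ((l n : ℂ) • R n - ContinuousLinearMap.id ℂ E) f = R n g := by
        intro n
        have h1 := hRinv n f g hfg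
        rw [map_sub, map_smul] at h1
        simp only [sub_apply, smul_apply, ContinuousLinearMap.id_apply]
        nth_rewrite 2 [← h1]
        abel
      simp only [h1]
      rw [tendsto_zero_iff_norm_tendsto_zero]
      have h2 : Tendsto (fun n => ‖g‖ / (l n - β)) atTop (𝓝 0) :=
        (hltop.atTop_add tendsto_const_nhds (C := -β)).const_div_atTop _
      refine squeeze_zero (fun _ => norm_nonneg _) (fun n => ?_) h2
      rw [le_div_iff₀ (by linarith [hlβ n]), mul_comm]
      exact hRbd n g
  have hcomm : ∀ m n, Commute (B m) (B n) := by
    have hid : ∀ m n g, R m g = R n g - ((l m : ℂ) - l n) • R m (R n g) := by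
      intro m n g
      have h1 := hRinv m _ _ (hRmem n g)
      have h2 : (l m : ℂ) • R n g - ((l n : ℂ) • R n g - g) = ((l m : ℂ) - l n) • R n g + g := by
        module
      rw [h2, map_add, map_smul] at h1
      exact eq_sub_of_add_eq' h1
    have hRR : ∀ m n, Commute (R m) (R n) := by
      intro m n
      by_cases hmn : (l m : ℂ) - l n = 0
      · have : R m = R n := by
          ext g
          simpa [hmn] using hid m n g
        rw [this]
      · ext g
        have h1 := hid m n g
        have h2 := hid n m g
        have h3 : ((l m : ℂ) - l n) • R m (R n g) = ((l m : ℂ) - l n) • R n (R m g) := by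
          have h4 : ((l m : ℂ) - l n) • R m (R n g) = R n g - R m g := by
            rw [eq_sub_iff_add_eq, add_comm, ← eq_sub_iff_add_eq]; exact h1
          have h5 : ((l n : ℂ) - l m) • R n (R m g) = R m g - R n g := by
            rw [eq_sub_iff_add_eq, add_comm, ← eq_sub_iff_add_eq]; exact h2
          rw [h4, ← neg_sub (R m g), ← h5, ← neg_smul, neg_sub]
        exact smul_right_injective E hmn h3
    intro m n
    simp only [hB]
    exact ((((hRR m n).smul_left _).smul_right _).sub_right
      ((Commute.one_right _).smul_right _)).sub_left
      (((Commute.one_left _).smul_left _))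
  set e : ℕ → ℝ → E →L[ℂ] E := fun n t => NormedSpace.exp (t • B n) with he
  have hebd : ∀ n t, 0 ≤ t → ∀ f, ‖e n t f‖ ≤ Real.exp (2 * β * t) * ‖f‖ := fun n t ht f =>
    norm_exp_yosida_le hβ (hl2 n) (hRbd n) f ht
  have hcauchy : ∀ t, 0 ≤ t → ∀ f, CauchySeq fun n => e n t f := by
    intro t ht f
    rw [cauchySeq_iff_tendsto_dist_atTop_0]
    have := tendsto_zero_of_dense (l := atTop) (fun p : ℕ × ℕ => e p.1 t - e p.2 t)
      (2 * Real.exp (2 * β * t)) (Eventually.of_forall fun p f => ?_) hdense (fun f hf => ?_) f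
    · simpa [dist_eq_norm] using this.norm
    · calc _ ≤ ‖e p.1 t f‖ + ‖e p.2 t f‖ := norm_sub_le _ _
        _ ≤ _ := by linarith [hebd p.1 t ht f, hebd p.2 t ht f]
    · obtain ⟨g, hfg⟩ := hf
      have h1 : CauchySeq fun n => B n f := by
        simp only [hBapp _ f g hfg]
        exact (hlRtend g).cauchySeq
      rw [cauchySeq_iff_tendsto_dist_atTop_0] at h1
      have h2 := (h1.const_mul (Real.exp (2 * β * t))).mul_const t
      rw [mul_zero, zero_mul] at h2
      refine squeeze_zero_norm (fun p => ?_) h2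
      rw [dist_eq_norm]
      exact norm_exp_sub_exp_le (hcomm p.1 p.2) t ht (hebd p.1) (hebd p.2) f
  choose s hs using fun t : ℝ≥0 => fun f : E => cauchySeq_tendsto_of_complete (hcauchy t t.2 f)
  let S : ℝ≥0 → E →L[ℂ] E := fun t =>
    continuousLinearMapOfTendsto (fun n => e n t) (tendsto_pi_nhds.2 (hs t))
  have hS : ∀ (t : ℝ≥0) f, Tendsto (fun n => e n t f) atTop (𝓝 (S t f)) := fun t f => hs t f
  have hSbd : ∀ (t : ℝ≥0) f, ‖S t f‖ ≤ Real.exp (2 * β * t) * ‖f‖ := fun t f =>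
    le_of_tendsto (hS t f).norm (Eventually.of_forall fun n => hebd n t t.2 f)
  -- Increments along an orbit that starts in the domain.
  have hinc : ∀ n (t : ℝ), 0 ≤ t → ∀ f g, (f, g) ∈ A →
      ‖e n t f - f‖ ≤ Real.exp (2 * β * t) * (2 * ‖g‖) * t := by
    intro n t ht f g hfg
    have h1 := norm_image_sub_le_of_norm_deriv_right_le_segment (f := fun s => e n s f) (a := 0)
      (b := t) (C := Real.exp (2 * β * t) * (2 * ‖g‖))
      (fun s _ => (hasDerivAt_exp_smul_apply (B n) f s).continuousAt.continuousWithinAt)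
      (fun s _ => (hasDerivAt_exp_smul_apply (B n) f s).hasDerivWithinAt) (fun s hs => by
        refine (hebd n s hs.1 _).trans ?_
        rw [hBapp n f g hfg]
        gcongr
        · exact hs.2.le
        · exact hlR n g) t ⟨ht, le_rfl⟩
    simpa [he] using h1
  have hC0 : IsC0Semigroup S := by
    refine ⟨?_, ?_, ?_⟩
    · ext f
      refine tendsto_nhds_unique (hS 0 f) ?_
      simp [he]
    · intro s t
      ext f
      refine tendsto_nhds_unique (hS (s + t) f) ?_
      have h1 : ∀ n, e n ((s + t : ℝ≥0) : ℝ) f = e n s (e n t f) := fun n => by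
        rw [NNReal.coe_add]; exact exp_add_smul_apply (B n) s t f
      simp only [h1, ContinuousLinearMap.comp_apply]
      have h2 : Tendsto (fun n => e n s (e n t f - S t f)) atTop (𝓝 0) := by
        have h3 : Tendsto (fun n => Real.exp (2 * β * s) * ‖e n t f - S t f‖) atTop (𝓝 0) := by
          have := ((tendsto_iff_norm_sub_tendsto_zero.1 (hS t f))).const_mul
            (Real.exp (2 * β * s))
          simpa using this
        exact squeeze_zero_norm (fun n => hebd n s s.2 _) h3
      simpa using h2.add (hS s (S t f))
    · intro f
      have h1 := tendsto_zero_of_dense (l := 𝓝 (0 : ℝ≥0))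
        (fun t => S t - ContinuousLinearMap.id ℂ E) (Real.exp (2 * β) + 1) ?_ hdense
        (fun f hf => ?_) f
      · rw [tendsto_iff_norm_sub_tendsto_zero]
        simpa using h1.norm
      · filter_upwards [Iio_mem_nhds (show (0 : ℝ≥0) < 1 by simp)] with t ht f
        have ht' : (t : ℝ) ≤ 1 := by exact_mod_cast (le_of_lt ht)
        calc _ ≤ ‖S t f‖ + ‖f‖ := norm_sub_le _ _
          _ ≤ Real.exp (2 * β * t) * ‖f‖ + ‖f‖ := by gcongr; exact hSbd t f
          _ ≤ Real.exp (2 * β) * ‖f‖ + ‖f‖ := by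
            have := Real.exp_le_exp.2 (show 2 * β * t ≤ 2 * β by nlinarith)
            gcongr
          _ = _ := by ring
      · obtain ⟨g, hfg⟩ := hf
        have h2 : ∀ t : ℝ≥0, ‖S t f - f‖ ≤ Real.exp (2 * β * t) * (2 * ‖g‖) * t := fun t =>
          le_of_tendsto ((hS t f).sub_const f).norm
            (Eventually.of_forall fun n => hinc n t t.2 f g hfg)
        have h3 : Tendsto (fun t : ℝ≥0 => Real.exp (2 * β * t) * (2 * ‖g‖) * t) (𝓝 0) (𝓝 0) := by
          have : Continuous fun t : ℝ≥0 => Real.exp (2 * β * t) * (2 * ‖g‖) * t := by fun_prop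
          simpa using this.tendsto 0
        exact squeeze_zero_norm (fun t => h2 t) h3
  have hfwd : ∀ f g, (f, g) ∈ A →
      Tendsto (fun h : ℝ≥0 => ((h : ℝ) : ℂ)⁻¹ • (S h f - f)) (𝓝[>] 0) (𝓝 g) := by
    intro f g hfg
    have key : ∀ (t : ℝ≥0) g' g'', t ≤ 1 → (g', g'') ∈ A → ‖S t f - f - (t : ℝ) • g‖ ≤
        ((Real.exp (2 * β) + 1) * ‖g - g'‖ + Real.exp (2 * β) * (2 * ‖g''‖) * t) * t := by
      intro t g' g'' ht1 hg'
      have ht1' : (t : ℝ) ≤ 1 := by exact_mod_cast ht1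
      have h1 : ∀ n, ‖e n t f - f - (t : ℝ) • g‖ ≤ (Real.exp (2 * β) * ‖B n f - g‖ +
          ((Real.exp (2 * β) + 1) * ‖g - g'‖ + Real.exp (2 * β) * (2 * ‖g''‖) * t)) * t := by
        intro n
        have hder : ∀ s : ℝ, HasDerivAt (fun s : ℝ => e n s f - s • g) (e n s (B n f) - g) s := by
          intro s
          have h2 := (hasDerivAt_id s).smul_const g
          simp only [one_smul] at h2
          exact (hasDerivAt_exp_smul_apply (B n) f s).sub h2
        have h1 := norm_image_sub_le_of_norm_deriv_right_le_segment (a := 0) (b := (t : ℝ))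
          (C := Real.exp (2 * β) * ‖B n f - g‖ +
            ((Real.exp (2 * β) + 1) * ‖g - g'‖ + Real.exp (2 * β) * (2 * ‖g''‖) * t))
          (fun s _ => (hder s).continuousAt.continuousWithinAt)
          (fun s _ => (hder s).hasDerivWithinAt) (fun s hs => ?_) t ⟨t.2, le_rfl⟩
        · convert h1 using 2
          · simp [he]; abel
          · simp
        · have hs1 : s ≤ 1 := hs.2.le.trans ht1'
          have hexp : Real.exp (2 * β * s) ≤ Real.exp (2 * β) :=
            Real.exp_le_exp.2 (by nlinarith)
          have hsplit : e n s (B n f) - g =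
              e n s (B n f - g) + (e n s (g - g') - (g - g')) + (e n s g' - g') := by
            simp only [map_sub]; abel
          have ha : ‖e n s (B n f - g)‖ ≤ Real.exp (2 * β) * ‖B n f - g‖ :=
            (hebd n s hs.1 _).trans (by gcongr)
          have hb : ‖e n s (g - g')‖ ≤ Real.exp (2 * β) * ‖g - g'‖ :=
            (hebd n s hs.1 _).trans (by gcongr)
          have hc : ‖e n s g' - g'‖ ≤ Real.exp (2 * β) * (2 * ‖g''‖) * t :=
            (hinc n s hs.1 g' g'' hg').trans (by gcongr; exacts [hs.1, hs.2.le])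
          rw [hsplit]
          refine (norm_add₃_le).trans ?_
          have hd := norm_sub_le (e n s (g - g')) (g - g')
          linarith
      have hlim : Tendsto (fun n => (Real.exp (2 * β) * ‖B n f - g‖ +
          ((Real.exp (2 * β) + 1) * ‖g - g'‖ + Real.exp (2 * β) * (2 * ‖g''‖) * t)) * (t : ℝ))
          atTop (𝓝 ((Real.exp (2 * β) * 0 +
          ((Real.exp (2 * β) + 1) * ‖g - g'‖ + Real.exp (2 * β) * (2 * ‖g''‖) * t)) * t)) := by
        simp only [hBapp _ f g hfg]
        exact (((tendsto_iff_norm_sub_tendsto_zero.1 (hlRtend g)).const_mul _).add_const _).mul_const _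
      have := le_of_tendsto_of_tendsto' (((hS t f).sub_const f).sub_const _).norm hlim h1
      simpa using this
    rw [tendsto_iff_norm_sub_tendsto_zero, ← tendsto_zero_iff_norm_tendsto_zero,
      NormedAddGroup.tendsto_nhds_zero]
    intro ε hε
    have hK : 0 < Real.exp (2 * β) + 1 := by positivity
    obtain ⟨g', ⟨g'', hg'⟩, hgg'⟩ :=
      hdense.exists_dist_lt g (show 0 < ε / 2 / (Real.exp (2 * β) + 1) by positivity)
    rw [dist_eq_norm, lt_div_iff₀ hK] at hgg'
    have hsmall : ∀ᶠ t : ℝ≥0 in 𝓝 0, Real.exp (2 * β) * (2 * ‖g''‖) * t < ε / 2 := by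
      have h1 : Continuous fun t : ℝ≥0 => Real.exp (2 * β) * (2 * ‖g''‖) * (t : ℝ) := by fun_prop
      have h2 := h1.tendsto 0
      simp only [NNReal.coe_zero, mul_zero] at h2
      exact h2.eventually (gt_mem_nhds (by positivity))
    filter_upwards [nhdsWithin_le_nhds hsmall, self_mem_nhdsWithin,
      nhdsWithin_le_nhds (Iio_mem_nhds (show (0 : ℝ≥0) < 1 by simp))] with t h1 h2 h3
    have ht0 : (0 : ℝ) < t := by exact_mod_cast h2
    have h4 := key t g' g'' (le_of_lt h3) hg'
    have h5 : ((t : ℝ) : ℂ)⁻¹ • (S t f - f) - g = ((t : ℝ) : ℂ)⁻¹ • (S t f - f - (t : ℝ) • g) := by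
      rw [smul_sub _ _ ((t : ℝ) • g), show ((t : ℝ) • g : E) = ((t : ℝ) : ℂ) • g from rfl,
        smul_smul, inv_mul_cancel₀ (by exact_mod_cast ht0.ne'), one_smul]
    rw [h5, norm_smul, norm_inv, Complex.norm_real, Real.norm_eq_abs, abs_of_pos ht0,
      inv_mul_lt_iff₀ ht0]
    calc _ ≤ _ := h4
      _ < t * ε := by rw [mul_comm]; gcongr; linarith
  refine ⟨S, hC0, fun f g => ⟨fun hfg => ?_, hfwd f g⟩⟩
  -- Conversely, the generator cannot be larger, since `l - A` is onto and `l - generator` is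
  -- injective.
  obtain ⟨R', hR'mem, -, -⟩ := hA.exists_resolvent (show β < 2 * β + 1 by linarith)
  set m : ℝ := 2 * β + 1 with hm
  set d := f - R' ((m : ℂ) • f - g) with hd
  have hdlim : Tendsto (fun h : ℝ≥0 => ((h : ℝ) : ℂ)⁻¹ • (S h d - d)) (𝓝[>] 0)
      (𝓝 ((m : ℂ) • d)) := by
    have h1 := hfg.sub (hfwd _ _ (hR'mem ((m : ℂ) • f - g)))
    have h2 : g - ((m : ℂ) • R' ((m : ℂ) • f - g) - ((m : ℂ) • f - g)) = (m : ℂ) • d := by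
      rw [hd]; module
    rw [h2] at h1
    refine h1.congr fun t => ?_
    rw [hd, map_sub (S t)]
    module
  have hd0 : d = 0 := by
    by_contra hne
    have hdn : 0 < ‖d‖ := norm_pos_iff.2 hne
    set u : ℝ → E := fun t => Real.exp (-(m * t)) • S t.toNNReal d with hu
    have hcont : Continuous u := by
      have h1 : Continuous fun t : ℝ => S t.toNNReal d :=
        (hC0.continuous d).comp continuous_real_toNNReal
      exact (by fun_prop : Continuous fun t : ℝ => Real.exp (-(m * t))).smul h1
    have hconst := constant_of_has_deriv_right_zero (f := u) (a := 0) (b := Real.log 2 + 1)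
      hcont.continuousOn (fun t ht => by
        have h1 := hC0.hasDerivWithinAt hdlim t ht.1
        have h2 : HasDerivWithinAt (fun t : ℝ => Real.exp (-(m * t)))
            (-m * Real.exp (-(m * t))) (Set.Ici t) t := by
          have := ((hasDerivAt_id t).const_mul m).neg.exp.hasDerivWithinAt (s := Set.Ici t)
          simpa [mul_comm] using this
        convert! h2.smul h1 using 1
        rw [map_smul]
        have hre : ∀ (a : ℝ) (v : E), a • v = (a : ℂ) • v := fun a v => rfl
        simp only [hre]
        push_cast
        module)
    have hT : (0 : ℝ) < Real.log 2 + 1 := by have := Real.log_pos (one_lt_two); linarith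
    have h1 := hconst (Real.log 2 + 1) ⟨hT.le, le_rfl⟩
    have h2 : ‖u 0‖ = ‖d‖ := by simp [hu, hC0.map_zero]
    have h3 : ‖u (Real.log 2 + 1)‖ ≤ Real.exp (-(Real.log 2 + 1)) * ‖d‖ := by
      rw [hu, norm_smul, Real.norm_eq_abs, abs_of_pos (Real.exp_pos _)]
      have h4 := hSbd (Real.log 2 + 1).toNNReal d
      rw [Real.coe_toNNReal _ hT.le] at h4
      calc _ ≤ Real.exp (-(m * (Real.log 2 + 1))) *
            (Real.exp (2 * β * (Real.log 2 + 1)) * ‖d‖) := by gcongr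
        _ = _ := by rw [← mul_assoc, ← Real.exp_add, hm]; ring_nf
    rw [h1, h2] at h3
    have h4 : Real.exp (-(Real.log 2 + 1)) < 1 := by
      rw [Real.exp_lt_one_iff]; linarith
    nlinarith
  have h1 := hR'mem ((m : ℂ) • f - g)
  have h2 : R' ((m : ℂ) • f - g) = f := (sub_eq_zero.1 (hd ▸ hd0)).symm
  rw [h2, sub_sub_cancel] at h1
  exact h1

end Generation

/-! ### Distributional solutions of second order equations on the line -/

theorem locallyIntegrable_intervalIntegrable {V : Type*} [NormedAddCommGroup V] {g : ℝ → V}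
    (hg : LocallyIntegrable g) (a b : ℝ) : IntervalIntegrable g volume a b :=
  (hg.integrableOn_isCompact isCompact_uIcc).intervalIntegrable

/-- Integration by parts against the primitive of a merely locally integrable function. -/
theorem integral_primitive_mul_deriv_real {g ψ : ℝ → ℝ} (hg : LocallyIntegrable g)
    (hψ : ContDiff ℝ 1 ψ) (hc : HasCompactSupport ψ) :
    ∫ y, (∫ s in (0 : ℝ)..y, g s) * deriv ψ y = -∫ y, g y * ψ y := by
  obtain ⟨r, hr⟩ := hc.isCompact.isBounded.subset_closedBall 0
  set R : ℝ := |r| + 1 with hR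
  have hRpos : 0 < R := by positivity
  have hsub : tsupport ψ ⊆ Set.Ioo (-R) R := by
    intro x hx
    have h1 := hr hx
    rw [Metric.mem_closedBall, dist_zero_right, Real.norm_eq_abs] at h1
    have h2 := le_abs_self r
    exact abs_lt.1 (by linarith : |x| < R)
  have hz : ∀ x, x ∉ Set.Ioo (-R) R → ψ x = 0 := fun x hx =>
    image_eq_zero_of_notMem_tsupport fun h => hx (hsub h)
  have hii : IntervalIntegrable g volume (-R) R := (locallyIntegrable_intervalIntegrable hg _ _)
  have hF : AbsolutelyContinuousOnInterval (fun y => ∫ s in (0 : ℝ)..y, g s) (-R) R :=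
    hii.absolutelyContinuousOnInterval_intervalIntegral
      (by rw [Set.uIcc_of_le (by linarith)]; constructor <;> linarith)
  have hψ' : AbsolutelyContinuousOnInterval ψ (-R) R :=
    ContDiffOn.absolutelyContinuousOnInterval hψ.contDiffOn
  have h1 := AbsolutelyContinuousOnInterval.integral_mul_deriv_eq_deriv_mul hF hψ'
  rw [hz R (by simp), hz (-R) (by simp)] at h1
  have h2 : ∫ x in (-R)..R, deriv (fun y => ∫ s in (0 : ℝ)..y, g s) x * ψ x =
      ∫ x in (-R)..R, g x * ψ x := by
    apply intervalIntegral.integral_congr_ae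
    filter_upwards [_root_.LocallyIntegrable.ae_hasDerivAt_integral hg] with x hx _
    rw [(hx 0).deriv]
  rw [h2] at h1
  have h3 : ∫ x in (-R)..R, (∫ s in (0 : ℝ)..x, g s) * deriv ψ x =
      ∫ x, (∫ s in (0 : ℝ)..x, g s) * deriv ψ x := by
    apply intervalIntegral.integral_eq_integral_of_support_subset
    intro x hx
    have h4 : x ∈ tsupport ψ := support_deriv_subset (right_ne_zero_of_mul hx)
    exact ⟨(hsub h4).1, (hsub h4).2.le⟩
  have h4 : ∫ x in (-R)..R, g x * ψ x = ∫ x, g x * ψ x := by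
    apply intervalIntegral.integral_eq_integral_of_support_subset
    intro x hx
    have h4 : x ∈ tsupport ψ := subset_tsupport _ (right_ne_zero_of_mul hx)
    exact ⟨(hsub h4).1, (hsub h4).2.le⟩
  rw [← h3, h1, h4]
  ring

theorem locallyIntegrable_smul {g : ℝ → ℂ} {ψ : ℝ → ℝ} (hg : LocallyIntegrable g)
    (hψ : Continuous ψ) (hc : HasCompactSupport ψ) : Integrable fun y => ψ y • g y :=
  hg.integrable_smul_left_of_hasCompactSupport hψ hc

theorem continuous_primitive_of_locallyIntegrable {g : ℝ → ℂ} (hg : LocallyIntegrable g) :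
    Continuous fun y => ∫ s in (0 : ℝ)..y, g s :=
  intervalIntegral.continuous_primitive (fun _ _ => (locallyIntegrable_intervalIntegrable hg _ _)) 0

theorem integral_deriv_smul_primitive {g : ℝ → ℂ} {ψ : ℝ → ℝ} (hg : LocallyIntegrable g)
    (hψ : ContDiff ℝ 1 ψ) (hc : HasCompactSupport ψ) :
    ∫ y, deriv ψ y • (∫ s in (0 : ℝ)..y, g s) = -∫ y, ψ y • g y := by
  have hint1 : Integrable fun y => deriv ψ y • (∫ s in (0 : ℝ)..y, g s) :=
    locallyIntegrable_smul (continuous_primitive_of_locallyIntegrable hg).locallyIntegrable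
      (hψ.continuous_deriv le_rfl) hc.deriv
  have hint2 := locallyIntegrable_smul hg hψ.continuous hc
  have hgi : ∀ a b, IntervalIntegrable g volume a b := fun a b => (locallyIntegrable_intervalIntegrable hg _ _)
  apply Complex.ext
  · have h1 := Complex.reCLM.integral_comp_comm hint1
    have h2 := Complex.reCLM.integral_comp_comm hint2
    have hre : LocallyIntegrable fun y => (g y).re :=
      fun x => by
        obtain ⟨s, hs, h⟩ := hg x
        exact ⟨s, hs, h.re⟩
    simp only [Complex.reCLM_apply, Complex.smul_re, smul_eq_mul] at h1 h2
    have h4 : ∀ y : ℝ, (∫ s in (0 : ℝ)..y, g s).re = ∫ s in (0 : ℝ)..y, (g s).re := fun y =>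
      (Complex.reCLM.intervalIntegral_comp_comm (hgi 0 y)).symm
    rw [← h1, Complex.neg_re, ← h2]
    simp only [h4, mul_comm (deriv ψ _), mul_comm (ψ _)]
    exact integral_primitive_mul_deriv_real hre hψ hc
  · have h1 := Complex.imCLM.integral_comp_comm hint1
    have h2 := Complex.imCLM.integral_comp_comm hint2
    have him : LocallyIntegrable fun y => (g y).im :=
      fun x => by
        obtain ⟨s, hs, h⟩ := hg x
        exact ⟨s, hs, h.im⟩
    simp only [Complex.imCLM_apply, Complex.smul_im, smul_eq_mul] at h1 h2
    have h4 : ∀ y : ℝ, (∫ s in (0 : ℝ)..y, g s).im = ∫ s in (0 : ℝ)..y, (g s).im := fun y =>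
      (Complex.imCLM.intervalIntegral_comp_comm (hgi 0 y)).symm
    rw [← h1, Complex.neg_im, ← h2]
    simp only [h4, mul_comm (deriv ψ _), mul_comm (ψ _)]
    exact integral_primitive_mul_deriv_real him hψ hc

/-- A smooth compactly supported function with vanishing integral is the derivative of a smooth
compactly supported function. -/
theorem exists_deriv_eq {η : ℝ → ℝ} (hη : ContDiff ℝ ∞ η) (hc : HasCompactSupport η)
    (h0 : ∫ y, η y = 0) :
    ∃ φ : ℝ → ℝ, ContDiff ℝ ∞ φ ∧ HasCompactSupport φ ∧ deriv φ = η := by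
  obtain ⟨r, hr⟩ := hc.isCompact.isBounded.subset_closedBall 0
  set R : ℝ := |r| + 1 with hR
  have hRpos : 0 < R := by positivity
  have hsub : tsupport η ⊆ Set.Ioo (-R) R := by
    intro x hx
    have h1 := hr hx
    rw [Metric.mem_closedBall, dist_zero_right, Real.norm_eq_abs] at h1
    have h2 := le_abs_self r
    exact abs_lt.1 (by linarith : |x| < R)
  have hz : ∀ x, x ∉ Set.Ioo (-R) R → η x = 0 := fun x hx =>
    image_eq_zero_of_notMem_tsupport fun h => hx (hsub h)
  set φ : ℝ → ℝ := fun y => ∫ s in (-R)..y, η s with hφ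
  have hd : ∀ y, HasDerivAt φ (η y) y := fun y =>
    intervalIntegral.integral_hasDerivAt_right (hη.continuous.intervalIntegrable _ _)
      hη.continuous.stronglyMeasurable.stronglyMeasurableAtFilter hη.continuous.continuousAt
  have hder : deriv φ = η := funext fun y => (hd y).deriv
  refine ⟨φ, ?_, ?_, hder⟩
  · rw [contDiff_infty_iff_deriv]
    exact ⟨fun y => (hd y).differentiableAt, hder ▸ hη⟩
  · apply HasCompactSupport.intro (isCompact_Icc (a := -R) (b := R))
    intro x hx
    rw [Set.mem_Icc, not_and_or, not_le, not_le] at hx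
    rcases hx with hx | hx
    · have : φ x = ∫ s in (-R)..x, (0 : ℝ) := by
        apply intervalIntegral.integral_congr
        intro s hs
        rw [Set.uIcc_of_ge hx.le] at hs
        exact hz s (fun h => by linarith [h.1, hs.2])
      simpa using this
    · have : φ x = ∫ s, η s := by
        apply intervalIntegral.integral_eq_integral_of_support_subset
        intro s hs
        by_contra h
        exact hs (hz s fun h' => h ⟨h'.1, by linarith [h'.2]⟩)
      rw [this, h0]

theorem exists_integral_eq_one : ∃ ρ : ℝ → ℝ, ContDiff ℝ ∞ ρ ∧ HasCompactSupport ρ ∧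
    ∫ y, ρ y = 1 := by
  let b : ContDiffBump (0 : ℝ) := default
  exact ⟨b.normed volume, b.contDiff_normed, b.hasCompactSupport_normed, b.integral_normed⟩

/-- A distribution with vanishing derivative is constant. -/
theorem ae_const_of_integral_deriv_smul_eq_zero {G : ℝ → ℂ} (hG : LocallyIntegrable G)
    (h : ∀ φ : ℝ → ℝ, ContDiff ℝ ∞ φ → HasCompactSupport φ → ∫ y, deriv φ y • G y = 0) :
    ∃ c : ℂ, ∀ᵐ y, G y = c := by
  obtain ⟨ρ, hρ, hρc, hρ1⟩ := exists_integral_eq_one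
  refine ⟨∫ y, ρ y • G y, ?_⟩
  refine ae_eq_of_integral_contDiff_smul_eq hG (locallyIntegrable_const _) fun η hη hηc => ?_
  set m := ∫ y, η y with hm
  have hd : ContDiff ℝ ∞ (fun y => η y - m * ρ y) := hη.sub (contDiff_const.mul hρ)
  have hdc : HasCompactSupport (fun y => η y - m * ρ y) := hηc.sub hρc.mul_left
  obtain ⟨φ, h1, h2, h3⟩ := exists_deriv_eq hd hdc (by
    rw [integral_sub (hη.continuous.integrable_of_hasCompactSupport hηc)
      ((hρ.continuous.integrable_of_hasCompactSupport hρc).const_mul _), integral_const_mul, hρ1]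
    simp [hm])
  have h4 := h φ h1 h2
  simp only [h3, sub_smul, mul_smul] at h4
  rw [integral_sub (locallyIntegrable_smul hG hη.continuous hηc)
    ((locallyIntegrable_smul hG hρ.continuous hρc).fun_smul m), integral_smul, sub_eq_zero] at h4
  rw [h4, integral_smul_const]

/-- Regularity: a locally integrable distributional solution of `u'' = q u` with `q` continuous
agrees almost everywhere with a classical solution. -/
theorem exists_classical_solution {G q : ℝ → ℂ} (hG : LocallyIntegrable G) (hq : Continuous q)
    (h : ∀ φ : ℝ → ℝ, ContDiff ℝ ∞ φ → HasCompactSupport φ →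
      ∫ y, deriv (deriv φ) y • G y = ∫ y, φ y • (q y * G y)) :
    ∃ u u1 : ℝ → ℂ, (∀ y, HasDerivAt u (u1 y) y) ∧ (∀ y, HasDerivAt u1 (q y * u y) y) ∧
      ∀ᵐ y, G y = u y := by
  have hqG : LocallyIntegrable fun y => q y * G y := by
    have := hG.continuous_smul hq
    exact this
  set F1 : ℝ → ℂ := fun y => ∫ s in (0 : ℝ)..y, q s * G s with hF1
  have hF1c : Continuous F1 := continuous_primitive_of_locallyIntegrable hqG
  set F : ℝ → ℂ := fun y => ∫ s in (0 : ℝ)..y, F1 s with hF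
  have hFd : ∀ y, HasDerivAt F (F1 y) y := fun y =>
    intervalIntegral.integral_hasDerivAt_right (hF1c.intervalIntegrable _ _)
      hF1c.stronglyMeasurable.stronglyMeasurableAtFilter hF1c.continuousAt
  have hFc : Continuous F := continuous_primitive_of_locallyIntegrable hF1c.locallyIntegrable
  set H : ℝ → ℂ := fun y => G y - F y with hH
  have hHl : LocallyIntegrable H := hG.sub hFc.locallyIntegrable
  -- The second distributional derivative of `G - F` vanishes.
  have hH2 : ∀ φ : ℝ → ℝ, ContDiff ℝ ∞ φ → HasCompactSupport φ →
      ∫ y, deriv (deriv φ) y • H y = 0 := by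
    intro φ hφ hc
    have hφ' : ContDiff ℝ ∞ (deriv φ) := (contDiff_infty_iff_deriv.1 hφ).2
    have hφ'' : ContDiff ℝ ∞ (deriv (deriv φ)) := (contDiff_infty_iff_deriv.1 hφ').2
    simp only [hH, smul_sub]
    rw [integral_sub (locallyIntegrable_smul hG hφ''.continuous hc.deriv.deriv)
      (locallyIntegrable_smul hFc.locallyIntegrable hφ''.continuous hc.deriv.deriv), h φ hφ hc,
      integral_deriv_smul_primitive hF1c.locallyIntegrable (hφ'.of_le (by simp)) hc.deriv,
      integral_deriv_smul_primitive hqG (hφ.of_le (by simp)) hc]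
    simp
  obtain ⟨ρ, hρ, hρc, hρ1⟩ := exists_integral_eq_one
  obtain ⟨c, hc⟩ : ∃ c : ℂ, ∀ φ : ℝ → ℝ, ContDiff ℝ ∞ φ → HasCompactSupport φ →
      ∫ y, deriv φ y • H y = (∫ y, φ y) • c := by
    refine ⟨∫ y, deriv ρ y • H y, fun φ hφ hφc => ?_⟩
    set m := ∫ y, φ y with hm
    have hd : ContDiff ℝ ∞ (fun y => φ y - m * ρ y) := hφ.sub (contDiff_const.mul hρ)
    have hdc : HasCompactSupport (fun y => φ y - m * ρ y) := hφc.sub hρc.mul_left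
    obtain ⟨χ, h1, h2, h3⟩ := exists_deriv_eq hd hdc (by
      rw [integral_sub (hφ.continuous.integrable_of_hasCompactSupport hφc)
        ((hρ.continuous.integrable_of_hasCompactSupport hρc).const_mul _), integral_const_mul,
        hρ1]
      simp [hm])
    have h4 := hH2 χ h1 h2
    have h5 : ∀ y, deriv (deriv χ) y = deriv φ y - m * deriv ρ y := by
      intro y
      rw [h3]
      exact (((hφ.differentiable (by simp) y).hasDerivAt).sub
        (((hρ.differentiable (by simp) y).hasDerivAt).const_mul m)).deriv
    simp only [h5, sub_smul, mul_smul] at h4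
    rw [integral_sub (locallyIntegrable_smul hHl (hφ.continuous_deriv (by simp)) hφc.deriv)
      ((locallyIntegrable_smul hHl (hρ.continuous_deriv (by simp)) hρc.deriv).fun_smul m),
      integral_smul, sub_eq_zero] at h4
    exact h4
  obtain ⟨b, hb⟩ := ae_const_of_integral_deriv_smul_eq_zero (G := fun y => H y + y • c)
    (hHl.add (Continuous.locallyIntegrable (by fun_prop))) (fun φ hφ hφc => by
      simp only [smul_add]
      have hlin : Continuous fun y : ℝ => y • c := by fun_prop
      rw [integral_add (locallyIntegrable_smul hHl (hφ.continuous_deriv (by simp)) hφc.deriv)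
        (locallyIntegrable_smul hlin.locallyIntegrable (hφ.continuous_deriv (by simp))
          hφc.deriv), hc φ hφ hφc]
      have h1 := integral_deriv_smul_primitive (locallyIntegrable_const (μ := volume) c)
        (hφ.of_le (by simp)) hφc
      simp only [intervalIntegral.integral_const, sub_zero] at h1
      rw [h1, integral_smul_const]
      simp)
  set u : ℝ → ℂ := fun y => F y + (b - y • c) with hu
  have hGu : ∀ᵐ y, G y = u y := by
    filter_upwards [hb] with y hy
    simp only [hu, ← hy, hH]
    ring
  have huc : Continuous u := by fun_prop
  have hF1' : ∀ y, F1 y = ∫ s in (0 : ℝ)..y, q s * u s := by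
    intro y
    apply intervalIntegral.integral_congr_ae
    filter_upwards [hGu] with s hs _
    rw [hs]
  have hquc : Continuous fun y => q y * u y := hq.mul huc
  refine ⟨u, fun y => F1 y - c, fun y => ?_, fun y => ?_, hGu⟩
  · have h1 := ((hasDerivAt_id y).smul_const c).const_sub b
    convert! (hFd y).add h1 using 1
    simp [sub_eq_add_neg]
  · have h1 : HasDerivAt (fun y => ∫ s in (0 : ℝ)..y, q s * u s) (q y * u y) y :=
      intervalIntegral.integral_hasDerivAt_right (hquc.intervalIntegrable _ _)
        hquc.stronglyMeasurable.stronglyMeasurableAtFilter hquc.continuousAt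
    have h2 : F1 = fun y => ∫ s in (0 : ℝ)..y, q s * u s := funext hF1'
    rw [← h2] at h1
    exact h1.sub_const c

/-- A convex function with a positive slope somewhere grows at least linearly, which is not
integrable against `1 / (1 + y²)`. -/
theorem deriv_nonpos_of_integrable {p p' : ℝ → ℝ} (hp : ∀ y, HasDerivAt p (p' y) y)
    (hmono : Monotone p') (hnn : ∀ y, 0 ≤ p y) (hint : Integrable fun y => p y / (1 + y ^ 2))
    (y₀ : ℝ) : p' y₀ ≤ 0 := by
  by_contra! hpos
  set c := p' y₀ with hc
  have hlow : ∀ y, y₀ ≤ y → c * (y - y₀) ≤ p y := by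
    intro y hy
    have h1 := (convex_Ici y₀).mul_sub_le_image_sub_of_le_deriv (f := p) (C := c)
      (fun x _ => (hp x).continuousAt.continuousWithinAt)
      (fun x _ => (hp x).differentiableAt.differentiableWithinAt) (fun x hx => by
        rw [(hp x).deriv]
        rw [interior_Ici] at hx
        exact hmono (le_of_lt hx)) y₀ (Set.mem_Ici.2 le_rfl) y hy hy
    linarith [hnn y₀]
  set a : ℝ := 2 * |y₀| + 1 with ha
  have h2 : IntegrableOn (fun y : ℝ => y⁻¹) (Set.Ioi a) := by
    refine Integrable.mono' ((hint.integrableOn (s := Set.Ioi a)).const_mul (4 / c))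
      measurable_inv.aestronglyMeasurable ?_
    filter_upwards [ae_restrict_mem measurableSet_Ioi] with y hy
    have hy' : a < y := hy
    have h3 := abs_nonneg y₀
    have h4 := le_abs_self y₀
    have hy1 : 1 < y := by linarith
    rw [Real.norm_eq_abs, abs_of_pos (by positivity)]
    have h5 := hlow y (by linarith)
    have h6 : c * y / 2 ≤ p y := by nlinarith
    rw [div_mul_div_comm, inv_eq_one_div, div_le_div_iff₀ (by linarith) (by positivity)]
    nlinarith [mul_pos hpos (by linarith : 0 < y)]
  exact not_integrableOn_Ioi_inv h2

/-- A convex nonnegative function on the line that is integrable against `1 / (1 + y²)` is constant,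
because a nonconstant one grows at least linearly at one end. -/
theorem deriv_eq_zero_of_integrable {p p' : ℝ → ℝ} (hp : ∀ y, HasDerivAt p (p' y) y)
    (hmono : Monotone p') (hnn : ∀ y, 0 ≤ p y) (hint : Integrable fun y => p y / (1 + y ^ 2))
    (y : ℝ) : p' y = 0 := by
  apply le_antisymm (deriv_nonpos_of_integrable hp hmono hnn hint y)
  have h1 := deriv_nonpos_of_integrable (p := fun y => p (-y)) (p' := fun y => -p' (-y))
    (fun y => by simpa using! (hp (-y)).scomp y (hasDerivAt_neg y))
    (fun a b hab => neg_le_neg (hmono (neg_le_neg hab))) (fun y => hnn _)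
    (by simpa using hint.comp_neg) (-y)
  simpa using h1

/-- **Liouville property**: if `q` has nonnegative real part, `|u|²` is convex for every solution of
`u'' = q u`; so a solution with `|u|²` integrable against `1 / (1 + y²)` has `u' = 0` and
`(Re q) u = 0`. -/
theorem ae_eq_const_of_weak_solution {G q : ℝ → ℂ} (hG : LocallyIntegrable G) (hq : Continuous q)
    (hre : ∀ y, 0 ≤ (q y).re) (hint : Integrable fun y => ‖G y‖ ^ 2 / (1 + y ^ 2))
    (h : ∀ φ : ℝ → ℝ, ContDiff ℝ ∞ φ → HasCompactSupport φ →
      ∫ y, deriv (deriv φ) y • G y = ∫ y, φ y • (q y * G y)) :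
    ∃ c : ℂ, (∀ᵐ y, G y = c) ∧ ∀ y, (q y).re * ‖c‖ ^ 2 = 0 := by
  obtain ⟨u, u1, hu, hu1, hGu⟩ := exists_classical_solution hG hq h
  have hd : ∀ y, HasDerivAt (fun y => ‖u y‖ ^ 2) (2 * inner ℝ (u y) (u1 y)) y := fun y =>
    (hu y).norm_sq
  have hd2 : ∀ y, HasDerivAt (fun y => 2 * inner ℝ (u y) (u1 y))
      (2 * ‖u1 y‖ ^ 2 + 2 * ((q y).re * ‖u y‖ ^ 2)) y := by
    intro y
    have h1 := ((hu y).inner ℝ (hu1 y)).const_mul 2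
    refine h1.congr_deriv ?_
    rw [real_inner_self_eq_norm_sq]
    have h2 : inner ℝ (u y) (q y * u y) = (q y).re * ‖u y‖ ^ 2 := by
      rw [Complex.inner, ← Complex.normSq_eq_norm_sq, Complex.normSq_apply]
      simp
      ring
    rw [h2]; ring
  have hnn2 : ∀ y, 0 ≤ 2 * ‖u1 y‖ ^ 2 + 2 * ((q y).re * ‖u y‖ ^ 2) := fun y => by
    have := hre y
    positivity
  have hmono : Monotone fun y => 2 * inner ℝ (u y) (u1 y) :=
    monotone_of_deriv_nonneg (fun y => (hd2 y).differentiableAt) fun y => by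
      rw [(hd2 y).deriv]; exact hnn2 y
  have hintu : Integrable fun y => ‖u y‖ ^ 2 / (1 + y ^ 2) := by
    refine hint.congr ?_
    filter_upwards [hGu] with y hy
    rw [hy]
  have hz := deriv_eq_zero_of_integrable hd hmono (fun y => by positivity) hintu
  have hz2 : ∀ y, 2 * ‖u1 y‖ ^ 2 + 2 * ((q y).re * ‖u y‖ ^ 2) = 0 := by
    intro y
    have h1 := hd2 y
    have h2 : (fun y => 2 * inner ℝ (u y) (u1 y)) = fun _ => (0 : ℝ) := funext hz
    rw [h2] at h1
    exact h1.unique (hasDerivAt_const y 0)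
  have hu10 : ∀ y, u1 y = 0 := by
    intro y
    have h1 := hz2 y
    have h2 : 0 ≤ (q y).re * ‖u y‖ ^ 2 := mul_nonneg (hre y) (by positivity)
    have h3 : ‖u1 y‖ ^ 2 = 0 := by nlinarith [sq_nonneg ‖u1 y‖]
    simpa using h3
  have hconst : ∀ y, u y = u 0 := fun y =>
    is_const_of_deriv_eq_zero (fun y => (hu y).differentiableAt)
      (fun y => by rw [(hu y).deriv, hu10]) y 0
  refine ⟨u 0, ?_, fun y => ?_⟩
  · filter_upwards [hGu] with y hy
    rw [hy, hconst]
  · have h1 := hz2 y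
    rw [hu10, hconst] at h1
    simpa using h1

/-! ### The weighted space on the line and its test functions -/

/-- The measure `(1 + y²) dy` on the line. -/
def lineWeight : Measure ℝ :=
  (volume : Measure ℝ).withDensity (fun y => ENNReal.ofReal (1 + y ^ 2))

/-- The space of profiles of a single Fourier mode of `X`. -/
abbrev Y : Type := Lp ℂ 2 lineWeight

/-- Unweighted `L²` on the line. -/
abbrev Z : Type := Lp ℂ 2 (volume : Measure ℝ)

theorem one_add_sq_pos (y : ℝ) : 0 < 1 + y ^ 2 := by positivity

theorem integrable_lineWeight_iff {V : Type*} [NormedAddCommGroup V] [NormedSpace ℝ V]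
    (g : ℝ → V) :
    Integrable g lineWeight ↔ Integrable (fun y => (1 + y ^ 2) • g y) := by
  have h1 := integrable_withDensity_iff_integrable_smul (μ := (volume : Measure ℝ))
    (f := fun y : ℝ => (1 + y ^ 2).toNNReal) (by fun_prop) (g := g)
  have h2 : (fun y : ℝ => (1 + y ^ 2).toNNReal • g y) = fun y => (1 + y ^ 2) • g y := by
    ext y
    rw [NNReal.smul_def, Real.coe_toNNReal _ (one_add_sq_pos y).le]
  rw [h2] at h1
  exact h1

theorem integral_lineWeight {V : Type*} [NormedAddCommGroup V] [NormedSpace ℝ V]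
    (g : ℝ → V) : ∫ y, g y ∂lineWeight = ∫ y, (1 + y ^ 2) • g y := by
  have h1 := integral_withDensity_eq_integral_smul (μ := (volume : Measure ℝ))
    (f := fun y : ℝ => (1 + y ^ 2).toNNReal) (by fun_prop) g
  have h2 : (fun y : ℝ => (1 + y ^ 2).toNNReal • g y) = fun y => (1 + y ^ 2) • g y := by
    ext y
    rw [NNReal.smul_def, Real.coe_toNNReal _ (one_add_sq_pos y).le]
  rw [h2] at h1
  exact h1

theorem volume_le_lineWeight : (volume : Measure ℝ) ≤ lineWeight := by
  have h1 : (volume : Measure ℝ).withDensity 1 ≤ lineWeight :=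
    withDensity_mono (Eventually.of_forall fun y => by
      rw [Pi.one_apply, ENNReal.one_le_ofReal]
      nlinarith [sq_nonneg y])
  rwa [withDensity_one] at h1

theorem volume_absolutelyContinuous : (volume : Measure ℝ) ≪ lineWeight :=
  Measure.absolutelyContinuous_of_le volume_le_lineWeight

theorem lineWeight_absolutelyContinuous : lineWeight ≪ (volume : Measure ℝ) :=
  withDensity_absolutelyContinuous _ _

theorem memLp_mul_id {f : ℝ → ℂ} (hf : MemLp f 2 lineWeight) :
    MemLp (fun y : ℝ => (y : ℂ) * f y) 2 volume := by
  have hm : AEStronglyMeasurable f volume := hf.1.mono_ac volume_absolutelyContinuous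
  have hm2 : AEStronglyMeasurable (fun y : ℝ => (y : ℂ) * f y) volume :=
    (Complex.continuous_ofReal.aestronglyMeasurable).mul hm
  rw [memLp_two_iff_integrable_sq_norm hm2]
  have h1 := (integrable_lineWeight_iff _).1 ((memLp_two_iff_integrable_sq_norm hf.1).1 hf)
  refine h1.mono' (hm2.norm.pow 2) (Eventually.of_forall fun y => ?_)
  rw [norm_mul, Complex.norm_real, Real.norm_eq_abs, Real.norm_eq_abs, smul_eq_mul,
    abs_of_nonneg (by positivity), mul_pow, sq_abs]
  nlinarith [sq_nonneg ‖f y‖]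

theorem norm_sq_eq_integral {μ : Measure ℝ} (f : Lp ℂ 2 μ) : ‖f‖ ^ 2 = ∫ y, ‖f y‖ ^ 2 ∂μ := by
  have h1 : ((‖f‖ ^ 2 : ℝ) : ℂ) = inner ℂ f f := by
    rw [inner_self_eq_norm_sq_to_K]; push_cast; rfl
  rw [L2.inner_def] at h1
  have h2 : ∀ y, inner ℂ (f y) (f y) = ((‖f y‖ ^ 2 : ℝ) : ℂ) := fun y => by
    rw [inner_self_eq_norm_sq_to_K]; push_cast; rfl
  simp only [h2] at h1
  rw [integral_complex_ofReal] at h1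
  exact_mod_cast h1

theorem integrable_norm_sq {μ : Measure ℝ} (f : Lp ℂ 2 μ) : Integrable (fun y => ‖f y‖ ^ 2) μ :=
  (memLp_two_iff_integrable_sq_norm (Lp.memLp f).1).1 (Lp.memLp f)

/-- The inclusion of the weighted space into `L²`. -/
def J0 : Y →L[ℂ] Z :=
  LinearMap.mkContinuous
    { toFun := fun f => ((Lp.memLp f).mono_measure volume_le_lineWeight).toLp f
      map_add' := fun f g => by
        rw [← MemLp.toLp_add]
        exact MemLp.toLp_congr _ _ (volume_absolutelyContinuous.ae_le (Lp.coeFn_add f g))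
      map_smul' := fun c f => by
        rw [← MemLp.toLp_const_smul]
        exact MemLp.toLp_congr _ _ (volume_absolutelyContinuous.ae_le (Lp.coeFn_smul c f)) }
    1 (fun f => by
      rw [one_mul]
      change ‖MemLp.toLp f ((Lp.memLp f).mono_measure volume_le_lineWeight)‖ ≤ _
      rw [Lp.norm_toLp, Lp.norm_def]
      exact ENNReal.toReal_mono (Lp.memLp f).2.ne (eLpNorm_mono_measure _ volume_le_lineWeight))

theorem coeFn_J0 (f : Y) : J0 f =ᵐ[volume] f :=
  ((Lp.memLp f).mono_measure volume_le_lineWeight).coeFn_toLp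

/-- Multiplication by `y`, from the weighted space to `L²`. -/
def J1 : Y →L[ℂ] Z :=
  LinearMap.mkContinuous
    { toFun := fun f => (memLp_mul_id (Lp.memLp f)).toLp _
      map_add' := fun f g => by
        rw [← MemLp.toLp_add]
        apply MemLp.toLp_congr
        filter_upwards [volume_absolutelyContinuous.ae_le (Lp.coeFn_add f g)] with y hy
        rw [hy, Pi.add_apply, mul_add]; rfl
      map_smul' := fun c f => by
        rw [← MemLp.toLp_const_smul]
        apply MemLp.toLp_congr
        filter_upwards [volume_absolutelyContinuous.ae_le (Lp.coeFn_smul c f)] with y hy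
        rw [hy, Pi.smul_apply, Pi.smul_apply, smul_eq_mul, smul_eq_mul, RingHom.id_apply]
        ring }
    1 (fun f => by
      rw [one_mul, ← abs_of_nonneg (norm_nonneg f), ← abs_of_nonneg (norm_nonneg (_ : Z)),
        ← sq_le_sq, norm_sq_eq_integral, norm_sq_eq_integral, integral_lineWeight]
      refine integral_mono_ae (integrable_norm_sq _)
        ((integrable_lineWeight_iff _).1 (integrable_norm_sq f)) ?_
      filter_upwards [(memLp_mul_id (Lp.memLp f)).coeFn_toLp] with y hy
      change ‖(MemLp.toLp _ (memLp_mul_id (Lp.memLp f))) y‖ ^ 2 ≤ _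
      rw [hy, norm_mul, Complex.norm_real, Real.norm_eq_abs, smul_eq_mul, mul_pow, sq_abs]
      nlinarith [sq_nonneg ‖f y‖])

theorem coeFn_J1 (f : Y) : J1 f =ᵐ[volume] fun y => (y : ℂ) * f y :=
  (memLp_mul_id (Lp.memLp f)).coeFn_toLp

theorem inner_Y (f g : Y) : inner ℂ f g = inner ℂ (J0 f) (J0 g) + inner ℂ (J1 f) (J1 g) := by
  rw [L2.inner_def, L2.inner_def, L2.inner_def, integral_lineWeight,
    ← integral_add (L2.integrable_inner _ _) (L2.integrable_inner _ _)]
  apply integral_congr_ae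
  filter_upwards [coeFn_J0 f, coeFn_J0 g, coeFn_J1 f, coeFn_J1 g] with y h1 h2 h3 h4
  rw [h1, h2, h3, h4]
  simp only [RCLike.inner_apply, map_mul, Complex.conj_ofReal, Complex.real_smul]
  push_cast
  ring

theorem norm_sq_Y (f : Y) : ‖f‖ ^ 2 = ‖J0 f‖ ^ 2 + ‖J1 f‖ ^ 2 := by
  have h := congrArg Complex.re (inner_Y f f)
  rw [Complex.add_re, ← RCLike.re_eq_complex_re] at h
  simpa only [inner_self_eq_norm_sq] using h

theorem norm_J0_le (f : Y) : ‖J0 f‖ ≤ ‖f‖ := by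
  have := norm_sq_Y f
  nlinarith [sq_nonneg ‖J1 f‖, norm_nonneg f, norm_nonneg (J0 f)]

theorem norm_J1_le (f : Y) : ‖J1 f‖ ≤ ‖f‖ := by
  have := norm_sq_Y f
  nlinarith [sq_nonneg ‖J0 f‖, norm_nonneg f, norm_nonneg (J1 f)]

/-- Smooth compactly supported functions on the line. -/
def testFnSubmodule : Submodule ℂ (ℝ → ℂ) where
  carrier := {φ | ContDiff ℝ ∞ φ ∧ HasCompactSupport φ}
  zero_mem' := ⟨contDiff_const, HasCompactSupport.zero⟩
  add_mem' := fun hf hg => ⟨hf.1.add hg.1, hf.2.add hg.2⟩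
  smul_mem' := fun c _ hf => ⟨contDiff_const.smul hf.1, hf.2.smul_left (f := fun _ => c)⟩

/-- The type of smooth compactly supported functions on the line. -/
abbrev TestFn : Type := testFnSubmodule

namespace TestFn

theorem contDiff (φ : TestFn) : ContDiff ℝ ∞ (φ : ℝ → ℂ) := φ.2.1

theorem compact (φ : TestFn) : HasCompactSupport (φ : ℝ → ℂ) := φ.2.2

theorem cont (φ : TestFn) : Continuous (φ : ℝ → ℂ) := φ.contDiff.continuous

theorem differentiable (φ : TestFn) : Differentiable ℝ (φ : ℝ → ℂ) :=
  φ.contDiff.differentiable (by simp)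

/-- The derivative of a test function. -/
def D : TestFn →ₗ[ℂ] TestFn where
  toFun φ := ⟨deriv φ, (contDiff_infty_iff_deriv.1 φ.contDiff).2, φ.compact.deriv⟩
  map_add' φ χ := by
    ext y
    exact deriv_add (φ.differentiable y) (χ.differentiable y)
  map_smul' c φ := by
    ext y
    exact deriv_const_smul c (φ.differentiable y)

/-- Multiplication of a test function by the coordinate `y`. -/
def M : TestFn →ₗ[ℂ] TestFn where
  toFun φ := ⟨fun y => (y : ℂ) * φ.1 y, Complex.ofRealCLM.contDiff.mul φ.contDiff,
    φ.compact.mul_left⟩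
  map_add' φ χ := by
    ext y
    exact mul_add _ _ _
  map_smul' c φ := by
    ext y
    exact mul_left_comm _ _ _

/-- Complex conjugation of a test function. -/
def conj (φ : TestFn) : TestFn :=
  ⟨fun y => starRingEnd ℂ (φ.1 y), Complex.conjCLE.contDiff.comp φ.contDiff,
    φ.compact.comp_left (map_zero _)⟩

theorem D_M (φ : TestFn) : D (M φ) = φ + M (D φ) := by
  ext y
  have h1 : HasDerivAt (fun y : ℝ => (y : ℂ)) 1 y := Complex.ofRealCLM.hasDerivAt
  have h2 := (h1.mul (φ.differentiable y).hasDerivAt).deriv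
  change deriv (fun y : ℝ => (y : ℂ) * φ.1 y) y = φ.1 y + (y : ℂ) * deriv φ.1 y
  rw [one_mul] at h2
  exact h2

theorem memLp (φ : TestFn) (μ : Measure ℝ) [IsFiniteMeasureOnCompacts μ] :
    MemLp (φ : ℝ → ℂ) 2 μ :=
  φ.cont.memLp_of_hasCompactSupport φ.compact

end TestFn

instance : IsFiniteMeasureOnCompacts lineWeight := by
  constructor
  intro K hK
  rw [lineWeight, withDensity_apply' _ K]
  have h1 : IntegrableOn (fun y : ℝ => 1 + y ^ 2) K :=
    (by fun_prop : Continuous fun y : ℝ => 1 + y ^ 2).continuousOn.integrableOn_compact hK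
  exact h1.lintegral_lt_top

/-- Test functions as elements of `L²(μ)`. -/
def toL2 (μ : Measure ℝ) [IsFiniteMeasureOnCompacts μ] : TestFn →ₗ[ℂ] Lp ℂ 2 μ where
  toFun φ := (φ.memLp μ).toLp _
  map_add' _ _ := rfl
  map_smul' _ _ := rfl

theorem coeFn_toL2 (μ : Measure ℝ) [IsFiniteMeasureOnCompacts μ] (φ : TestFn) :
    toL2 μ φ =ᵐ[μ] (φ : ℝ → ℂ) := (φ.memLp μ).coeFn_toLp

/-- Test functions as elements of the weighted space. -/
abbrev toY : TestFn →ₗ[ℂ] Y := toL2 lineWeight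

/-- Test functions as elements of `L²`. -/
abbrev toZ : TestFn →ₗ[ℂ] Z := toL2 volume

theorem J0_toY (φ : TestFn) : J0 (toY φ) = toZ φ := by
  apply Lp.ext
  filter_upwards [coeFn_J0 (toY φ), volume_absolutelyContinuous.ae_le (coeFn_toL2 lineWeight φ),
    coeFn_toL2 volume φ] with y h1 h2 h3
  rw [h1, h2, h3]

theorem J1_toY (φ : TestFn) : J1 (toY φ) = toZ (TestFn.M φ) := by
  apply Lp.ext
  filter_upwards [coeFn_J1 (toY φ), volume_absolutelyContinuous.ae_le (coeFn_toL2 lineWeight φ),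
    coeFn_toL2 volume (TestFn.M φ)] with y h1 h2 h3
  rw [h1, h2, h3]
  rfl

theorem inner_toZ (φ : TestFn) (g : Z) :
    inner ℂ (toZ φ) g = ∫ y, starRingEnd ℂ (φ.1 y) * g y := by
  rw [L2.inner_def]
  apply integral_congr_ae
  filter_upwards [coeFn_toL2 volume φ] with y h1
  rw [h1, RCLike.inner_apply, mul_comm]

theorem inner_toZ_M (φ : TestFn) (g : Y) :
    inner ℂ (toZ (TestFn.M φ)) (J0 g) = inner ℂ (toZ φ) (J1 g) := by
  rw [inner_toZ, inner_toZ]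
  apply integral_congr_ae
  filter_upwards [coeFn_J0 g, coeFn_J1 g] with y h1 h2
  rw [h1, h2]
  change starRingEnd ℂ ((y : ℂ) * φ.1 y) * _ = _
  rw [map_mul, Complex.conj_ofReal]
  ring

/-- Multiplication by `y` is symmetric. -/
theorem inner_M_left (φ χ : TestFn) :
    inner ℂ (toZ (TestFn.M φ)) (toZ χ) = inner ℂ (toZ φ) (toZ (TestFn.M χ)) := by
  have := inner_toZ_M φ (toY χ)
  rwa [J0_toY, J1_toY] at this

/-- Integration by parts. -/
theorem inner_D_left (φ χ : TestFn) :
    inner ℂ (toZ (TestFn.D φ)) (toZ χ) = -inner ℂ (toZ φ) (toZ (TestFn.D χ)) := by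
  have key : ∀ φ χ : TestFn, inner ℂ (toZ φ) (toZ χ) = ∫ y, starRingEnd ℂ (φ.1 y) * χ.1 y := by
    intro φ χ
    rw [inner_toZ]
    apply integral_congr_ae
    filter_upwards [coeFn_toL2 volume χ] with y h1
    rw [h1]
  rw [key, key]
  have hd : ∀ φ : TestFn, ∀ y, HasDerivAt (fun y => starRingEnd ℂ (φ.1 y))
      (starRingEnd ℂ ((TestFn.D φ).1 y)) y := fun φ y =>
    (Complex.conjCLE : ℂ →L[ℝ] ℂ).hasFDerivAt.comp_hasDerivAt y (φ.differentiable y).hasDerivAt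
  have hint : ∀ φ χ : TestFn, Integrable (fun y => starRingEnd ℂ (φ.1 y) * χ.1 y) := fun φ χ =>
    ((Complex.continuous_conj.comp φ.cont).mul χ.cont).integrable_of_hasCompactSupport
      χ.compact.mul_left
  have h := integral_mul_deriv_eq_deriv_mul_of_integrable
    (u := fun y => starRingEnd ℂ (φ.1 y)) (v := χ.1)
    (u' := fun y => starRingEnd ℂ ((TestFn.D φ).1 y)) (v' := (TestFn.D χ).1)
    (fun y _ => hd φ y) (fun y _ => (χ.differentiable y).hasDerivAt) (hint _ _) (hint _ _)
    (hint _ _)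
  rw [h, neg_neg]

open TestFn

/-! ### Density of the range of Schrödinger operators -/

/-- The operator `φ ↦ φ'' - s φ - c y² φ` on test functions. -/
def schr (s c : ℂ) : TestFn →ₗ[ℂ] TestFn :=
  D.comp D - s • LinearMap.id - c • M.comp M

theorem schr_apply (s c : ℂ) (φ : TestFn) : schr s c φ = D (D φ) - s • φ - c • M (M φ) := rfl

/-- A real test function, viewed as a complex one. -/
def ofRealTest (φ : ℝ → ℝ) (hφ : ContDiff ℝ ∞ φ) (hc : HasCompactSupport φ) : TestFn :=
  ⟨fun y => (φ y : ℂ), Complex.ofRealCLM.contDiff.comp hφ, hc.comp_left Complex.ofReal_zero⟩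

theorem D_D_ofRealTest (φ : ℝ → ℝ) (hφ : ContDiff ℝ ∞ φ) (hc : HasCompactSupport φ) (y : ℝ) :
    (D (D (ofRealTest φ hφ hc))).1 y = ((deriv (deriv φ) y : ℝ) : ℂ) := by
  have h1 : ∀ χ : ℝ → ℝ, ContDiff ℝ ∞ χ →
      deriv (fun y => (χ y : ℂ)) = fun y => ((deriv χ y : ℝ) : ℂ) := fun χ hχ =>
    funext fun y => ((hχ.differentiable (by simp) y).hasDerivAt.ofReal_comp).deriv
  change deriv (deriv (fun y => (φ y : ℂ))) y = _
  rw [h1 φ hφ, h1 _ (contDiff_infty_iff_deriv.1 hφ).2]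

/-- Liouville property for the distributional adjoint of `schr s c`. -/
theorem ae_eq_const_of_integral_schr {G : ℝ → ℂ} {s c : ℂ} (hG : LocallyIntegrable G)
    (hs : 0 ≤ s.re) (hc : 0 ≤ c.re) (hint : Integrable fun y => ‖G y‖ ^ 2 / (1 + y ^ 2))
    (h : ∀ φ : TestFn, ∫ y, starRingEnd ℂ ((schr s c φ).1 y) * G y = 0) :
    ∃ z : ℂ, (∀ᵐ y, G y = z) ∧ s.re * ‖z‖ ^ 2 = 0 := by
  obtain ⟨z, hz, hz2⟩ := ae_eq_const_of_weak_solution (G := G)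
    (q := fun y => starRingEnd ℂ s + starRingEnd ℂ c * (y : ℂ) ^ 2) hG (by fun_prop)
    (fun y => by
      have h1 : (starRingEnd ℂ s + starRingEnd ℂ c * (y : ℂ) ^ 2).re = s.re + c.re * y ^ 2 := by
        rw [← Complex.ofReal_pow, Complex.add_re, Complex.re_mul_ofReal, Complex.conj_re,
          Complex.conj_re]
      rw [h1]; positivity)
    hint (fun φ hφ hφc => by
      have h1 := h (ofRealTest φ hφ hφc)
      have hqc : Continuous fun y : ℝ => starRingEnd ℂ s + starRingEnd ℂ c * (y : ℂ) ^ 2 := by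
        fun_prop
      have hqG : LocallyIntegrable fun y : ℝ =>
          (starRingEnd ℂ s + starRingEnd ℂ c * (y : ℂ) ^ 2) * G y := hG.continuous_smul hqc
      have hφ' := (contDiff_infty_iff_deriv.1 hφ).2
      rw [← sub_eq_zero, ← integral_sub
        (locallyIntegrable_smul hG (hφ'.continuous_deriv (by simp)) hφc.deriv.deriv)
        (locallyIntegrable_smul hqG hφ.continuous hφc), ← h1]
      congr 1
      ext y
      have h2 : (schr s c (ofRealTest φ hφ hφc)).1 y = ((deriv (deriv φ) y : ℝ) : ℂ) - s * φ y -
          c * (y * (y * φ y)) := by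
        rw [← D_D_ofRealTest φ hφ hφc]; rfl
      rw [h2]
      simp only [map_sub, map_mul, Complex.conj_ofReal, Complex.real_smul]
      ring)
  refine ⟨z, hz, ?_⟩
  simpa using hz2 0

theorem locallyIntegrable_of_memLp {f : ℝ → ℂ} (hf : MemLp f 2 volume) : LocallyIntegrable f :=
  hf.locallyIntegrable (by norm_num)

theorem integrable_norm_sq_div (f : Y) : Integrable fun y : ℝ => ‖J0 f y‖ ^ 2 / (1 + y ^ 2) := by
  refine (integrable_norm_sq (J0 f)).mono' ?_ (Eventually.of_forall fun y => ?_)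
  · simp only [div_eq_mul_inv]
    exact (integrable_norm_sq (J0 f)).1.mul
      (by fun_prop : Measurable fun y : ℝ => (1 + y ^ 2)⁻¹).aestronglyMeasurable
  · rw [Real.norm_eq_abs, abs_of_nonneg (by positivity)]
    exact div_le_self (by positivity) (by nlinarith [sq_nonneg y])

theorem J0_injective {f : Y} (h : J0 f = 0) : f = 0 := by
  apply Lp.ext
  apply lineWeight_absolutelyContinuous.ae_le
  filter_upwards [coeFn_J0 f, volume_absolutelyContinuous.ae_le (Lp.coeFn_zero ℂ 2 lineWeight),
    (Lp.coeFn_zero ℂ 2 (volume : Measure ℝ))] with y h1 h2 h3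
  rw [h2, ← h1, h, h3]

theorem const_eq_zero_of_ae {f : Y} {z : ℂ} (h : ∀ᵐ y, J0 f y = z) : z = 0 := by
  have h1 : Integrable (fun _ : ℝ => ‖z‖ ^ 2) :=
    (integrable_norm_sq (J0 f)).congr (by filter_upwards [h] with y hy; rw [hy])
  rw [integrable_const_iff] at h1
  rcases h1 with h1 | h1
  · simpa using h1
  · exact absurd h1.1 (by simp)

/-- Distributional solutions in the weighted space of `f'' = s f + c y² f` vanish. -/
theorem eq_zero_of_inner_schr {f : Y} {s c : ℂ} (hs : 0 ≤ s.re) (hc : 0 ≤ c.re)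
    (h : ∀ φ : TestFn, inner ℂ (toZ (schr s c φ)) (J0 f) = 0) : f = 0 := by
  obtain ⟨z, hz, -⟩ := ae_eq_const_of_integral_schr
    (locallyIntegrable_of_memLp (Lp.memLp (J0 f))) hs hc (integrable_norm_sq_div f)
    (fun φ => by rw [← inner_toZ]; exact h φ)
  have hz0 := const_eq_zero_of_ae hz
  apply J0_injective
  apply Lp.ext
  filter_upwards [hz, Lp.coeFn_zero ℂ 2 (volume : Measure ℝ)] with y h1 h2
  rw [h1, h2, hz0]; rfl

/-- The range of `schr s c` on test functions is dense in the weighted space: a function `v`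
orthogonal to it gives the distributional solution `(1 + y²) v` of the adjoint equation. -/
theorem denseRange_schr {s c : ℂ} (hs : 0 < s.re) (hc : 0 ≤ c.re) :
    DenseRange (toY.comp (schr s c)) := by
  have key : (LinearMap.range (toY.comp (schr s c))).topologicalClosure = ⊤ := by
    rw [Submodule.topologicalClosure_eq_top_iff, Submodule.eq_bot_iff]
    intro v hv
    rw [Submodule.mem_orthogonal] at hv
    set G : ℝ → ℂ := fun y => (1 + y ^ 2 : ℝ) • J0 v y with hG
    have hGl : LocallyIntegrable G :=
      (locallyIntegrable_of_memLp (Lp.memLp (J0 v))).continuous_smul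
        (by fun_prop : Continuous fun y : ℝ => (1 + y ^ 2 : ℝ))
    have hint : Integrable fun y => ‖G y‖ ^ 2 / (1 + y ^ 2) := by
      refine ((integrable_lineWeight_iff _).1 (integrable_norm_sq v)).congr ?_
      filter_upwards [coeFn_J0 v] with y hy
      have := one_add_sq_pos y
      rw [hG, norm_smul, Real.norm_eq_abs, abs_of_pos this, hy, smul_eq_mul]
      field_simp
    obtain ⟨z, hz, hz2⟩ := ae_eq_const_of_integral_schr hGl hs.le hc hint (fun φ => by
      have h1 := hv _ ⟨φ, rfl⟩
      rw [L2.inner_def, integral_lineWeight] at h1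
      rw [← h1]
      apply integral_congr_ae
      filter_upwards [coeFn_J0 v,
        volume_absolutelyContinuous.ae_le (coeFn_toL2 lineWeight (schr s c φ))] with y h2 h3
      simp only [LinearMap.comp_apply, hG]
      rw [h2, h3, RCLike.inner_apply, mul_comm, smul_mul_assoc])
    have hz0 : z = 0 := by
      rcases mul_eq_zero.1 hz2 with h | h
      · exact absurd h hs.ne'
      · simpa using h
    apply J0_injective
    apply Lp.ext
    filter_upwards [hz, Lp.coeFn_zero ℂ 2 (volume : Measure ℝ)] with y h1 h2
    rw [h2]
    rw [hG, hz0] at h1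
    exact (smul_eq_zero.1 h1).resolve_left (one_add_sq_pos y).ne'
  intro x
  have : x ∈ (LinearMap.range (toY.comp (schr s c))).topologicalClosure := by
    rw [key]; trivial
  exact this

/-! ### Energy identities for test functions -/

/-- The real part of the inner product of `L²`. -/
def rin (a b : Z) : ℝ := (inner ℂ a b).re

theorem rin_comm (a b : Z) : rin a b = rin b a := by
  rw [rin, rin, ← inner_conj_symm, Complex.conj_re]

theorem rin_self (a : Z) : rin a a = ‖a‖ ^ 2 := by
  rw [rin, ← RCLike.re_eq_complex_re, inner_self_eq_norm_sq]

theorem rin_add_left (a b c : Z) : rin (a + b) c = rin a c + rin b c := by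
  simp [rin, inner_add_left]

theorem rin_add_right (a b c : Z) : rin a (b + c) = rin a b + rin a c := by
  simp [rin, inner_add_right]

theorem rin_sub_left (a b c : Z) : rin (a - b) c = rin a c - rin b c := by
  simp [rin, inner_sub_left]

theorem rin_sub_right (a b c : Z) : rin a (b - c) = rin a b - rin a c := by
  simp [rin, inner_sub_right]

theorem rin_smul_left (r : ℝ) (a b : Z) : rin ((r : ℂ) • a) b = r * rin a b := by
  rw [rin, inner_smul_left, Complex.conj_ofReal, Complex.re_ofReal_mul]; rfl

theorem rin_smul_right (r : ℝ) (a b : Z) : rin a ((r : ℂ) • b) = r * rin a b := by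
  rw [rin, inner_smul_right, Complex.re_ofReal_mul]; rfl

theorem rin_I_left (a b : Z) : rin (Complex.I • a) b = -rin a (Complex.I • b) := by
  simp [rin, inner_smul_left, inner_smul_right]

theorem rin_I_I (a b : Z) : rin (Complex.I • a) (Complex.I • b) = rin a b := by
  rw [rin_I_left, smul_smul, Complex.I_mul_I, neg_one_smul]
  simp [rin]

theorem rin_I_self (a : Z) : rin (Complex.I • a) a = 0 := by
  have h1 := rin_I_left a a
  rw [rin_comm a] at h1
  linarith

theorem abs_rin_le (a b : Z) : |rin a b| ≤ ‖a‖ * ‖b‖ :=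
  (Complex.abs_re_le_norm _).trans (norm_inner_le_norm a b)

theorem rin_D_left (φ χ : TestFn) : rin (toZ (D φ)) (toZ χ) = -rin (toZ φ) (toZ (D χ)) := by
  rw [rin, inner_D_left]; simp [rin]

theorem rin_M_left (φ χ : TestFn) : rin (toZ (M φ)) (toZ χ) = rin (toZ φ) (toZ (M χ)) := by
  rw [rin, inner_M_left]; rfl

theorem rin_DD_self (φ : TestFn) : rin (toZ (D (D φ))) (toZ φ) = -‖toZ (D φ)‖ ^ 2 := by
  rw [rin_D_left, rin_self]

theorem rin_D_M (φ : TestFn) : rin (toZ (D φ)) (toZ (M φ)) = -(‖toZ φ‖ ^ 2 / 2) := by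
  have h1 := rin_D_left φ (M φ)
  rw [D_M, map_add, rin_add_right, rin_self, ← rin_M_left φ (D φ),
    rin_comm (toZ (M φ))] at h1
  linarith

theorem rin_DD_MM (φ : TestFn) :
    rin (toZ (D (D φ))) (toZ (M (M φ))) = ‖toZ φ‖ ^ 2 - ‖toZ (M (D φ))‖ ^ 2 := by
  have h1 := rin_D_M φ
  rw [rin_D_left, D_M, map_add, rin_add_right, D_M, map_add, map_add, rin_add_right,
    ← rin_M_left (D φ) (M (D φ)), rin_self, h1]
  ring

theorem norm_toY_sq (φ : TestFn) : ‖toY φ‖ ^ 2 = ‖toZ φ‖ ^ 2 + ‖toZ (M φ)‖ ^ 2 := by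
  rw [norm_sq_Y, J0_toY, J1_toY]

theorem re_inner_toY (φ χ : TestFn) : (inner ℂ (toY φ) (toY χ)).re =
    rin (toZ φ) (toZ χ) + rin (toZ (M φ)) (toZ (M χ)) := by
  rw [inner_Y, J0_toY, J0_toY, J1_toY, J1_toY, Complex.add_re]; rfl

/-! ### The operator on a single Fourier mode -/

/-- The Laplacian `∂_y² - j²` on the `j`-th Fourier mode. -/
def lapMode (j : ℤ) : TestFn →ₗ[ℂ] TestFn := schr ((j : ℂ) ^ 2) 0

theorem lapMode_apply (j : ℤ) (φ : TestFn) : lapMode j φ = D (D φ) - (j : ℂ) ^ 2 • φ := by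
  rw [lapMode, schr_apply, zero_smul, sub_zero]

/-- The local part `ν (∂_y² - j²) - i j y²` of the linearized operator on the `j`-th mode. -/
def locMode (ν : ℝ) (j : ℤ) : TestFn →ₗ[ℂ] TestFn :=
  (ν : ℂ) • lapMode j - (Complex.I * j) • M.comp M

theorem locMode_apply (ν : ℝ) (j : ℤ) (φ : TestFn) :
    locMode ν j φ = (ν : ℂ) • lapMode j φ - (Complex.I * j) • M (M φ) := rfl

/-- The operator `l - locMode ν j`. -/
def shiftMode (ν : ℝ) (j : ℤ) (l : ℝ) : TestFn →ₗ[ℂ] TestFn :=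
  (l : ℂ) • LinearMap.id - locMode ν j

theorem shiftMode_apply (ν : ℝ) (j : ℤ) (l : ℝ) (φ : TestFn) :
    shiftMode ν j l φ = (l : ℂ) • φ - locMode ν j φ := rfl

theorem shiftMode_eq_schr {ν : ℝ} (hν : 0 < ν) (j : ℤ) (l : ℝ) :
    shiftMode ν j l = (-ν : ℂ) • schr (l / ν + (j : ℂ) ^ 2) (Complex.I * j / ν) := by
  have hν' : (ν : ℂ) ≠ 0 := by exact_mod_cast hν.ne'
  ext1 φ
  rw [shiftMode_apply, locMode_apply, lapMode_apply, LinearMap.smul_apply, schr_apply]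
  match_scalars <;> field_simp
  ring

theorem re_shift_coeff {ν l : ℝ} (hν : 0 < ν) (hl : 0 < l) (j : ℤ) :
    0 < ((l : ℂ) / ν + (j : ℂ) ^ 2).re := by
  have : ((l : ℂ) / ν + (j : ℂ) ^ 2) = ((l / ν + (j : ℝ) ^ 2 : ℝ) : ℂ) := by push_cast; ring
  rw [this, Complex.ofReal_re]
  positivity

theorem re_I_mul_div (j : ℤ) (ν : ℝ) : (Complex.I * j / ν).re = 0 := by
  rw [Complex.div_ofReal_re]; simp

theorem denseRange_lapMode {j : ℤ} (hj : j ≠ 0) : DenseRange (toY.comp (lapMode j)) := by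
  apply denseRange_schr
  · have : ((j : ℂ) ^ 2) = (((j : ℝ) ^ 2 : ℝ) : ℂ) := by push_cast; ring
    rw [this, Complex.ofReal_re]
    have : (j : ℝ) ≠ 0 := by exact_mod_cast hj
    positivity
  · simp

theorem denseRange_shiftMode {ν l : ℝ} (hν : 0 < ν) (hl : 0 < l) (j : ℤ) :
    DenseRange (toY.comp (shiftMode ν j l)) := by
  have h1 := denseRange_schr (re_shift_coeff hν hl j) (re_I_mul_div j ν).ge
  have hν' : (-ν : ℂ) ≠ 0 := by simpa using hν.ne'
  have h2 : Set.range (toY.comp (shiftMode ν j l)) =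
      Set.range (toY.comp (schr (l / ν + (j : ℂ) ^ 2) (Complex.I * j / ν))) := by
    rw [shiftMode_eq_schr hν]
    ext x
    constructor
    · rintro ⟨φ, rfl⟩
      exact ⟨(-ν : ℂ) • φ, by simp only [map_smul, LinearMap.comp_apply, LinearMap.smul_apply]⟩
    · rintro ⟨φ, rfl⟩
      refine ⟨(-ν : ℂ)⁻¹ • φ, ?_⟩
      simp only [LinearMap.comp_apply, LinearMap.smul_apply, map_smul, smul_smul]
      rw [inv_mul_cancel₀ hν', one_smul]
  rw [DenseRange, h2]
  exact h1

/-- `l - locMode` is accretive up to a bounded term in the weighted space. -/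
theorem shiftMode_energy (ν : ℝ) (j : ℤ) (l : ℝ) (φ : TestFn) :
    (inner ℂ (toY (shiftMode ν j l φ)) (toY φ)).re = (l + ν * j ^ 2) * ‖toY φ‖ ^ 2 +
      ν * (‖toZ (D φ)‖ ^ 2 + ‖toZ (M (D φ))‖ ^ 2 - ‖toZ φ‖ ^ 2) := by
  have hsplit : shiftMode ν j l φ = ((l + ν * j ^ 2 : ℝ) : ℂ) • φ - (ν : ℂ) • D (D φ) +
      (j : ℝ) • (Complex.I • M (M φ)) := by
    rw [shiftMode_apply, locMode_apply, lapMode_apply]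
    have : ((j : ℝ) • (Complex.I • M (M φ)) : TestFn) = (Complex.I * j) • M (M φ) := by
      rw [mul_comm, mul_smul]
      ext y; simp
    rw [this]
    push_cast
    module
  have hI1 : (inner ℂ (toY ((j : ℝ) • (Complex.I • M (M φ)) : TestFn)) (toY φ)).re = 0 := by
    have h1 : ((j : ℝ) • (Complex.I • M (M φ)) : TestFn) =
        ((j : ℝ) : ℂ) • (Complex.I • M (M φ)) := rfl
    rw [h1, re_inner_toY, map_smul, map_smul, map_smul, map_smul, map_smul, map_smul,
      rin_smul_left, rin_smul_left, rin_I_left, rin_I_left, ← map_smul, ← map_smul,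
      rin_M_left, rin_M_left (M (M φ)), map_smul, map_smul, map_smul, map_smul, rin_comm,
      rin_I_self, rin_comm, rin_I_self]
    ring
  rw [hsplit, map_add, map_sub, map_smul, map_smul, inner_add_left, inner_sub_left, Complex.add_re,
    Complex.sub_re, hI1, inner_smul_left, inner_smul_left, Complex.conj_ofReal,
    Complex.conj_ofReal, Complex.re_ofReal_mul, Complex.re_ofReal_mul]
  have h2 : (inner ℂ (toY φ) (toY φ)).re = ‖toY φ‖ ^ 2 := by
    rw [← RCLike.re_eq_complex_re, inner_self_eq_norm_sq]
  have h3 := re_inner_toY (D (D φ)) φ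
  rw [rin_DD_self, rin_M_left, rin_DD_MM] at h3
  rw [h2, h3]
  ring

theorem shiftMode_energy_le {ν : ℝ} (hν : 0 < ν) (hν1 : ν < 1) (j : ℤ) (l : ℝ) (φ : TestFn) :
    (l - 1) * ‖toY φ‖ ^ 2 + ν * (‖toZ (D φ)‖ ^ 2 + ‖toZ (M (D φ))‖ ^ 2) ≤
      ‖toY (shiftMode ν j l φ)‖ * ‖toY φ‖ := by
  have h1 := shiftMode_energy ν j l φ
  have h2 := (Complex.re_le_norm _).trans (norm_inner_le_norm (𝕜 := ℂ) (toY (shiftMode ν j l φ)) (toY φ))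
  have h3 := norm_toY_sq φ
  have h4 : 0 ≤ ν * (j : ℝ) ^ 2 * ‖toY φ‖ ^ 2 := by positivity
  have h5 : ν * ‖toZ φ‖ ^ 2 ≤ ‖toY φ‖ ^ 2 := by
    nlinarith [sq_nonneg ‖toZ φ‖, sq_nonneg ‖toZ (M φ)‖]
  nlinarith

theorem norm_le_shiftMode {ν : ℝ} (hν : 0 < ν) (hν1 : ν < 1) (j : ℤ) (l : ℝ) (φ : TestFn) :
    (l - 1) * ‖toY φ‖ ≤ ‖toY (shiftMode ν j l φ)‖ := by
  have h1 := shiftMode_energy_le hν hν1 j l φ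
  have h2 : 0 ≤ ν * (‖toZ (D φ)‖ ^ 2 + ‖toZ (M (D φ))‖ ^ 2) := by positivity
  rcases (norm_nonneg (toY φ)).eq_or_lt with h | h
  · rw [← h, mul_zero]; exact norm_nonneg _
  · nlinarith

/-- The resolvent `(l - locMode ν j)⁻¹` on the weighted space. -/
def resMode (ν : ℝ) (j : ℤ) (l : ℝ) : Y →L[ℂ] Y :=
  toY.extendOfNorm (toY.comp (shiftMode ν j l))

section

variable {ν : ℝ} (hν : 0 < ν) (hν1 : ν < 1) {l : ℝ} (hl : 1 < l) (j : ℤ)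

include hν hν1 hl

theorem norm_toY_le_shiftMode (φ : TestFn) :
    ‖toY φ‖ ≤ (l - 1)⁻¹ * ‖(toY.comp (shiftMode ν j l)) φ‖ := by
  rw [← div_eq_inv_mul, le_div_iff₀ (by linarith), mul_comm]
  exact norm_le_shiftMode hν hν1 j l φ

theorem resMode_shiftMode (φ : TestFn) : resMode ν j l (toY (shiftMode ν j l φ)) = toY φ :=
  LinearMap.extendOfNorm_eq (denseRange_shiftMode hν (by linarith) j)
    ⟨_, norm_toY_le_shiftMode hν hν1 hl j⟩ φ

theorem norm_resMode_le (x : Y) : (l - 1) * ‖resMode ν j l x‖ ≤ ‖x‖ := by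
  have := LinearMap.norm_extendOfNorm_apply_le (denseRange_shiftMode hν (by linarith) j) _
    (norm_toY_le_shiftMode hν hν1 hl j) x
  rwa [← div_eq_inv_mul, le_div_iff₀ (by linarith), mul_comm] at this

end

/-- The real part of the commutator of `∂_y²` with `i y²`: the only cross term in
`‖ν φ'' - i j y² φ‖²`. -/
theorem rin_I_D_M (φ : TestFn) : rin (toZ (D (D φ))) (Complex.I • toZ (M (M φ))) =
    -2 * rin (toZ (D φ)) (Complex.I • toZ (M φ)) := by
  have h1 : rin (toZ (D φ)) (Complex.I • toZ (M (M (D φ)))) = 0 := by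
    rw [← map_smul, ← map_smul, ← rin_M_left, map_smul, rin_comm, rin_I_self]
  rw [← map_smul, rin_D_left, map_smul, map_smul, D_M, D_M, map_add M, map_add toZ, map_add toZ,
    smul_add, smul_add, rin_add_right, rin_add_right, h1]
  ring

/-- Maximal regularity of the local part: both `φ''` and `y² φ` are controlled by the graph norm, so
they extend continuously along the resolvent. The constant is irrelevant. -/
theorem norm_second_order_le {ν : ℝ} (hν : 0 < ν) (hν1 : ν < 1) {j : ℤ} (φ : TestFn) :
    (ν * ‖toZ (D (D φ))‖) ^ 2 + (j * ‖toZ (M (M φ))‖) ^ 2 ≤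
      ((3 + ν * j ^ 2) ^ 2 + 4 * |(j : ℝ)|) * ‖toY (shiftMode ν j 2 φ)‖ ^ 2 := by
  set x := ‖toY (shiftMode ν j 2 φ)‖ with hx
  have h1 := norm_le_shiftMode hν hν1 j 2 φ
  have h2 := shiftMode_energy_le hν hν1 j 2 φ
  have hx0 : 0 ≤ x := norm_nonneg _
  have hY0 : 0 ≤ ‖toY φ‖ := norm_nonneg _
  have hφx : ‖toY φ‖ ≤ x := by linarith
  have hD : ν * ‖toZ (D φ)‖ ^ 2 ≤ x ^ 2 := by
    have : 0 ≤ ν * ‖toZ (M (D φ))‖ ^ 2 := by positivity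
    nlinarith
  have hM : ‖toZ (M φ)‖ ≤ x := by
    rw [← J1_toY]; exact (norm_J1_le _).trans hφx
  -- The second order part is `(2 + ν j²) φ - x`.
  have hr : (ν : ℂ) • toZ (D (D φ)) - ((j : ℝ) : ℂ) • (Complex.I • toZ (M (M φ))) =
      ((2 + ν * j ^ 2 : ℝ) : ℂ) • toZ φ - toZ (shiftMode ν j 2 φ) := by
    rw [shiftMode_apply, locMode_apply, lapMode_apply]
    simp only [map_sub, map_smul]
    push_cast
    module
  have hr2 : ‖(ν : ℂ) • toZ (D (D φ)) - ((j : ℝ) : ℂ) • (Complex.I • toZ (M (M φ)))‖ ≤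
      (3 + ν * j ^ 2) * x := by
    rw [hr]
    refine (norm_sub_le _ _).trans ?_
    rw [norm_smul, Complex.norm_real, Real.norm_eq_abs, abs_of_pos (by positivity)]
    have h3 : ‖toZ φ‖ ≤ x := by
      rw [← J0_toY]; exact (norm_J0_le _).trans hφx
    have h4 : ‖toZ (shiftMode ν j 2 φ)‖ ≤ x := by
      rw [← J0_toY]; exact norm_J0_le _
    have h5 : 0 ≤ ν * (j : ℝ) ^ 2 := by positivity
    nlinarith
  have hexp : ‖(ν : ℂ) • toZ (D (D φ)) - ((j : ℝ) : ℂ) • (Complex.I • toZ (M (M φ)))‖ ^ 2 =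
      (ν * ‖toZ (D (D φ))‖) ^ 2 + (j * ‖toZ (M (M φ))‖) ^ 2 +
        4 * (ν * j * rin (toZ (D φ)) (Complex.I • toZ (M φ))) := by
    rw [← rin_self, rin_sub_left, rin_sub_right, rin_sub_right, rin_smul_left, rin_smul_left,
      rin_smul_left, rin_smul_left, rin_smul_right, rin_smul_right, rin_smul_right,
      rin_smul_right, rin_self, rin_self, rin_comm (Complex.I • _), rin_I_D_M, norm_smul,
      Complex.norm_I, one_mul]
    ring
  have hc : |ν * j * rin (toZ (D φ)) (Complex.I • toZ (M φ))| ≤ |(j : ℝ)| * x ^ 2 := by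
    rw [abs_mul, abs_mul, abs_of_pos hν]
    have h3 := abs_rin_le (toZ (D φ)) (Complex.I • toZ (M φ))
    rw [norm_smul, Complex.norm_I, one_mul] at h3
    have h4 : ν * (‖toZ (D φ)‖ * ‖toZ (M φ)‖) ≤ x ^ 2 := by
      have h5 : ‖toZ (M φ)‖ ^ 2 ≤ x ^ 2 := by gcongr
      have h6 : ν * ‖toZ (M φ)‖ ^ 2 ≤ x ^ 2 := by nlinarith [sq_nonneg ‖toZ (M φ)‖]
      nlinarith [mul_nonneg hν.le (sq_nonneg (‖toZ (D φ)‖ - ‖toZ (M φ)‖))]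
    calc _ = |(j : ℝ)| * (ν * |rin (toZ (D φ)) (Complex.I • toZ (M φ))|) := by ring
      _ ≤ |(j : ℝ)| * (ν * (‖toZ (D φ)‖ * ‖toZ (M φ)‖)) := by gcongr
      _ ≤ _ := by gcongr
  have h7 := abs_le.1 hc
  have h8 : ‖(ν : ℂ) • toZ (D (D φ)) - ((j : ℝ) : ℂ) • (Complex.I • toZ (M (M φ)))‖ ^ 2 ≤
      ((3 + ν * j ^ 2) * x) ^ 2 := by gcongr
  rw [hexp] at h8
  nlinarith [h7.1]

/-- The continuous extension to the weighted space of a linear map `F` of test functions precomposed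
with the resolvent: on the image of a test function `φ` under `2 - locMode` it takes the
value `F φ`. -/
def extMode (ν : ℝ) (j : ℤ) (F : TestFn →ₗ[ℂ] Z) : Y →L[ℂ] Z :=
  F.extendOfNorm (toY.comp (shiftMode ν j 2))

section

variable {ν : ℝ} (hν : 0 < ν) (hν1 : ν < 1) (j : ℤ)

include hν

theorem extMode_apply (F : TestFn →ₗ[ℂ] Z)
    (hF : ∃ C, ∀ φ, ‖F φ‖ ≤ C * ‖toY (shiftMode ν j 2 φ)‖) (φ : TestFn) :
    extMode ν j F (toY (shiftMode ν j 2 φ)) = F φ :=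
  LinearMap.extendOfNorm_eq (denseRange_shiftMode hν (by norm_num) j) hF φ

include hν1

theorem extMode_D (φ : TestFn) :
    extMode ν j (toZ.comp D) (toY (shiftMode ν j 2 φ)) = toZ (D φ) := by
  refine extMode_apply hν j _ ⟨√(1 / ν), fun φ => ?_⟩ φ
  have h1 := norm_le_shiftMode hν hν1 j 2 φ
  have h2 := shiftMode_energy_le hν hν1 j 2 φ
  have h3 : 0 ≤ ν * ‖toZ (M (D φ))‖ ^ 2 := by positivity
  refine abs_le_of_sq_le_sq' ?_ (by positivity) |>.2
  rw [mul_pow, Real.sq_sqrt (by positivity), div_mul_eq_mul_div, le_div_iff₀ hν]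
  change ‖toZ (D φ)‖ ^ 2 * ν ≤ _
  nlinarith [norm_nonneg (toY φ), norm_nonneg (toY (shiftMode ν j 2 φ))]

theorem extMode_MD (φ : TestFn) :
    extMode ν j (toZ.comp (M.comp D)) (toY (shiftMode ν j 2 φ)) = toZ (M (D φ)) := by
  refine extMode_apply hν j _ ⟨√(1 / ν), fun φ => ?_⟩ φ
  have h1 := norm_le_shiftMode hν hν1 j 2 φ
  have h2 := shiftMode_energy_le hν hν1 j 2 φ
  have h3 : 0 ≤ ν * ‖toZ (D φ)‖ ^ 2 := by positivity
  refine abs_le_of_sq_le_sq' ?_ (by positivity) |>.2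
  rw [mul_pow, Real.sq_sqrt (by positivity), div_mul_eq_mul_div, le_div_iff₀ hν]
  change ‖toZ (M (D φ))‖ ^ 2 * ν ≤ _
  nlinarith [norm_nonneg (toY φ), norm_nonneg (toY (shiftMode ν j 2 φ))]

theorem extMode_DD (φ : TestFn) :
    extMode ν j (toZ.comp (D.comp D)) (toY (shiftMode ν j 2 φ)) = toZ (D (D φ)) := by
  set K := (3 + ν * (j : ℝ) ^ 2) ^ 2 + 4 * |(j : ℝ)| with hK
  have hK0 : 0 ≤ K := by positivity
  refine extMode_apply hν j _ ⟨√(K / ν ^ 2), fun φ => ?_⟩ φ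
  have h1 := norm_second_order_le hν hν1 (j := j) φ
  have h3 : 0 ≤ (j * ‖toZ (M (M φ))‖) ^ 2 := by positivity
  refine abs_le_of_sq_le_sq' ?_ (by positivity) |>.2
  rw [mul_pow, Real.sq_sqrt (by positivity), div_mul_eq_mul_div, le_div_iff₀ (by positivity)]
  change ‖toZ (D (D φ))‖ ^ 2 * ν ^ 2 ≤ _
  rw [← hK] at h1
  nlinarith

theorem extMode_MM (hj : j ≠ 0) (φ : TestFn) :
    extMode ν j (toZ.comp (M.comp M)) (toY (shiftMode ν j 2 φ)) = toZ (M (M φ)) := by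
  set K := (3 + ν * (j : ℝ) ^ 2) ^ 2 + 4 * |(j : ℝ)| with hK
  have hK0 : 0 ≤ K := by positivity
  have hj' : (j : ℝ) ≠ 0 := by exact_mod_cast hj
  refine extMode_apply hν j _ ⟨√(K / j ^ 2), fun φ => ?_⟩ φ
  have h1 := norm_second_order_le hν hν1 (j := j) φ
  have h3 : 0 ≤ (ν * ‖toZ (D (D φ))‖) ^ 2 := by positivity
  refine abs_le_of_sq_le_sq' ?_ (by positivity) |>.2
  rw [mul_pow, Real.sq_sqrt (by positivity), div_mul_eq_mul_div, le_div_iff₀ (by positivity)]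
  change ‖toZ (M (M φ))‖ ^ 2 * (j : ℝ) ^ 2 ≤ _
  rw [← hK] at h1
  nlinarith

end

/-- Density of the image of test functions under `2 - locMode`, in the form of an induction
principle for closed conditions. -/
theorem shiftMode_induction {ν : ℝ} (hν : 0 < ν) {l : ℝ} (hl : 0 < l) (j : ℤ) {P : Y → Prop}
    (hP : IsClosed {x | P x}) (h : ∀ φ : TestFn, P (toY (shiftMode ν j l φ))) (x : Y) : P x :=
  (denseRange_shiftMode hν hl j).induction (fun _ ⟨φ, hφ⟩ => hφ ▸ h φ) hP x

theorem lapMode_induction {j : ℤ} (hj : j ≠ 0) {P : Y → Prop}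
    (hP : IsClosed {x | P x}) (h : ∀ φ : TestFn, P (toY (lapMode j φ))) (x : Y) : P x :=
  (denseRange_lapMode hj).induction (fun _ ⟨φ, hφ⟩ => hφ ▸ h φ) hP x

/-! ### The stream function -/

theorem lapMode_energy (j : ℤ) (φ : TestFn) :
    rin (toZ (lapMode j φ)) (toZ φ) = -‖toZ (D φ)‖ ^ 2 - j ^ 2 * ‖toZ φ‖ ^ 2 := by
  have h0 : ((j : ℂ) ^ 2) = (((j : ℝ) ^ 2 : ℝ) : ℂ) := by push_cast; ring
  rw [lapMode_apply, map_sub, map_smul, h0, rin_sub_left, rin_smul_left, rin_DD_self, rin_self]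

theorem lapMode_energy_Y (j : ℤ) (φ : TestFn) :
    (inner ℂ (toY (lapMode j φ)) (toY φ)).re = -‖toZ (D φ)‖ ^ 2 - ‖toZ (M (D φ))‖ ^ 2 +
      ‖toZ φ‖ ^ 2 - j ^ 2 * ‖toY φ‖ ^ 2 := by
  have h0 : ((j : ℂ) ^ 2) = (((j : ℝ) ^ 2 : ℝ) : ℂ) := by push_cast; ring
  rw [lapMode_apply, map_sub, map_smul, h0, inner_sub_left, inner_smul_left, Complex.conj_ofReal,
    Complex.sub_re, Complex.re_ofReal_mul, re_inner_toY, rin_DD_self, rin_M_left, rin_DD_MM,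
    ← RCLike.re_eq_complex_re, inner_self_eq_norm_sq]
  ring

section

variable {j : ℤ} (hj : j ≠ 0)

include hj

theorem one_le_sq_int : (1 : ℝ) ≤ (j : ℝ) ^ 2 := by
  have : 1 ≤ j ^ 2 := by
    have := sq_abs j
    have h2 := Int.one_le_abs hj
    nlinarith
  exact_mod_cast this

theorem norm_toZ_le_lapMode (φ : TestFn) :
    j ^ 2 * ‖toZ φ‖ ≤ ‖toZ (lapMode j φ)‖ ∧
      ‖toZ (D φ)‖ ^ 2 ≤ ‖toZ (lapMode j φ)‖ ^ 2 := by
  have h1 := lapMode_energy j φ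
  have h2 := (abs_le.1 (abs_rin_le (toZ (lapMode j φ)) (toZ φ))).1
  have h3 := norm_nonneg (toZ φ)
  have h5 := norm_nonneg (toZ (lapMode j φ))
  have hj1 := one_le_sq_int hj
  have h4 : j ^ 2 * ‖toZ φ‖ ≤ ‖toZ (lapMode j φ)‖ := by
    rcases h3.eq_or_lt with h | h
    · rw [← h, mul_zero]; exact norm_nonneg _
    · nlinarith [sq_nonneg ‖toZ (D φ)‖]
  refine ⟨h4, ?_⟩
  have h6 : ‖toZ φ‖ ≤ ‖toZ (lapMode j φ)‖ := by nlinarith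
  have h7 : 0 ≤ (j : ℝ) ^ 2 * ‖toZ φ‖ ^ 2 := by positivity
  nlinarith

/-- The factor `|j|` gained by the inverse Laplacian absorbs the `∂_x` in `∂_x Δ⁻¹`, which makes
`velMode j` bounded uniformly in `j`. -/
theorem norm_toY_le_lapMode (φ : TestFn) :
    |(j : ℝ)| * ‖toY φ‖ ≤ 2 * ‖toY (lapMode j φ)‖ := by
  have h1 := lapMode_energy_Y j φ
  have h2 := (abs_le.1 ((Complex.abs_re_le_norm _).trans
    (norm_inner_le_norm (𝕜 := ℂ) (toY (lapMode j φ)) (toY φ)))).1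
  have hj1 := one_le_sq_int hj
  have h3 : ‖toZ φ‖ ≤ ‖toY (lapMode j φ)‖ := by
    have h4 := (norm_toZ_le_lapMode hj φ).1
    have h5 : ‖toZ (lapMode j φ)‖ ≤ ‖toY (lapMode j φ)‖ := by
      rw [← J0_toY]; exact norm_J0_le _
    nlinarith [norm_nonneg (toZ φ)]
  have hja : 1 ≤ |(j : ℝ)| := by
    rw [← Int.cast_abs]; exact_mod_cast Int.one_le_abs hj
  set a := |(j : ℝ)| * ‖toY φ‖ with ha
  set U := ‖toY (lapMode j φ)‖ with hU
  have hU0 : 0 ≤ U := norm_nonneg _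
  have ha0 : 0 ≤ a := by positivity
  have h4 : a ^ 2 ≤ U * ‖toY φ‖ + ‖toZ φ‖ ^ 2 := by
    have : a ^ 2 = j ^ 2 * ‖toY φ‖ ^ 2 := by rw [ha, mul_pow, sq_abs]
    rw [this]
    nlinarith [sq_nonneg ‖toZ (D φ)‖, sq_nonneg ‖toZ (M (D φ))‖]
  have h5 : ‖toY φ‖ ≤ a := by
    rw [ha]; nlinarith [norm_nonneg (toY φ)]
  have h6 : ‖toZ φ‖ ^ 2 ≤ U ^ 2 := by gcongr
  nlinarith

end

/-- The inverse Laplacian `(∂_y² - j²)⁻¹` on the weighted space, for `j ≠ 0`: it maps the vorticity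
to the stream function. -/
def stream (j : ℤ) : Y →L[ℂ] Y := toY.extendOfNorm (toY.comp (lapMode j))

/-- The derivative `∂_y (∂_y² - j²)⁻¹` of the stream function, for `j ≠ 0`. -/
def dstream (j : ℤ) : Y →L[ℂ] Z := (toZ.comp D).extendOfNorm (toY.comp (lapMode j))

/-- The operator `∂_x Δ⁻¹` on the `j`-th Fourier mode. -/
def velMode (j : ℤ) : Y →L[ℂ] Y := if j = 0 then 0 else (Complex.I * j) • stream j

section

variable {j : ℤ} (hj : j ≠ 0)

include hj

theorem norm_toY_le_lapMode' (φ : TestFn) :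
    ‖toY φ‖ ≤ (2 / |(j : ℝ)|) * ‖(toY.comp (lapMode j)) φ‖ := by
  have hj' : 0 < |(j : ℝ)| := abs_pos.2 (by exact_mod_cast hj)
  rw [div_mul_eq_mul_div, le_div_iff₀ hj', mul_comm]
  exact norm_toY_le_lapMode hj φ

theorem stream_lapMode (φ : TestFn) : stream j (toY (lapMode j φ)) = toY φ :=
  LinearMap.extendOfNorm_eq (denseRange_lapMode hj) ⟨_, norm_toY_le_lapMode' hj⟩ φ

theorem dstream_lapMode (φ : TestFn) : dstream j (toY (lapMode j φ)) = toZ (D φ) := by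
  refine LinearMap.extendOfNorm_eq (denseRange_lapMode hj) ⟨1, fun φ => ?_⟩ φ
  rw [one_mul]
  have h1 : ‖toZ (lapMode j φ)‖ ≤ ‖toY (lapMode j φ)‖ := by
    rw [← J0_toY]; exact norm_J0_le _
  refine le_trans ?_ h1
  exact abs_le_of_sq_le_sq' (norm_toZ_le_lapMode hj φ).2 (norm_nonneg _) |>.2

end

theorem norm_velMode_le (j : ℤ) (f : Y) : ‖velMode j f‖ ≤ 2 * ‖f‖ := by
  rw [velMode]
  split_ifs with hj
  · simp
  · have hj' : 0 < |(j : ℝ)| := abs_pos.2 (by exact_mod_cast hj)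
    have h1 := LinearMap.norm_extendOfNorm_apply_le (denseRange_lapMode hj) _
      (norm_toY_le_lapMode' hj) f
    rw [div_mul_eq_mul_div, le_div_iff₀ hj', mul_comm] at h1
    have h2 : ‖Complex.I * (j : ℂ)‖ = |(j : ℝ)| := by
      rw [norm_mul, Complex.norm_I, one_mul, Complex.norm_intCast]
    rw [smul_apply, norm_smul, h2]
    exact h1

/-! ### The resolvent of the full operator on a mode -/

/-- The `j`-th Fourier mode of the relation `g = 𝓛 f`, `h = ∂ₓ Δ⁻¹ f`, in the sense of
distributions on the line. -/
def ModeRel (ν : ℝ) (j : ℤ) (f h g : Y) : Prop :=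
  (∀ φ : TestFn, inner ℂ (toZ (lapMode j φ)) (J0 h) =
      (Complex.I * j) * inner ℂ (toZ φ) (J0 f)) ∧
    ∀ φ : TestFn, inner ℂ (toZ φ) (J0 g) =
      inner ℂ (toZ ((ν : ℂ) • lapMode j φ + (Complex.I * j) • M (M φ))) (J0 f) +
        2 * inner ℂ (toZ φ) (J0 h)

theorem inner_lapMode (j : ℤ) (φ χ : TestFn) :
    inner ℂ (toZ (lapMode j φ)) (toZ χ) = inner ℂ (toZ φ) (toZ (lapMode j χ)) := by
  have h0 : ((j : ℂ) ^ 2) = (((j : ℝ) ^ 2 : ℝ) : ℂ) := by push_cast; ring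
  rw [lapMode_apply, lapMode_apply, map_sub, map_sub, map_smul, map_smul, inner_sub_left,
    inner_sub_right, inner_D_left, inner_D_left, inner_smul_left, inner_smul_right, h0,
    Complex.conj_ofReal, neg_neg]

theorem inner_adjoint_shiftMode (ν : ℝ) (j : ℤ) (l : ℝ) (φ χ : TestFn) :
    inner ℂ (toZ ((l : ℂ) • φ - ((ν : ℂ) • lapMode j φ + (Complex.I * j) • M (M φ)))) (toZ χ) =
      inner ℂ (toZ φ) (toZ (shiftMode ν j l χ)) := by
  rw [shiftMode_apply, locMode_apply]
  simp only [map_sub, map_add, map_smul, inner_sub_left, inner_add_left, inner_sub_right,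
    inner_smul_left, inner_smul_right, inner_lapMode, inner_M_left, Complex.conj_ofReal, map_mul,
    Complex.conj_I, map_intCast]
  ring

theorem adjoint_shiftMode_eq_schr {ν : ℝ} (hν : 0 < ν) (j : ℤ) (l : ℝ) (φ : TestFn) :
    (l : ℂ) • φ - ((ν : ℂ) • lapMode j φ + (Complex.I * j) • M (M φ)) =
      (-ν : ℂ) • schr (l / ν + (j : ℂ) ^ 2) (-(Complex.I * j / ν)) φ := by
  have hν' : (ν : ℂ) ≠ 0 := by exact_mod_cast hν.ne'
  rw [lapMode_apply, schr_apply]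
  match_scalars <;> field_simp
  ring

theorem eq_zero_of_inner_lapMode {f : Y} {j : ℤ}
    (h : ∀ φ : TestFn, inner ℂ (toZ (lapMode j φ)) (J0 f) = 0) : f = 0 := by
  refine eq_zero_of_inner_schr (s := (j : ℂ) ^ 2) (c := 0) ?_ (by simp) h
  have : ((j : ℂ) ^ 2) = (((j : ℝ) ^ 2 : ℝ) : ℂ) := by push_cast; ring
  rw [this, Complex.ofReal_re]
  positivity

theorem velMode_weak (j : ℤ) (f : Y) (φ : TestFn) :
    inner ℂ (toZ (lapMode j φ)) (J0 (velMode j f)) =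
      (Complex.I * j) * inner ℂ (toZ φ) (J0 f) := by
  rw [velMode]
  split_ifs with hj
  · simp [hj]
  · refine lapMode_induction hj (P := fun f => inner ℂ (toZ (lapMode j φ))
      (J0 (((Complex.I * j) • stream j) f)) = (Complex.I * j) * inner ℂ (toZ φ) (J0 f))
      (isClosed_eq (by fun_prop) (by fun_prop)) (fun χ => ?_) f
    rw [smul_apply, stream_lapMode hj, map_smul, J0_toY, J0_toY, inner_smul_right, inner_lapMode]

/-- Uniqueness of `∂_x Δ⁻¹ f` on a mode. -/
theorem ModeRel.eq_velMode {ν : ℝ} {j : ℤ} {f h g : Y} (H : ModeRel ν j f h g) :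
    h = velMode j f := by
  rw [← sub_eq_zero]
  refine eq_zero_of_inner_lapMode (j := j) fun φ => ?_
  rw [map_sub, inner_sub_right, H.1 φ, velMode_weak, sub_self]

section

variable {ν : ℝ} (hν : 0 < ν) (hν1 : ν < 1) {l : ℝ} (hl : 1 < l) (j : ℤ)

include hν hν1 hl

/-- `resMode ν j l x` is a distributional solution of `(l - locMode ν j) f = x`. -/
theorem resMode_weak (x : Y) (φ : TestFn) :
    inner ℂ (toZ ((l : ℂ) • φ - ((ν : ℂ) • lapMode j φ + (Complex.I * j) • M (M φ))))
      (J0 (resMode ν j l x)) = inner ℂ (toZ φ) (J0 x) := by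
  refine shiftMode_induction hν (show 0 < l by linarith) j (P := fun x => inner ℂ
    (toZ ((l : ℂ) • φ - ((ν : ℂ) • lapMode j φ + (Complex.I * j) • M (M φ))))
      (J0 (resMode ν j l x)) = inner ℂ (toZ φ) (J0 x))
    (isClosed_eq (by fun_prop) (by fun_prop)) (fun χ => ?_) x
  rw [resMode_shiftMode hν hν1 hl, J0_toY, J0_toY, inner_adjoint_shiftMode]

/-- The distributional domain is not larger than the range of the resolvent: by uniqueness for the
distributional equation, every `f` in it is reached from test functions in the graph norm. -/
theorem ModeRel.eq_resMode {f h g : Y} (H : ModeRel ν j f h g) :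
    f = resMode ν j l ((l : ℂ) • f - g + (2 : ℂ) • velMode j f) := by
  rw [← sub_eq_zero]
  refine eq_zero_of_inner_schr (s := l / ν + (j : ℂ) ^ 2) (c := -(Complex.I * j / ν))
    (re_shift_coeff hν (by linarith) j).le (by rw [Complex.neg_re, re_I_mul_div]; simp)
    fun φ => ?_
  have hν' : (-ν : ℂ) ≠ 0 := by simpa using hν.ne'
  have h1 := resMode_weak hν hν1 hl j ((l : ℂ) • f - g + (2 : ℂ) • velMode j f) φ
  have h2 : inner ℂ (toZ ((l : ℂ) • φ - ((ν : ℂ) • lapMode j φ + (Complex.I * j) • M (M φ))))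
      (J0 f) = inner ℂ (toZ φ) (J0 ((l : ℂ) • f - g + (2 : ℂ) • velMode j f)) := by
    have h3 := H.2 φ
    rw [H.eq_velMode] at h3
    rw [map_sub toZ, inner_sub_left, map_smul toZ, inner_smul_left, Complex.conj_ofReal, map_add J0,
      map_sub J0, map_smul J0, map_smul J0, inner_add_right, inner_sub_right, inner_smul_right,
      inner_smul_right, h3]
    ring
  have h3 : inner ℂ (toZ ((l : ℂ) • φ - ((ν : ℂ) • lapMode j φ + (Complex.I * j) • M (M φ))))
      (J0 (f - resMode ν j l ((l : ℂ) • f - g + (2 : ℂ) • velMode j f))) = 0 := by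
    rw [map_sub J0, inner_sub_right, h1, h2, sub_self]
  rw [adjoint_shiftMode_eq_schr hν, map_smul, inner_smul_left] at h3
  rcases mul_eq_zero.1 h3 with h | h
  · exact absurd h (by simpa using hν.ne')
  · exact h

end

section

variable {ν : ℝ} (hν : 0 < ν) (hν1 : ν < 1) {l : ℝ} (hl : 5 < l) (j : ℤ)

include hν hν1 hl

/-- Resolvent bound for the full operator on a mode. -/
theorem ModeRel.norm_le {f h g : Y} (H : ModeRel ν j f h g) :
    (l - 5) * ‖f‖ ≤ ‖(l : ℂ) • f - g‖ := by
  have h1 := norm_resMode_le hν hν1 (show 1 < l by linarith) j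
    ((l : ℂ) • f - g + (2 : ℂ) • velMode j f)
  rw [← H.eq_resMode hν hν1 (by linarith)] at h1
  have h2 := norm_add_le ((l : ℂ) • f - g) ((2 : ℂ) • velMode j f)
  have h3 := norm_velMode_le j f
  rw [norm_smul, Complex.norm_two] at h2
  linarith

/-- Solvability of the resolvent equation for the full operator on a mode, by a Neumann series. -/
theorem exists_resMode_eq (g : Y) : ∃ x : Y, x - (2 : ℂ) • velMode j (resMode ν j l x) = g ∧
    (l - 5) * ‖resMode ν j l x‖ ≤ ‖g‖ := by
  set t : Y →L[ℂ] Y := (2 : ℂ) • (velMode j).comp (resMode ν j l) with ht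
  have hbd : ∀ x, ‖t x‖ ≤ (4 / (l - 1)) * ‖x‖ := by
    intro x
    have h1 := norm_resMode_le hν hν1 (show 1 < l by linarith) j x
    have h2 := norm_velMode_le j (resMode ν j l x)
    rw [ht, smul_apply, norm_smul, Complex.norm_two, ContinuousLinearMap.comp_apply,
      div_mul_eq_mul_div, le_div_iff₀ (by linarith)]
    nlinarith
  have hlt : ‖t‖ < 1 :=
    lt_of_le_of_lt (t.opNorm_le_bound (by apply div_nonneg <;> linarith) hbd) (by
      rw [div_lt_one (by linarith)]; linarith)
  let u := Units.oneSub t hlt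
  have hu : ∀ g, (u : Y →L[ℂ] Y) ((↑u⁻¹ : Y →L[ℂ] Y) g) = g := by
    intro g
    have := congrArg (fun T : Y →L[ℂ] Y => T g) u.mul_inv
    exact this
  refine ⟨(↑u⁻¹ : Y →L[ℂ] Y) g, ?_, ?_⟩
  · have := hu g
    exact this
  · set x := (↑u⁻¹ : Y →L[ℂ] Y) g with hx
    have h0 : x - (2 : ℂ) • velMode j (resMode ν j l x) = g := hu g
    have h1 := norm_resMode_le hν hν1 (show 1 < l by linarith) j x
    have h2 := norm_velMode_le j (resMode ν j l x)
    have h3 : ‖x‖ ≤ ‖g‖ + 2 * ‖velMode j (resMode ν j l x)‖ := by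
      rw [← h0]
      have := norm_add_le (x - (2 : ℂ) • velMode j (resMode ν j l x))
        ((2 : ℂ) • velMode j (resMode ν j l x))
      rw [sub_add_cancel, norm_smul, Complex.norm_two] at this
      exact this
    linarith

end

/-- Test functions are dense in the weighted space. -/
theorem denseRange_toY : DenseRange toY := by
  have h := denseRange_shiftMode (ν := 1) one_pos (l := 1) one_pos 0
  refine h.mono ?_
  rintro _ ⟨φ, rfl⟩
  exact ⟨_, rfl⟩

/-! ### Identities for the stream function -/

theorem continuous_rin {T : Type*} [TopologicalSpace T] {a b : T → Z} (ha : Continuous a)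
    (hb : Continuous b) : Continuous fun t => rin (a t) (b t) :=
  Complex.continuous_re.comp (ha.inner hb)

section Stream

variable {j : ℤ} (hj : j ≠ 0)

include hj

theorem inner_stream_self (f : Y) : inner ℂ (J0 f) (J0 (stream j f)) =
    ((-‖dstream j f‖ ^ 2 - j ^ 2 * ‖J0 (stream j f)‖ ^ 2 : ℝ) : ℂ) := by
  refine lapMode_induction hj (P := fun f => inner ℂ (J0 f) (J0 (stream j f)) =
    ((-‖dstream j f‖ ^ 2 - j ^ 2 * ‖J0 (stream j f)‖ ^ 2 : ℝ) : ℂ))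
    (isClosed_eq (by fun_prop) (by fun_prop)) (fun χ => ?_) f
  rw [stream_lapMode hj, dstream_lapMode hj, J0_toY, J0_toY, lapMode_apply, map_sub, map_smul,
    inner_sub_left, inner_D_left, inner_smul_left, inner_self_eq_norm_sq_to_K,
    inner_self_eq_norm_sq_to_K]
  push_cast
  simp

theorem rin_stream_self (f : Y) : rin (J0 f) (J0 (stream j f)) =
    -‖dstream j f‖ ^ 2 - j ^ 2 * ‖J0 (stream j f)‖ ^ 2 := by
  rw [rin, inner_stream_self hj, Complex.ofReal_re]

theorem rin_I_stream_self (f : Y) : rin (Complex.I • J0 (stream j f)) (J0 f) = 0 := by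
  rw [rin_comm, rin, inner_smul_right, inner_stream_self hj, Complex.re_mul_ofReal]
  simp

/-- With `f = Δψ` this is `Re ⟨ψ', y f⟩`, from which integration by parts removes the weight `y`. It
provides the dissipation of `‖∂_y ψ‖²` in the hypocoercive form. -/
theorem rin_dstream (f : Y) : rin (dstream j f) (J1 f) =
    -(‖dstream j f‖ ^ 2 / 2) + j ^ 2 * ‖J0 (stream j f)‖ ^ 2 / 2 := by
  refine lapMode_induction hj (P := fun f => rin (dstream j f) (J1 f) =
    -(‖dstream j f‖ ^ 2 / 2) + j ^ 2 * ‖J0 (stream j f)‖ ^ 2 / 2)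
    (isClosed_eq (continuous_rin (by fun_prop) (by fun_prop)) (by fun_prop)) (fun χ => ?_) f
  have h0 : ((j : ℂ) ^ 2) = (((j : ℝ) ^ 2 : ℝ) : ℂ) := by push_cast; ring
  rw [stream_lapMode hj, dstream_lapMode hj, J0_toY, J1_toY, lapMode_apply, map_sub, map_sub,
    map_smul, map_smul, h0, rin_sub_right, rin_smul_right, rin_D_M, ← rin_M_left, rin_comm, rin_D_M]
  ring

theorem rin_lapMode_stream (f : Y) (φ : TestFn) :
    rin (toZ (lapMode j φ)) (J0 (stream j f)) = rin (toZ φ) (J0 f) := by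
  refine lapMode_induction hj (P := fun f => rin (toZ (lapMode j φ)) (J0 (stream j f)) =
    rin (toZ φ) (J0 f)) (isClosed_eq (continuous_rin (by fun_prop) (by fun_prop))
    (continuous_rin (by fun_prop) (by fun_prop))) (fun χ => ?_) f
  rw [stream_lapMode hj, J0_toY, J0_toY, rin, inner_lapMode]; rfl

theorem rin_stream_M_D (f : Y) (φ : TestFn) : rin (J0 (stream j f)) (toZ (M (D φ))) =
    -rin (J0 (stream j f)) (toZ φ) - rin (dstream j f) (toZ (M φ)) := by
  refine lapMode_induction hj (P := fun f => rin (J0 (stream j f)) (toZ (M (D φ))) =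
    -rin (J0 (stream j f)) (toZ φ) - rin (dstream j f) (toZ (M φ)))
    (isClosed_eq (continuous_rin (by fun_prop) (by fun_prop))
    (((continuous_rin (by fun_prop) (by fun_prop)).neg).sub
      (continuous_rin (by fun_prop) (by fun_prop)))) (fun χ => ?_) f
  rw [stream_lapMode hj, dstream_lapMode hj, J0_toY, rin_D_left, D_M, map_add, rin_add_right]
  ring

/-- The elliptic estimate `‖∇ψ‖² ≤ ‖f‖²` for `f = Δψ` on a nonzero mode. -/
theorem norm_stream_le (f : Y) : ‖dstream j f‖ ^ 2 + j ^ 2 * ‖J0 (stream j f)‖ ^ 2 ≤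
    ‖J0 f‖ ^ 2 := by
  have h1 := rin_stream_self hj f
  have h2 := (abs_le.1 (abs_rin_le (J0 f) (J0 (stream j f)))).1
  have hj1 := one_le_sq_int hj
  have h3 : ‖J0 (stream j f)‖ ≤ ‖J0 f‖ := by
    by_contra! hlt
    have h4 : 0 < ‖J0 (stream j f)‖ := (norm_nonneg _).trans_lt hlt
    nlinarith [sq_nonneg ‖dstream j f‖]
  nlinarith [norm_nonneg (J0 f)]

/-- The form dissipates only `‖y f‖²` and `‖∂_y ψ‖²`; these two control the rest of `‖∇ψ‖²`. -/
theorem sq_stream_le (f : Y) : j ^ 2 * ‖J0 (stream j f)‖ ^ 2 ≤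
    2 * ‖dstream j f‖ ^ 2 + ‖J1 f‖ ^ 2 := by
  have h1 := rin_dstream hj f
  have h2 := (abs_le.1 (abs_rin_le (dstream j f) (J1 f))).2
  nlinarith [sq_nonneg (‖dstream j f‖ - ‖J1 f‖)]

end Stream

/-! ### Energy functionals -/

/-- The operator of the `j`-th mode at the point `resMode ν j 2 x` of its domain. -/
def genMode (ν : ℝ) (j : ℤ) : Y →L[ℂ] Y :=
  (2 : ℂ) • resMode ν j 2 - ContinuousLinearMap.id ℂ Y +
    (2 : ℂ) • (velMode j).comp (resMode ν j 2)

/-- The symmetric operator of the quadratic form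
`‖u‖² + ‖y u‖² + 2 ‖∇ψ‖²`, at the point `u = resMode ν j 2 x`. -/
def energyOp (ν : ℝ) (j : ℤ) : Y →L[ℂ] Z :=
  J0.comp (resMode ν j 2) + extMode ν j (toZ.comp (M.comp M)) -
    (2 : ℂ) • J0.comp ((stream j).comp (resMode ν j 2))

/-- The symmetric operator of the hypocoercive quadratic form
`½ ‖u‖² + (d/8) ‖u'‖² + (σ/8) Re ⟨i y u, u'⟩ + (1/4d) (½ ‖y u‖² + ‖∇ψ‖²)`, at the point
`u = resMode ν j 2 x`. -/
def hypoOp (ν : ℝ) (j : ℤ) (d σ : ℝ) : Y →L[ℂ] Z :=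
  ((1 / 2 : ℝ) : ℂ) • J0.comp (resMode ν j 2) - ((d / 8 : ℝ) : ℂ) • extMode ν j (toZ.comp (D.comp D)) -
    ((σ / 8 : ℝ) : ℂ) • (Complex.I • (extMode ν j (toZ.comp (M.comp D)) +
      ((1 / 2 : ℝ) : ℂ) • J0.comp (resMode ν j 2))) +
    ((1 / (4 * d) : ℝ) : ℂ) • (((1 / 2 : ℝ) : ℂ) • extMode ν j (toZ.comp (M.comp M)) -
      J0.comp ((stream j).comp (resMode ν j 2)))

theorem rin_I_M_D (φ : TestFn) : rin (toZ φ) (Complex.I • toZ (M (D φ))) =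
    -rin (Complex.I • toZ (M φ)) (toZ (D φ)) := by
  rw [rin_I_left, neg_neg, ← map_smul, ← map_smul, ← rin_M_left, map_smul]

theorem rin_MM_MD (φ : TestFn) : rin (toZ (M (M φ))) (toZ (M (D φ))) =
    -(3 / 2 * ‖toZ (M φ)‖ ^ 2) := by
  have h1 := rin_D_M (M φ)
  rw [D_M, map_add, rin_add_left, ← rin_M_left, rin_self, rin_comm] at h1
  linarith

theorem rin_DD_I (φ : TestFn) : rin (toZ (D (D φ))) (Complex.I • toZ φ) = 0 := by
  rw [← map_smul, rin_D_left, map_smul, map_smul, rin_comm, rin_I_self, neg_zero]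

section Values

variable {ν : ℝ} (hν : 0 < ν) (hν1 : ν < 1) {j : ℤ} (hj : j ≠ 0)

include hν hν1 hj

theorem J0_genMode (φ : TestFn) : J0 (genMode ν j (toY (shiftMode ν j 2 φ))) =
    (ν : ℂ) • toZ (D (D φ)) - ((ν * j ^ 2 : ℝ) : ℂ) • toZ φ -
      ((j : ℝ) : ℂ) • (Complex.I • toZ (M (M φ))) +
      ((2 * j : ℝ) : ℂ) • (Complex.I • J0 (stream j (toY φ))) := by
  have h1 : genMode ν j (toY (shiftMode ν j 2 φ)) = toY (locMode ν j φ) +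
      (2 : ℂ) • ((Complex.I * j) • stream j (toY φ)) := by
    simp only [genMode, add_apply, sub_apply, smul_apply, ContinuousLinearMap.comp_apply,
      resMode_shiftMode hν hν1 (by norm_num : (1 : ℝ) < 2), ContinuousLinearMap.id_apply, velMode,
      if_neg hj]
    rw [shiftMode_apply, map_sub, map_smul]
    push_cast
    module
  rw [h1, map_add, J0_toY, locMode_apply, lapMode_apply]
  simp only [map_sub, map_smul]
  push_cast
  module

theorem energyOp_shiftMode (φ : TestFn) : energyOp ν j (toY (shiftMode ν j 2 φ)) =
    toZ φ + toZ (M (M φ)) - ((2 : ℝ) : ℂ) • J0 (stream j (toY φ)) := by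
  simp only [energyOp, add_apply, sub_apply, smul_apply, ContinuousLinearMap.comp_apply,
    resMode_shiftMode hν hν1 (by norm_num : (1 : ℝ) < 2), extMode_MM hν hν1 j hj, J0_toY]
  push_cast
  rfl

theorem hypoOp_shiftMode (d σ : ℝ) (φ : TestFn) : hypoOp ν j d σ (toY (shiftMode ν j 2 φ)) =
    ((1 / 2 : ℝ) : ℂ) • toZ φ - ((d / 8 : ℝ) : ℂ) • toZ (D (D φ)) -
    ((σ / 8 : ℝ) : ℂ) • (Complex.I • toZ (M (D φ)) + ((1 / 2 : ℝ) : ℂ) • (Complex.I • toZ φ)) +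
    ((1 / (4 * d) : ℝ) : ℂ) • (((1 / 2 : ℝ) : ℂ) • toZ (M (M φ)) - J0 (stream j (toY φ))) := by
  simp only [hypoOp, add_apply, sub_apply, smul_apply, ContinuousLinearMap.comp_apply,
    resMode_shiftMode hν hν1 (by norm_num : (1 : ℝ) < 2), extMode_MM hν hν1 j hj,
    extMode_DD hν hν1, extMode_MD hν hν1, J0_toY]
  rw [smul_add Complex.I, smul_comm Complex.I]

end Values

section Products

variable (ν : ℝ) {j : ℤ} (hj : j ≠ 0) (φ : TestFn)

include hj

/-- The stream function tested against `φ''`. -/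
theorem rin_DD_stream : rin (toZ (D (D φ))) (J0 (stream j (toY φ))) = ‖toZ φ‖ ^ 2 -
    j ^ 2 * (‖dstream j (toY φ)‖ ^ 2 + j ^ 2 * ‖J0 (stream j (toY φ))‖ ^ 2) := by
  have h0 : ((j : ℂ) ^ 2) = (((j : ℝ) ^ 2 : ℝ) : ℂ) := by push_cast; ring
  have h1 := rin_lapMode_stream hj (toY φ) φ
  have h2 := rin_stream_self hj (toY φ)
  rw [J0_toY] at h1 h2
  rw [lapMode_apply, map_sub, map_smul, h0, rin_sub_left, rin_smul_left, h2, rin_self] at h1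
  linarith

theorem rin_I_stream_DD : rin (Complex.I • J0 (stream j (toY φ))) (toZ (D (D φ))) = 0 := by
  have h0 : ((j : ℂ) ^ 2) = (((j : ℝ) ^ 2 : ℝ) : ℂ) := by push_cast; ring
  have h1 := rin_lapMode_stream hj (toY φ) (Complex.I • φ)
  have h2 := rin_I_stream_self hj (toY φ)
  rw [J0_toY] at h1 h2
  rw [map_smul, map_smul, map_smul, rin_I_self, rin_I_left, lapMode_apply, map_sub, map_smul, h0,
    rin_sub_left, rin_smul_left, rin_comm _ (Complex.I • _), rin_comm _ (Complex.I • _), h2] at h1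
  linarith

theorem rin_stream_MD : rin (J0 (stream j (toY φ))) (toZ (M (D φ))) =
    3 / 2 * ‖dstream j (toY φ)‖ ^ 2 + j ^ 2 * ‖J0 (stream j (toY φ))‖ ^ 2 / 2 := by
  have h1 := rin_stream_M_D hj (toY φ) φ
  have h2 := rin_stream_self hj (toY φ)
  have h3 := rin_dstream hj (toY φ)
  rw [J0_toY] at h2
  rw [J1_toY] at h3
  rw [h1, h3, rin_comm, h2]
  ring

end Products

/-! ### Quadratic form inequalities -/

/-- Young's inequality for a cross term. -/
theorem abs_cross_le {t A B Q : ℝ} (ht : 0 < t) (hA : 0 ≤ A) (hB : 0 ≤ B) (h : Q ^ 2 ≤ A * B) :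
    |Q| ≤ t * A + B / (4 * t) := by
  have h0 : 0 ≤ t * A + B / (4 * t) := by positivity
  refine abs_le_of_sq_le_sq (h.trans ?_) h0
  have h1 : (t * A + B / (4 * t)) ^ 2 = (t * A - B / (4 * t)) ^ 2 + A * B := by
    field_simp; ring
  rw [h1]
  nlinarith [sq_nonneg (t * A - B / (4 * t))]

/-- The algebra behind the decay of the hypocoercive form. The cross term `Q` supplies the
dissipation `k (Y1 + 2 P1)` that is missing from the other three terms. -/
theorem hypo_dissipation {d k U0 U1 U2 Y1 W P0 P1 Q c : ℝ} (hd : 0 < d) (hk : 0 < k)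
    (hU0 : 0 ≤ U0) (hU1 : 0 ≤ U1) (hU2 : 0 ≤ U2) (hY1 : 0 ≤ Y1) (hW : 0 ≤ W) (hP1 : 0 ≤ P1)
    (hQ : Q ^ 2 ≤ Y1 * U1) (hc : c ^ 2 ≤ U2 * W) (hP : P0 ≤ 2 * P1 + Y1) :
    2 * (-(1 / 2) * (d ^ 2 * k * U1 + d ^ 2 * k * k ^ 2 * U0) -
      d / 8 * (d ^ 2 * k * U2 + d ^ 2 * k * k ^ 2 * U1 + 2 * k * Q) -
      1 / 8 * (d ^ 2 * k * c + d ^ 2 * k * k ^ 2 * Q + k * Y1 + 2 * k * P1) -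
      1 / (8 * d) * (d ^ 2 * k * U0 + d ^ 2 * k * W + d ^ 2 * k * k ^ 2 * Y1)) ≤
    -(d * k / 5) * (U0 / 2 + d / 8 * U1 + Q / 8 + Y1 / (8 * d) + (P1 + P0) / (4 * d)) := by
  obtain ⟨V, rfl⟩ : ∃ V, Y1 = d * V := ⟨Y1 / d, by field_simp⟩
  obtain ⟨p1, rfl⟩ : ∃ p, P1 = d * p := ⟨P1 / d, by field_simp⟩
  obtain ⟨p0, rfl⟩ : ∃ p, P0 = d * p := ⟨P0 / d, by field_simp⟩
  have hV : 0 ≤ V := by simpa [hd] using hY1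
  have hp1 : 0 ≤ p1 := by simpa [hd] using hP1
  have hp : p0 ≤ 2 * p1 + V := by nlinarith
  have hA : 0 ≤ d * U1 := by positivity
  have hQ' : Q ^ 2 ≤ (d * U1) * V := by linarith
  have q1 := abs_cross_le one_pos hA hV hQ'
  have c1 := abs_cross_le (t := 1 / 2) (by norm_num) (show 0 ≤ d ^ 2 * U2 by positivity) hW
    (show (d * c) ^ 2 ≤ (d ^ 2 * U2) * W by nlinarith [sq_nonneg d])
  have q1' := neg_abs_le Q
  have c1' := neg_abs_le (d * c)
  have e : 2 * (-(1 / 2) * (d ^ 2 * k * U1 + d ^ 2 * k * k ^ 2 * U0) -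
      d / 8 * (d ^ 2 * k * U2 + d ^ 2 * k * k ^ 2 * U1 + 2 * k * Q) -
      1 / 8 * (d ^ 2 * k * c + d ^ 2 * k * k ^ 2 * Q + k * (d * V) + 2 * k * (d * p1)) -
      1 / (8 * d) * (d ^ 2 * k * U0 + d ^ 2 * k * W + d ^ 2 * k * k ^ 2 * (d * V))) -
      -(d * k / 5) * (U0 / 2 + d / 8 * U1 + Q / 8 + (d * V) / (8 * d) +
        (d * p1 + d * p0) / (4 * d)) =
      -(d * k) * ((d * U1 + Q / 2 + V / 4 + p1 / 2 + U0 / 4 - (U0 / 2 + d * U1 / 8 + Q / 8 + V / 8 +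
        (p1 + p0) / 4) / 5) + (d ^ 2 * U2 / 4 + W / 4 + d * c / 4) +
        d * k ^ 2 * (U0 + d * U1 / 4 + V / 4 + Q / 4)) := by
    field_simp; ring
  have t1 : 0 ≤ d * U1 + Q / 2 + V / 4 + p1 / 2 + U0 / 4 - (U0 / 2 + d * U1 / 8 + Q / 8 + V / 8 +
        (p1 + p0) / 4) / 5 := by linarith
  have hd2 : 0 ≤ d ^ 2 * U2 := by positivity
  have t2 : 0 ≤ d ^ 2 * U2 / 4 + W / 4 + d * c / 4 := by linarith
  have t3 : 0 ≤ d * k ^ 2 * (U0 + d * U1 / 4 + V / 4 + Q / 4) := by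
    have : 0 ≤ U0 + d * U1 / 4 + V / 4 + Q / 4 := by linarith
    positivity
  have : 0 ≤ d * k * ((d * U1 + Q / 2 + V / 4 + p1 / 2 + U0 / 4 - (U0 / 2 + d * U1 / 8 + Q / 8 +
      V / 8 + (p1 + p0) / 4) / 5) + (d ^ 2 * U2 / 4 + W / 4 + d * c / 4) +
        d * k ^ 2 * (U0 + d * U1 / 4 + V / 4 + Q / 4)) := by positivity
  linarith

/-- Coercivity of the hypocoercive form in terms of the energy `U0 + Y1 + 2 P`. The cross term is
absorbed by `d / 8 * U1 + Y1 / (8 * d)`. -/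
theorem hypo_lower {d U0 U1 Y1 P Q : ℝ} (hd : 0 < d) (hd1 : d ≤ 1) (hU0 : 0 ≤ U0) (hU1 : 0 ≤ U1)
    (hY1 : 0 ≤ Y1) (hP : 0 ≤ P) (hQ : Q ^ 2 ≤ Y1 * U1) :
    U0 + Y1 + 2 * P ≤
      32 / 3 * (U0 / 2 + d / 8 * U1 + Q / 8 + Y1 / (8 * d) + P / (4 * d)) := by
  obtain ⟨V, rfl⟩ : ∃ V, Y1 = d * V := ⟨Y1 / d, by field_simp⟩
  obtain ⟨p, rfl⟩ : ∃ p, P = d * p := ⟨P / d, by field_simp⟩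
  have hV : 0 ≤ V := by simpa [hd] using hY1
  have hp : 0 ≤ p := by simpa [hd] using hP
  have hA : 0 ≤ d * U1 := by positivity
  have q1 := abs_cross_le one_pos hA hV (Q := Q) (by linarith)
  have q1' := neg_abs_le Q
  rw [show d * V / (8 * d) = V / 8 by field_simp, show d * p / (4 * d) = p / 4 by field_simp]
  nlinarith

/-- The form exceeds the energy by the factor `1 / (2 d)` and by a multiple of `d * U1`, which the
viscous dissipation pays for. -/
theorem hypo_upper {d U0 U1 Y1 P Q : ℝ} (hd : 0 < d) (hd1 : d ≤ 1) (hU0 : 0 ≤ U0) (hU1 : 0 ≤ U1)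
    (hY1 : 0 ≤ Y1) (hP : 0 ≤ P) (hQ : Q ^ 2 ≤ Y1 * U1) :
    U0 / 2 + d / 8 * U1 + Q / 8 + Y1 / (8 * d) + P / (4 * d) ≤
      (U0 + Y1 + 2 * P) / (2 * d) + 3 / 16 * d * U1 := by
  obtain ⟨V, rfl⟩ : ∃ V, Y1 = d * V := ⟨Y1 / d, by field_simp⟩
  obtain ⟨p, rfl⟩ : ∃ p, P = d * p := ⟨P / d, by field_simp⟩
  obtain ⟨u, rfl⟩ : ∃ p, U0 = d * p := ⟨U0 / d, by field_simp⟩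
  have hV : 0 ≤ V := by simpa [hd] using hY1
  have hp : 0 ≤ p := by simpa [hd] using hP
  have hu : 0 ≤ u := by simpa [hd] using hU0
  have hA : 0 ≤ d * U1 := by positivity
  have q1 := abs_cross_le (t := 1 / 2) (by norm_num) hA hV (Q := Q) (by linarith)
  have q1' := le_abs_self Q
  rw [show d * V / (8 * d) = V / 8 by field_simp, show d * p / (4 * d) = p / 4 by field_simp,
    show (d * u + d * V + 2 * (d * p)) / (2 * d) = u / 2 + V / 2 + p by field_simp]
  nlinarith

theorem rin_I_MM (φ : TestFn) : rin (Complex.I • toZ (M (M φ))) (toZ φ) = 0 := by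
  rw [rin_I_left, ← map_smul, rin_M_left, map_smul, map_smul, rin_comm, rin_I_self, neg_zero]

section Forms

variable {ν : ℝ} (hν : 0 < ν) (hν1 : ν < 1) {j : ℤ} (hj : j ≠ 0)

include hν hν1 hj

/-- The `L²` norm is dissipated by the viscosity only; neither transport nor the stream function
contributes. -/
theorem rin_genMode_resMode_le (x : Y) :
    rin (J0 (genMode ν j x)) (J0 (resMode ν j 2 x)) ≤ -ν * ‖extMode ν j (toZ.comp D) x‖ ^ 2 := by
  refine shiftMode_induction hν (l := 2) (by norm_num) j
    (P := fun x => rin (J0 (genMode ν j x)) (J0 (resMode ν j 2 x)) ≤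
      -ν * ‖extMode ν j (toZ.comp D) x‖ ^ 2)
    (isClosed_le (continuous_rin (by fun_prop) (by fun_prop)) (by fun_prop)) (fun φ => ?_) x
  have h1 := rin_I_stream_self hj (toY φ)
  rw [J0_toY] at h1
  rw [J0_genMode hν hν1 hj, resMode_shiftMode hν hν1 (by norm_num), J0_toY, extMode_D hν hν1]
  have h2 := rin_I_MM φ
  simp only [rin_add_left, rin_sub_left, rin_smul_left, h1, h2, rin_DD_self, rin_self]
  have : 0 ≤ ν * j ^ 2 * ‖toZ φ‖ ^ 2 := by positivity
  linarith

theorem rin_resMode_energyOp (x : Y) : rin (J0 (resMode ν j 2 x)) (energyOp ν j x) =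
    ‖resMode ν j 2 x‖ ^ 2 + 2 * (‖dstream j (resMode ν j 2 x)‖ ^ 2 +
      j ^ 2 * ‖J0 (stream j (resMode ν j 2 x))‖ ^ 2) := by
  refine shiftMode_induction hν (l := 2) (by norm_num) j
    (P := fun x => rin (J0 (resMode ν j 2 x)) (energyOp ν j x) =
    ‖resMode ν j 2 x‖ ^ 2 + 2 * (‖dstream j (resMode ν j 2 x)‖ ^ 2 +
      j ^ 2 * ‖J0 (stream j (resMode ν j 2 x))‖ ^ 2))
    (isClosed_eq (continuous_rin (by fun_prop) (by fun_prop)) (by fun_prop)) (fun φ => ?_) x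
  have h1 := rin_stream_self hj (toY φ)
  rw [J0_toY] at h1
  rw [energyOp_shiftMode hν hν1 hj, resMode_shiftMode hν hν1 (by norm_num), J0_toY, norm_toY_sq]
  simp only [rin_add_right, rin_sub_right, rin_smul_right, h1, rin_self, ← rin_M_left]
  ring

theorem energy_bounds (x : Y) :
    ‖resMode ν j 2 x‖ ^ 2 ≤ rin (J0 (resMode ν j 2 x)) (energyOp ν j x) ∧
      rin (J0 (resMode ν j 2 x)) (energyOp ν j x) ≤ 3 * ‖resMode ν j 2 x‖ ^ 2 := by
  rw [rin_resMode_energyOp hν hν1 hj]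
  have h1 := norm_stream_le hj (resMode ν j 2 x)
  have h2 : ‖J0 (resMode ν j 2 x)‖ ^ 2 ≤ ‖resMode ν j 2 x‖ ^ 2 := by
    gcongr; exact norm_J0_le _
  have h3 : 0 ≤ ‖dstream j (resMode ν j 2 x)‖ ^ 2 +
      j ^ 2 * ‖J0 (stream j (resMode ν j 2 x))‖ ^ 2 := by positivity
  constructor <;> linarith

/-- The energy `‖u‖² + ‖y u‖² + 2 ‖∇ψ‖²` does not increase: the contribution of `2 ∂_x ψ` to
`‖y u‖²` cancels that of `-y² ∂_x u` to `2 ‖∇ψ‖²`. -/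
theorem rin_genMode_energyOp_nonpos (x : Y) :
    rin (J0 (genMode ν j x)) (energyOp ν j x) ≤ 0 := by
  refine shiftMode_induction hν (l := 2) (by norm_num) j
    (P := fun x => rin (J0 (genMode ν j x)) (energyOp ν j x) ≤ 0)
    (isClosed_le (continuous_rin (by fun_prop) (by fun_prop)) (by fun_prop)) (fun φ => ?_) x
  have h1 := rin_I_stream_self hj (toY φ)
  have h3 := rin_stream_self hj (toY φ)
  rw [J0_toY] at h1 h3
  rw [J0_genMode hν hν1 hj, energyOp_shiftMode hν hν1 hj]
  have h2 := rin_I_MM φ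
  have h4 : rin (toZ φ) (toZ (M (M φ))) = ‖toZ (M φ)‖ ^ 2 := by rw [← rin_M_left, rin_self]
  have h5 : rin (Complex.I • J0 (stream j (toY φ))) (toZ (M (M φ))) =
      -rin (Complex.I • toZ (M (M φ))) (J0 (stream j (toY φ))) := by
    rw [rin_I_left, rin_comm]
  simp only [rin_add_left, rin_sub_left, rin_smul_left, rin_add_right, rin_sub_right,
    rin_smul_right, h1, h2, h3, h4, h5, rin_DD_self, rin_DD_MM, rin_self, rin_DD_stream hj,
    rin_I_self]
  have : 0 ≤ ν * (‖toZ (D φ)‖ ^ 2 + ‖toZ (M (D φ))‖ ^ 2 + ‖toZ φ‖ ^ 2) +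
      ν * j ^ 2 * (‖toZ φ‖ ^ 2 + ‖toZ (M φ)‖ ^ 2) := by positivity
  linarith

end Forms

section HypoForm

variable {ν : ℝ} (hν : 0 < ν) (hν1 : ν < 1) {j : ℤ} (hj : j ≠ 0) {d σ : ℝ}

include hν hν1 hj

/-- The hypocoercive form at a test function. The sign `σ` of `j` makes the cross term dissipative. -/
theorem rin_hypoOp (φ : TestFn) :
    rin (toZ φ) (hypoOp ν j d σ (toY (shiftMode ν j 2 φ))) =
      ‖toZ φ‖ ^ 2 / 2 + d / 8 * ‖toZ (D φ)‖ ^ 2 +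
        (σ * rin (Complex.I • toZ (M φ)) (toZ (D φ))) / 8 + ‖toZ (M φ)‖ ^ 2 / (8 * d) +
        (‖dstream j (toY φ)‖ ^ 2 + j ^ 2 * ‖J0 (stream j (toY φ))‖ ^ 2) / (4 * d) := by
  have h3 := rin_stream_self hj (toY φ)
  rw [J0_toY] at h3
  rw [hypoOp_shiftMode hν hν1 hj]
  have h1 : rin (toZ φ) (toZ (D (D φ))) = -‖toZ (D φ)‖ ^ 2 := by rw [rin_comm, rin_DD_self]
  have h2 : rin (toZ φ) (Complex.I • toZ φ) = 0 := by rw [rin_comm, rin_I_self]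
  have h4 : rin (toZ φ) (toZ (M (M φ))) = ‖toZ (M φ)‖ ^ 2 := by rw [← rin_M_left, rin_self]
  simp only [rin_add_right, rin_sub_right, rin_smul_right, h1, h2, h3, h4, rin_I_M_D, rin_self]
  ring

/-- Half of the time derivative of the hypocoercive form along the flow. -/
theorem rin_genMode_hypoOp (hσ : σ * σ = 1) (φ : TestFn) :
    rin (J0 (genMode ν j (toY (shiftMode ν j 2 φ)))) (hypoOp ν j d σ (toY (shiftMode ν j 2 φ))) =
      -(1 / 2) * (ν * ‖toZ (D φ)‖ ^ 2 + ν * j ^ 2 * ‖toZ φ‖ ^ 2) -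
      d / 8 * (ν * ‖toZ (D (D φ))‖ ^ 2 + ν * j ^ 2 * ‖toZ (D φ)‖ ^ 2 +
        2 * (σ * j) * (σ * rin (Complex.I • toZ (M φ)) (toZ (D φ)))) -
      1 / 8 * (ν * (σ * rin (toZ (D (D φ))) (Complex.I • toZ (M (D φ)))) +
        ν * j ^ 2 * (σ * rin (Complex.I • toZ (M φ)) (toZ (D φ))) + (σ * j) * ‖toZ (M φ)‖ ^ 2 +
        2 * (σ * j) * ‖dstream j (toY φ)‖ ^ 2) -
      1 / (8 * d) * (ν * ‖toZ φ‖ ^ 2 + ν * ‖toZ (M (D φ))‖ ^ 2 +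
        ν * j ^ 2 * ‖toZ (M φ)‖ ^ 2) := by
  have h1 := rin_I_stream_self hj (toY φ)
  have h3 := rin_stream_self hj (toY φ)
  rw [J0_toY] at h1 h3
  rw [J0_genMode hν hν1 hj, hypoOp_shiftMode hν hν1 hj]
  have h2 := rin_I_MM φ
  have h4 : rin (toZ φ) (toZ (M (M φ))) = ‖toZ (M φ)‖ ^ 2 := by rw [← rin_M_left, rin_self]
  have h4' : rin (toZ (M (M φ))) (toZ φ) = ‖toZ (M φ)‖ ^ 2 := by rw [rin_comm, h4]
  have h5 : rin (Complex.I • J0 (stream j (toY φ))) (toZ (M (M φ))) =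
      -rin (Complex.I • toZ (M (M φ))) (J0 (stream j (toY φ))) := by
    rw [rin_I_left, rin_comm]
  have h6 : rin (toZ φ) (toZ (D (D φ))) = -‖toZ (D φ)‖ ^ 2 := by rw [rin_comm, rin_DD_self]
  have h7 : rin (toZ φ) (Complex.I • toZ φ) = 0 := by rw [rin_comm, rin_I_self]
  have h8 : rin (Complex.I • toZ (M (M φ))) (toZ (D (D φ))) =
      -2 * rin (Complex.I • toZ (M φ)) (toZ (D φ)) := by
    rw [rin_comm, rin_I_D_M, rin_comm]
  have h9 : rin (J0 (stream j (toY φ))) (toZ φ) = rin (toZ φ) (J0 (stream j (toY φ))) :=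
    rin_comm _ _
  simp only [rin_add_left, rin_sub_left, rin_smul_left, rin_add_right, rin_sub_right,
    rin_smul_right, rin_I_I, h1, h2, h3, h4, h4', h5, h6, h7, h8, h9, rin_DD_self, rin_DD_MM,
    rin_self, rin_DD_stream hj, rin_I_stream_DD hj, rin_stream_MD hj, rin_I_M_D, rin_MM_MD,
    rin_DD_I, rin_I_self]
  linear_combination (d * j * rin (Complex.I • toZ (M φ)) (toZ (D φ)) / 4) * hσ

end HypoForm

theorem sq_cross_le {σ : ℝ} (hσ : σ * σ = 1) (a b : Z) : (σ * rin a b) ^ 2 ≤ ‖a‖ ^ 2 * ‖b‖ ^ 2 := by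
  have h1 : (σ * rin a b) ^ 2 = |rin a b| ^ 2 := by rw [sq_abs]; linear_combination rin a b ^ 2 * hσ
  rw [h1, ← mul_pow]
  exact pow_le_pow_left₀ (abs_nonneg _) (abs_rin_le a b) 2

section HypoForm

variable {ν : ℝ} (hν : 0 < ν) (hν1 : ν < 1) {j : ℤ} (hj : j ≠ 0) {d σ : ℝ} (hd : 0 < d)
  (hσ : σ * σ = 1)

include hν hν1 hj hd hσ

/-- Decay of the hypocoercive form along the flow, at rate `d |j| / 5`. -/
theorem rin_genMode_hypoOp_le (hσj : 0 < σ * j) (hνd : ν = d ^ 2 * (σ * j)) (x : Y) :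
    2 * rin (J0 (genMode ν j x)) (hypoOp ν j d σ x) ≤
      -(d * (σ * j) / 5) * rin (J0 (resMode ν j 2 x)) (hypoOp ν j d σ x) := by
  refine shiftMode_induction hν (l := 2) (by norm_num) j
    (P := fun x => 2 * rin (J0 (genMode ν j x)) (hypoOp ν j d σ x) ≤
      -(d * (σ * j) / 5) * rin (J0 (resMode ν j 2 x)) (hypoOp ν j d σ x))
    (isClosed_le ((continuous_rin (by fun_prop) (by fun_prop)).const_mul _)
      ((continuous_rin (by fun_prop) (by fun_prop)).const_mul _)) (fun φ => ?_) x
  rw [resMode_shiftMode hν hν1 (by norm_num), J0_toY, rin_hypoOp hν hν1 hj,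
    rin_genMode_hypoOp hν hν1 hj hσ]
  have hQ : (σ * rin (Complex.I • toZ (M φ)) (toZ (D φ))) ^ 2 ≤
      ‖toZ (M φ)‖ ^ 2 * ‖toZ (D φ)‖ ^ 2 := by
    refine (sq_cross_le hσ _ _).trans_eq ?_
    rw [norm_smul, Complex.norm_I, one_mul]
  have hc : (σ * rin (toZ (D (D φ))) (Complex.I • toZ (M (D φ)))) ^ 2 ≤
      ‖toZ (D (D φ))‖ ^ 2 * ‖toZ (M (D φ))‖ ^ 2 := by
    refine (sq_cross_le hσ _ _).trans_eq ?_
    rw [norm_smul, Complex.norm_I, one_mul]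
  have hP := sq_stream_le hj (toY φ)
  rw [J1_toY] at hP
  have hjk : (j : ℝ) ^ 2 = (σ * j) ^ 2 := by linear_combination -(j : ℝ) ^ 2 * hσ
  have h1 := hypo_dissipation hd hσj (sq_nonneg ‖toZ φ‖) (sq_nonneg ‖toZ (D φ)‖)
    (sq_nonneg ‖toZ (D (D φ))‖) (sq_nonneg ‖toZ (M φ)‖) (sq_nonneg ‖toZ (M (D φ))‖)
    (sq_nonneg ‖dstream j (toY φ)‖) hQ hc hP
  rw [← hνd, ← hjk] at h1
  exact h1

/-- The hypocoercive form controls the energy, and is controlled by it up to the first derivative. -/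
theorem hypo_bounds (hd1 : d ≤ 1) (x : Y) :
    rin (J0 (resMode ν j 2 x)) (energyOp ν j x) ≤
      32 / 3 * rin (J0 (resMode ν j 2 x)) (hypoOp ν j d σ x) ∧
    rin (J0 (resMode ν j 2 x)) (hypoOp ν j d σ x) ≤
      rin (J0 (resMode ν j 2 x)) (energyOp ν j x) / (2 * d) +
        3 / 16 * d * ‖extMode ν j (toZ.comp D) x‖ ^ 2 := by
  refine shiftMode_induction hν (l := 2) (by norm_num) j
    (P := fun x => rin (J0 (resMode ν j 2 x)) (energyOp ν j x) ≤
      32 / 3 * rin (J0 (resMode ν j 2 x)) (hypoOp ν j d σ x) ∧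
    rin (J0 (resMode ν j 2 x)) (hypoOp ν j d σ x) ≤
      rin (J0 (resMode ν j 2 x)) (energyOp ν j x) / (2 * d) +
        3 / 16 * d * ‖extMode ν j (toZ.comp D) x‖ ^ 2)
    ((isClosed_le (continuous_rin (by fun_prop) (by fun_prop))
      ((continuous_rin (by fun_prop) (by fun_prop)).const_mul _)).inter
      (isClosed_le (continuous_rin (by fun_prop) (by fun_prop))
      (((continuous_rin (by fun_prop) (by fun_prop)).div_const _).add (by fun_prop))))
    (fun φ => ?_) x
  rw [rin_resMode_energyOp hν hν1 hj, resMode_shiftMode hν hν1 (by norm_num), J0_toY,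
    rin_hypoOp hν hν1 hj, norm_toY_sq, extMode_D hν hν1]
  have hQ : (σ * rin (Complex.I • toZ (M φ)) (toZ (D φ))) ^ 2 ≤
      ‖toZ (M φ)‖ ^ 2 * ‖toZ (D φ)‖ ^ 2 := by
    refine (sq_cross_le hσ _ _).trans_eq ?_
    rw [norm_smul, Complex.norm_I, one_mul]
  have hP : 0 ≤ ‖dstream j (toY φ)‖ ^ 2 + j ^ 2 * ‖J0 (stream j (toY φ))‖ ^ 2 := by positivity
  exact ⟨hypo_lower hd hd1 (sq_nonneg _) (sq_nonneg _) (sq_nonneg _) hP hQ,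
    hypo_upper hd hd1 (sq_nonneg _) (sq_nonneg _) (sq_nonneg _) hP hQ⟩

end HypoForm

theorem rin_stream_comm {j : ℤ} (hj : j ≠ 0) (f g : Y) :
    rin (J0 f) (J0 (stream j g)) = rin (J0 (stream j f)) (J0 g) := by
  refine lapMode_induction hj (P := fun f => rin (J0 f) (J0 (stream j g)) =
    rin (J0 (stream j f)) (J0 g)) (isClosed_eq (continuous_rin (by fun_prop) (by fun_prop))
    (continuous_rin (by fun_prop) (by fun_prop))) (fun χ => ?_) f
  rw [stream_lapMode hj, J0_toY, J0_toY, rin_lapMode_stream hj]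

section Symmetry

variable {ν : ℝ} (hν : 0 < ν) (hν1 : ν < 1) {j : ℤ} (hj : j ≠ 0)

include hν hν1 hj

/-- Symmetry of the energy form, polarised; it allows the form to be differentiated in time. -/
theorem energyOp_symm (x x' : Y) : rin (J0 (resMode ν j 2 x)) (energyOp ν j x') =
    rin (energyOp ν j x) (J0 (resMode ν j 2 x')) := by
  refine shiftMode_induction hν (l := 2) (by norm_num) j
    (P := fun x => rin (J0 (resMode ν j 2 x)) (energyOp ν j x') =
      rin (energyOp ν j x) (J0 (resMode ν j 2 x')))
    (isClosed_eq (continuous_rin (by fun_prop) (by fun_prop))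
      (continuous_rin (by fun_prop) (by fun_prop))) (fun φ => ?_) x
  refine shiftMode_induction hν (l := 2) (by norm_num) j
    (P := fun x' => rin (J0 (resMode ν j 2 (toY (shiftMode ν j 2 φ)))) (energyOp ν j x') =
      rin (energyOp ν j (toY (shiftMode ν j 2 φ))) (J0 (resMode ν j 2 x')))
    (isClosed_eq (continuous_rin (by fun_prop) (by fun_prop))
      (continuous_rin (by fun_prop) (by fun_prop))) (fun χ => ?_) x'
  have h1 := rin_stream_comm hj (toY φ) (toY χ)
  rw [J0_toY, J0_toY] at h1
  rw [energyOp_shiftMode hν hν1 hj, energyOp_shiftMode hν hν1 hj,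
    resMode_shiftMode hν hν1 (by norm_num), resMode_shiftMode hν hν1 (by norm_num), J0_toY, J0_toY]
  simp only [rin_add_left, rin_sub_left, rin_smul_left, rin_add_right, rin_sub_right,
    rin_smul_right, h1, rin_M_left]

theorem hypoOp_symm (d σ : ℝ) (x x' : Y) : rin (J0 (resMode ν j 2 x)) (hypoOp ν j d σ x') =
    rin (hypoOp ν j d σ x) (J0 (resMode ν j 2 x')) := by
  refine shiftMode_induction hν (l := 2) (by norm_num) j
    (P := fun x => rin (J0 (resMode ν j 2 x)) (hypoOp ν j d σ x') =
      rin (hypoOp ν j d σ x) (J0 (resMode ν j 2 x')))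
    (isClosed_eq (continuous_rin (by fun_prop) (by fun_prop))
      (continuous_rin (by fun_prop) (by fun_prop))) (fun φ => ?_) x
  refine shiftMode_induction hν (l := 2) (by norm_num) j
    (P := fun x' => rin (J0 (resMode ν j 2 (toY (shiftMode ν j 2 φ)))) (hypoOp ν j d σ x') =
      rin (hypoOp ν j d σ (toY (shiftMode ν j 2 φ))) (J0 (resMode ν j 2 x')))
    (isClosed_eq (continuous_rin (by fun_prop) (by fun_prop))
      (continuous_rin (by fun_prop) (by fun_prop))) (fun χ => ?_) x'
  have h1 := rin_stream_comm hj (toY φ) (toY χ)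
  rw [J0_toY, J0_toY] at h1
  rw [hypoOp_shiftMode hν hν1 hj, hypoOp_shiftMode hν hν1 hj,
    resMode_shiftMode hν hν1 (by norm_num), resMode_shiftMode hν hν1 (by norm_num), J0_toY, J0_toY]
  -- Integration by parts turns `i y ∂_y` into `i (y ∂_y + 1)`.
  have h2 : rin (Complex.I • toZ (M (D φ))) (toZ χ) =
      rin (toZ φ) (Complex.I • toZ (M (D χ))) + rin (toZ φ) (Complex.I • toZ χ) := by
    rw [rin_I_left, ← map_smul, rin_M_left, rin_D_left, neg_neg, D_M, map_add, rin_add_right,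
      map_smul, map_smul, map_smul, map_smul, add_comm]
  simp only [rin_add_left, rin_sub_left, rin_smul_left, rin_add_right, rin_sub_right,
    rin_smul_right, h1, h2, rin_M_left, rin_D_left, rin_I_left]
  ring

end Symmetry

/-! ### Decay of a single mode -/

theorem le_of_right_deriv_nonpos {g g' : ℝ → ℝ} (hg : Continuous g)
    (hg' : ∀ t, 0 ≤ t → HasDerivWithinAt g (g' t) (Set.Ici t) t) (h : ∀ t, 0 ≤ t → g' t ≤ 0)
    {s t : ℝ} (hs : 0 ≤ s) (hst : s ≤ t) : g t ≤ g s :=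
  image_le_of_deriv_right_le_deriv_boundary (B := fun _ => g s) (B' := fun _ => 0)
    hg.continuousOn (fun x hx => hg' x (hs.trans hx.1)) le_rfl continuousOn_const
    (fun _ _ => hasDerivWithinAt_const _ _ _) (fun x hx => h x (hs.trans hx.1))
    (Set.right_mem_Icc.2 hst)

theorem le_exp_of_right_deriv_le {g g' : ℝ → ℝ} {c : ℝ} (hg : Continuous g)
    (hg' : ∀ t, 0 ≤ t → HasDerivWithinAt g (g' t) (Set.Ici t) t)
    (h : ∀ t, 0 ≤ t → g' t ≤ c * g t) {s t : ℝ} (hs : 0 ≤ s) (hst : s ≤ t) :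
    g t ≤ Real.exp (c * (t - s)) * g s := by
  have hE : ∀ x, HasDerivAt (fun x => Real.exp (-c * (x - s))) (Real.exp (-c * (x - s)) * -c) x := by
    intro x
    have h0 : HasDerivAt (fun x => -c * (x - s)) (-c) x := by
      simpa using ((hasDerivAt_id x).sub_const s).const_mul (-c)
    exact h0.exp
  have h1 := le_of_right_deriv_nonpos (g := fun x => Real.exp (-c * (x - s)) * g x)
    (g' := fun x => Real.exp (-c * (x - s)) * -c * g x + Real.exp (-c * (x - s)) * g' x)
    (by fun_prop) (fun x hx => (hE x).hasDerivWithinAt.mul (hg' x hx)) (fun x hx => by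
      have := mul_le_mul_of_nonneg_left (h x hx) (Real.exp_pos (-c * (x - s))).le
      linarith) hs hst
  simp only [sub_self, mul_zero, Real.exp_zero, one_mul] at h1
  calc g t = Real.exp (c * (t - s)) * (Real.exp (-c * (t - s)) * g t) := by
        rw [← mul_assoc, ← Real.exp_add]; simp
    _ ≤ _ := by gcongr

theorem map_slope {E : Type*} [NormedAddCommGroup E] [NormedSpace ℂ E]
    (L : Y →L[ℂ] E) (v : ℝ → Y) (t s : ℝ) :
    L (slope v t s) = (((s - t)⁻¹ : ℝ) : ℂ) • (L (v s) - L (v t)) := by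
  have h : ∀ (r : ℝ) (w : Y), r • w = (r : ℂ) • w := fun _ _ => rfl
  rw [slope_def_module, h, map_smul, map_sub]

/-- The right derivative of a symmetric quadratic form along `v = L x`; only `v`, and not `x`, has
to be differentiable. -/
theorem hasDerivWithinAt_quad {L B : Y →L[ℂ] Z} (hsymm : ∀ x x', rin (L x) (B x') = rin (B x) (L x'))
    {v v' : ℝ → Y} {x : ℝ → Y} (hx : Continuous x) (hL : ∀ t, J0 (v t) = L (x t)) {t : ℝ}
    (hv : HasDerivWithinAt v (v' t) (Set.Ici t) t) :
    HasDerivWithinAt (fun t => rin (L (x t)) (B (x t))) (2 * rin (J0 (v' t)) (B (x t)))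
      (Set.Ici t) t := by
  have hv1 : Tendsto (slope v t) (𝓝[>] t) (𝓝 (v' t)) :=
    (hasDerivWithinAt_iff_tendsto_slope' (by simp)).1 (hasDerivWithinAt_Ioi_iff_Ici.2 hv)
  have h1 : Tendsto (fun s => rin (J0 (slope v t s)) (B (x s + x t))) (𝓝[>] t)
      (𝓝 (rin (J0 (v' t)) (B (x t + x t)))) := by
    have h2 : Tendsto (fun s => J0 (slope v t s)) (𝓝[>] t) (𝓝 (J0 (v' t))) :=
      (J0.continuous.tendsto _).comp hv1
    have h3 : Tendsto (fun s => B (x s + x t)) (𝓝[>] t) (𝓝 (B (x t + x t))) :=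
      ((by fun_prop : Continuous fun s => B (x s + x t)).tendsto t).mono_left nhdsWithin_le_nhds
    exact (Complex.continuous_re.tendsto _).comp (h2.inner h3)
  have h2 : rin (J0 (v' t)) (B (x t + x t)) = 2 * rin (J0 (v' t)) (B (x t)) := by
    rw [map_add, rin_add_right]; ring
  rw [h2] at h1
  refine hasDerivWithinAt_Ioi_iff_Ici.1 ((hasDerivWithinAt_iff_tendsto_slope' (by simp)).2 ?_)
  refine h1.congr fun s => ?_
  rw [map_slope, hL, hL, rin_smul_left, slope_def_field, map_add, rin_add_right,
    rin_sub_left, rin_sub_left, hsymm (x t) (x s), rin_comm (B (x t))]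
  ring

/-- A right-differentiable solution of the evolution equation of the `j`-th mode. -/
structure IsModeSolution (ν : ℝ) (j : ℤ) (v v' : ℝ → Y) : Prop where
  cont : Continuous v
  cont' : Continuous v'
  deriv : ∀ t, 0 ≤ t → HasDerivWithinAt v (v' t) (Set.Ici t) t
  rel : ∀ t, ∃ h, ModeRel ν j (v t) h (v' t)

namespace IsModeSolution

variable {ν : ℝ} {j : ℤ} {v v' : ℝ → Y}

/-- A crude growth bound valid on every mode, the zero mode included. The resolvent bounds at large `l`
give `Re ⟨f, g⟩ ≤ 5 ‖f‖²`. -/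
theorem norm_sq_le_exp (H : IsModeSolution ν j v v') (hν : 0 < ν) (hν1 : ν < 1) {t : ℝ}
    (ht : 0 ≤ t) : ‖v t‖ ^ 2 ≤ Real.exp (10 * t) * ‖v 0‖ ^ 2 := by
  have key : ∀ f g : Y, (∀ l : ℝ, 5 < l → (l - 5) * ‖f‖ ≤ ‖(l : ℂ) • f - g‖) →
      (inner ℂ f g).re ≤ 5 * ‖f‖ ^ 2 := by
    intro f g hfg
    by_contra! hlt
    set δ := (inner ℂ f g).re - 5 * ‖f‖ ^ 2 with hδ
    have hδ0 : 0 < δ := by linarith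
    set l := 6 + ‖g‖ ^ 2 / (2 * δ) with hl
    have h1 := hfg l (by have : 0 ≤ ‖g‖ ^ 2 / (2 * δ) := by positivity
                         linarith)
    have hl5 : 5 < l := by have : 0 ≤ ‖g‖ ^ 2 / (2 * δ) := by positivity
                           linarith
    have h2 : ((l - 5) * ‖f‖) ^ 2 ≤ ‖(l : ℂ) • f - g‖ ^ 2 :=
      pow_le_pow_left₀ (mul_nonneg (by linarith) (norm_nonneg _)) h1 2
    have h3 : ‖(l : ℂ) • f - g‖ ^ 2 = l ^ 2 * ‖f‖ ^ 2 - 2 * (l * (inner ℂ f g).re) + ‖g‖ ^ 2 := by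
      rw [@norm_sub_sq ℂ, inner_smul_left, Complex.conj_ofReal, norm_smul, Complex.norm_real,
        mul_pow, Real.norm_eq_abs, sq_abs, RCLike.re_eq_complex_re, Complex.re_ofReal_mul]
    have h4 : 2 * δ * l = 12 * δ + ‖g‖ ^ 2 := by rw [hl]; field_simp; ring
    have h5 : (inner ℂ f g).re = δ + 5 * ‖f‖ ^ 2 := by rw [hδ]; ring
    rw [h3, h5] at h2
    nlinarith [sq_nonneg ‖f‖]
  have hd : ∀ t, 0 ≤ t → HasDerivWithinAt (fun t => (inner ℂ (v t) (v t)).re)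
      (inner ℂ (v t) (v' t) + inner ℂ (v' t) (v t)).re (Set.Ici t) t := fun t ht =>
    Complex.reCLM.hasFDerivAt.comp_hasDerivWithinAt t ((H.deriv t ht).inner ℂ (H.deriv t ht))
  have hn : ∀ t, (inner ℂ (v t) (v t)).re = ‖v t‖ ^ 2 := fun t => by
    rw [← RCLike.re_eq_complex_re, inner_self_eq_norm_sq]
  have h1 := le_exp_of_right_deriv_le (c := 10)
    (Complex.continuous_re.comp (H.cont.inner H.cont)) hd (fun t ht => by
      obtain ⟨h, hh⟩ := H.rel t
      have := key (v t) (v' t) (fun l hl => hh.norm_le hν hν1 hl j)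
      have h2 : (inner ℂ (v' t) (v t)).re = (inner ℂ (v t) (v' t)).re := by
        rw [← inner_conj_symm, Complex.conj_re]
      simp only [Function.comp_apply]
      rw [Complex.add_re, h2, hn]
      linarith) le_rfl ht
  simp only [Function.comp_apply] at h1
  rwa [hn, hn, sub_zero] at h1

/-- The exponential decay of the energy of a mode, with the loss of a factor `8 / d`. -/
theorem energy_decay (H : IsModeSolution ν j v v') (hν : 0 < ν) (hν1 : ν < 1) (hj : j ≠ 0)
    {d σ : ℝ} (hd : 0 < d) (hd1 : d ≤ 1) (hσ : σ * σ = 1) (hσj : 0 < σ * j)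
    (hνd : ν = d ^ 2 * (σ * j)) {t : ℝ} (ht : 0 ≤ t) :
    ‖v t‖ ^ 2 ≤ 3 * ‖v 0‖ ^ 2 ∧
      ‖v t‖ ^ 2 ≤ 8 / d * Real.exp (-(d * (σ * j) / 5 * t)) * (3 * ‖v 0‖ ^ 2) := by
  set x : ℝ → Y := fun t => (2 : ℂ) • v t - v' t + (2 : ℂ) • velMode j (v t) with hx
  have hxc : Continuous x := by
    have := H.cont
    have := H.cont'
    fun_prop
  have hres : ∀ t, v t = resMode ν j 2 (x t) := fun t => by
    obtain ⟨h, hh⟩ := H.rel t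
    have := hh.eq_resMode hν hν1 (l := 2) (by norm_num)
    rw [Complex.ofReal_ofNat] at this
    exact this
  have hgen : ∀ t, genMode ν j (x t) = v' t := fun t => by
    have h1 : genMode ν j (x t) = (2 : ℂ) • resMode ν j 2 (x t) - x t +
      (2 : ℂ) • velMode j (resMode ν j 2 (x t)) := rfl
    rw [h1, ← hres]
    change (2 : ℂ) • v t - ((2 : ℂ) • v t - v' t + (2 : ℂ) • velMode j (v t)) +
      (2 : ℂ) • velMode j (v t) = v' t
    abel
  set a := d * (σ * j) with ha
  have ha0 : 0 < a := mul_pos hd hσj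
  have hνa : ν = a * d := by rw [hνd, ha]; ring
  set N : ℝ → ℝ := fun t => rin (J0.comp (resMode ν j 2) (x t)) (energyOp ν j (x t)) with hN
  set Φ : ℝ → ℝ := fun t => rin (J0.comp (resMode ν j 2) (x t)) (hypoOp ν j d σ (x t)) with hΦ
  set E : ℝ → ℝ := fun t => rin (J0.comp (resMode ν j 2) (x t)) (J0.comp (resMode ν j 2) (x t))
    with hE
  have hL : ∀ t, J0 (v t) = J0.comp (resMode ν j 2) (x t) := fun t => by
    rw [hres t]; rfl
  have dN : ∀ t, 0 ≤ t → HasDerivWithinAt N (2 * rin (J0 (v' t)) (energyOp ν j (x t)))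
      (Set.Ici t) t := fun t ht =>
    hasDerivWithinAt_quad (energyOp_symm hν hν1 hj) hxc hL (H.deriv t ht)
  have dΦ : ∀ t, 0 ≤ t → HasDerivWithinAt Φ (2 * rin (J0 (v' t)) (hypoOp ν j d σ (x t)))
      (Set.Ici t) t := fun t ht =>
    hasDerivWithinAt_quad (hypoOp_symm hν hν1 hj d σ) hxc hL (H.deriv t ht)
  have dE : ∀ t, 0 ≤ t → HasDerivWithinAt E
      (2 * rin (J0 (v' t)) (J0.comp (resMode ν j 2) (x t))) (Set.Ici t) t := fun t ht =>
    hasDerivWithinAt_quad (fun _ _ => rfl) hxc hL (H.deriv t ht)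
  have cN : Continuous N := continuous_rin (by fun_prop) (by fun_prop)
  have cΦ : Continuous Φ := continuous_rin (by fun_prop) (by fun_prop)
  have cE : Continuous E := continuous_rin (by fun_prop) (by fun_prop)
  have bN : ∀ t, 2 * rin (J0 (v' t)) (energyOp ν j (x t)) ≤ 0 := fun t => by
    rw [← hgen]
    linarith [rin_genMode_energyOp_nonpos hν hν1 hj (x t)]
  have bΦ : ∀ t, 2 * rin (J0 (v' t)) (hypoOp ν j d σ (x t)) ≤ -(a / 5) * Φ t := fun t => by
    rw [← hgen]
    exact rin_genMode_hypoOp_le hν hν1 hj hd hσ hσj hνd (x t)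
  have bE : ∀ t, 2 * rin (J0 (v' t)) (J0.comp (resMode ν j 2) (x t)) ≤
      -(2 * ν) * ‖extMode ν j (toZ.comp TestFn.D) (x t)‖ ^ 2 := fun t => by
    rw [← hgen]
    have := rin_genMode_resMode_le hν hν1 hj (x t)
    simp only [ContinuousLinearMap.comp_apply]
    linarith
  have eqv : ∀ t, ‖v t‖ ^ 2 ≤ N t ∧ N t ≤ 3 * ‖v t‖ ^ 2 := fun t => by
    have := energy_bounds hν hν1 hj (x t)
    rw [← hres] at this
    simpa [hN, ← hL] using this
  have hyp : ∀ t, N t ≤ 32 / 3 * Φ t ∧ Φ t ≤ N t / (2 * d) +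
      3 / 16 * d * ‖extMode ν j (toZ.comp TestFn.D) (x t)‖ ^ 2 := fun t =>
    hypo_bounds hν hν1 hj hd hσ hd1 (x t)
  have N0 : ∀ t, 0 ≤ N t := fun t => (sq_nonneg _).trans (eqv t).1
  have Φ0 : ∀ t, 0 ≤ Φ t := fun t => by linarith [N0 t, (hyp t).1]
  have Nle : ∀ t, 0 ≤ t → N t ≤ N 0 := fun t ht =>
    le_of_right_deriv_nonpos cN dN (fun t _ => bN t) le_rfl ht
  -- The time weighted functional `t Φ + (3 d / 32 ν) ‖v‖²` grows at most linearly.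
  have hF := le_of_right_deriv_nonpos
    (g := fun t => t * Φ t + 3 / 32 * (d / ν) * E t - t * (N 0 / (2 * d)))
    (by fun_prop) (fun t ht => (((hasDerivWithinAt_id t _).mul (dΦ t ht)).add
      ((dE t ht).const_mul (3 / 32 * (d / ν)))).sub
        ((hasDerivWithinAt_id t _).mul_const (N 0 / (2 * d)))) (fun t ht => by
      have h1 : t * (2 * rin (J0 (v' t)) (hypoOp ν j d σ (x t))) ≤ 0 := by
        have h2 : 0 ≤ a / 5 * Φ t := mul_nonneg (by positivity) (Φ0 t)
        nlinarith [bΦ t]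
      have h2 := mul_le_mul_of_nonneg_left (bE t) (show 0 ≤ 3 / 32 * (d / ν) by positivity)
      have h3 : 3 / 32 * (d / ν) * (-(2 * ν) * ‖extMode ν j (toZ.comp TestFn.D) (x t)‖ ^ 2) =
          -(3 / 16 * d * ‖extMode ν j (toZ.comp TestFn.D) (x t)‖ ^ 2) := by
        field_simp; ring
      have h4 : N t / (2 * d) ≤ N 0 / (2 * d) := by gcongr; exact Nle t ht
      simp only [id]
      linarith [(hyp t).2]) le_rfl (show 0 ≤ 1 / a by positivity)
  have E0 : E 0 ≤ N 0 := by
    have h1 : E 0 = ‖J0 (v 0)‖ ^ 2 := by rw [hE, hL]; exact rin_self _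
    rw [h1]
    refine le_trans ?_ (eqv 0).1
    gcongr
    exact norm_J0_le _
  have Epos : 0 ≤ E (1 / a) := by
    change 0 ≤ rin _ _
    rw [rin_self]; positivity
  have Φ1 : Φ (1 / a) ≤ 0.6 * N 0 / d := by
    simp only [zero_mul, zero_add, sub_zero] at hF
    have h1 : 1 / a * Φ (1 / a) ≤ 3 / 32 * (d / ν) * N 0 + 1 / a * (N 0 / (2 * d)) := by
      have h2 : 0 ≤ 3 / 32 * (d / ν) * E (1 / a) := by positivity
      have h3 : 3 / 32 * (d / ν) * E 0 ≤ 3 / 32 * (d / ν) * N 0 := by gcongr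
      linarith
    have h2 : Φ (1 / a) ≤ 3 / 32 * N 0 + N 0 / (2 * d) := by
      have h3 := mul_le_mul_of_nonneg_left h1 ha0.le
      rw [hνa] at h3
      have h4 : a * (1 / a * Φ (1 / a)) = Φ (1 / a) := by field_simp
      have h5 : a * (3 / 32 * (d / (a * d)) * N 0 + 1 / a * (N 0 / (2 * d))) =
          3 / 32 * N 0 + N 0 / (2 * d) := by field_simp
      rwa [h4, h5] at h3
    refine h2.trans ?_
    have h3 : N 0 / (2 * d) * d = N 0 / 2 := by field_simp
    rw [le_div_iff₀ hd, add_mul, h3]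
    nlinarith [N0 0]
  have e1 : Real.exp (1 / 5) ≤ 1.25 := by
    have h1 := Real.exp_one_lt_d9
    have h2 : Real.exp (1 / 5) ^ 5 = Real.exp 1 := by
      rw [← Real.exp_nat_mul]; norm_num
    by_contra! hlt
    have h3 : (1.25 : ℝ) ^ 5 ≤ Real.exp (1 / 5) ^ 5 := by gcongr
    rw [h2] at h3
    norm_num at h3
    linarith
  have hNt : N t ≤ 8 / d * Real.exp (-(a / 5 * t)) * N 0 := by
    rcases le_total t (1 / a) with h | h
    · refine (Nle t ht).trans ?_
      have h1 : Real.exp (-(1 / 5)) ≤ Real.exp (-(a / 5 * t)) := by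
        apply Real.exp_le_exp.2
        rw [le_div_iff₀ ha0] at h
        linarith
      have h2 : 1 ≤ 8 / d * Real.exp (-(a / 5 * t)) := by
        have h3 : (1 : ℝ) ≤ 1 / d := by rw [le_div_iff₀ hd]; linarith
        have h4 : 1 / 1.25 ≤ Real.exp (-(1 / 5)) := by
          rw [Real.exp_neg, ← one_div]
          exact one_div_le_one_div_of_le (Real.exp_pos _) e1
        have h5 : 8 / d = 8 * (1 / d) := by ring
        rw [h5]
        norm_num at h4
        nlinarith
      nlinarith [N0 0]
    · have h1 := le_exp_of_right_deriv_le cΦ dΦ (fun t _ => bΦ t)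
        (show 0 ≤ 1 / a by positivity) h
      have h2 : Real.exp (-(a / 5) * (t - 1 / a)) = Real.exp (1 / 5) * Real.exp (-(a / 5 * t)) := by
        rw [← Real.exp_add]
        congr 1
        field_simp
        ring
      rw [h2] at h1
      have h3 : Φ t ≤ 1.25 * Real.exp (-(a / 5 * t)) * (0.6 * N 0 / d) :=
        h1.trans (by gcongr; exact Φ0 _)
      have h4 := (hyp t).1
      have h5 : 32 / 3 * (1.25 * Real.exp (-(a / 5 * t)) * (0.6 * N 0 / d)) =
        8 / d * Real.exp (-(a / 5 * t)) * N 0 := by ring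
      linarith
  refine ⟨(eqv t).1.trans ((Nle t ht).trans (eqv 0).2), (eqv t).1.trans (hNt.trans ?_)⟩
  gcongr
  exact (eqv 0).2

end IsModeSolution

/-- Trading rate for constant: dividing the rate by `Λ` absorbs a prefactor as large as
`8 * exp ((Λ - 1) / 2)`. Below `s = 30 Λ` the trivial bound `m ≤ 1` suffices, with `exp 3 ≤ 27`; beyond
it a tenth of `s` exceeds `Λ / 2`. -/
theorem decay_rate_le {Λ s : ℝ} (hΛ : 1 ≤ Λ) (hs : 0 ≤ s) {m : ℝ} (h1 : m ≤ 1)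
    (h2 : m ≤ 8 * Real.exp ((Λ - 1) / 2) * Real.exp (-(s / 5))) :
    m ≤ 27 * Real.exp (-(1 / 10 * (s / Λ))) := by
  have hΛ0 : 0 < Λ := by linarith
  rcases le_total s (30 * Λ) with h | h
  · refine h1.trans ?_
    have h3 : s / Λ ≤ 30 := by rwa [div_le_iff₀ hΛ0]
    have h4 : Real.exp (-3) ≤ Real.exp (-(1 / 10 * (s / Λ))) := Real.exp_le_exp.2 (by linarith)
    have h5 : Real.exp 3 ≤ 27 := by
      have h6 : Real.exp 3 = Real.exp 1 ^ 3 := by rw [← Real.exp_nat_mul]; norm_num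
      have h7 : Real.exp 1 ≤ 3 := Real.exp_one_lt_three.le
      have := Real.exp_pos 1
      rw [h6]
      calc Real.exp 1 ^ 3 ≤ 3 ^ 3 := by gcongr
        _ = 27 := by norm_num
    have h8 : 1 / 27 ≤ Real.exp (-3) := by
      rw [Real.exp_neg, ← one_div]
      exact one_div_le_one_div_of_le (Real.exp_pos _) h5
    linarith
  · refine h2.trans ?_
    rw [mul_assoc, ← Real.exp_add]
    have h3 : s / Λ ≤ s := div_le_self hs hΛ
    have h4 : Real.exp ((Λ - 1) / 2 + -(s / 5)) ≤ Real.exp (-(1 / 10 * (s / Λ))) :=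
      Real.exp_le_exp.2 (by linarith)
    have := Real.exp_pos (-(1 / 10 * (s / Λ)))
    linarith

/-- The choice `d = √(ν / k)` gives `ν = d² k` and the rate `d k = √(ν k)`; the loss `1 / d` equals
`exp ((Λ - 1) / 2)` with `Λ = 1 + |log ν| + log k`. The constant `9` is the root of `3 * 27`. -/
theorem IsModeSolution.norm_le {ν : ℝ} {j : ℤ} {v v' : ℝ → Y} (H : IsModeSolution ν j v v')
    (hν : 0 < ν) (hν1 : ν < 1) {k : ℕ} (hk : k ≠ 0) (hjk : j = k ∨ j = -k) {t : ℝ} (ht : 0 ≤ t) :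
    ‖v t‖ ≤ 9 * Real.exp (-(1 / 20) * rate ν k * t) * ‖v 0‖ := by
  have hk1 : (1 : ℝ) ≤ k := by exact_mod_cast Nat.one_le_iff_ne_zero.2 hk
  have hk0 : (0 : ℝ) < k := by linarith
  have hj : j ≠ 0 := by rcases hjk with h | h <;> rw [h] <;> simpa using hk
  obtain ⟨σ, hσ, hσj⟩ : ∃ σ : ℝ, σ * σ = 1 ∧ σ * j = k := by
    rcases hjk with h | h
    · exact ⟨1, by norm_num, by rw [h]; simp⟩
    · exact ⟨-1, by norm_num, by rw [h]; simp⟩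
  set d := √ν / √k with hd
  have hsν : 0 < √ν := Real.sqrt_pos.2 hν
  have hsk : 0 < √(k : ℝ) := Real.sqrt_pos.2 hk0
  have hd0 : 0 < d := by positivity
  have hd1 : d ≤ 1 := by
    rw [hd, div_le_one hsk]
    exact Real.sqrt_le_sqrt (by linarith)
  have hνd : ν = d ^ 2 * (σ * j) := by
    rw [hσj, hd, div_pow, Real.sq_sqrt hν.le, Real.sq_sqrt hk0.le]
    field_simp
  have hda : d * (σ * j) = √ν * √k := by
    rw [hσj, hd, div_mul_eq_mul_div, div_eq_iff hsk.ne', mul_assoc, Real.mul_self_sqrt hk0.le]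
  have h1 := H.energy_decay hν hν1 hj hd0 hd1 hσ (by rw [hσj]; exact hk0) hνd ht
  rw [hda] at h1
  set Λ := 1 + |Real.log ν| + Real.log k with hΛ
  have hlν : Real.log ν < 0 := Real.log_neg hν hν1
  have hlk : 0 ≤ Real.log k := Real.log_nonneg hk1
  have hΛ1 : 1 ≤ Λ := by
    have := abs_nonneg (Real.log ν)
    linarith
  have hdΛ : 1 / d = Real.exp ((Λ - 1) / 2) := by
    have h2 : Real.exp ((Λ - 1) / 2) = Real.exp (Real.log k / 2) / Real.exp (Real.log ν / 2) := by
      rw [← Real.exp_sub, hΛ, abs_of_neg hlν]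
      congr 1
      ring
    rw [h2, ← Real.log_sqrt hk0.le, ← Real.log_sqrt hν.le, Real.exp_log hsk, Real.exp_log hsν, hd,
      one_div_div]
  set s := √ν * √k * t with hs
  have hs0 : 0 ≤ s := by positivity
  rcases (norm_nonneg (v 0)).eq_or_lt with h0 | h0
  · have h2 := h1.1
    rw [← h0] at h2
    have h3 : ‖v t‖ = 0 := by
      have : ‖v t‖ ^ 2 ≤ 0 := by simpa using h2
      nlinarith [norm_nonneg (v t)]
    rw [h3, ← h0, mul_zero]
  have hv0 : 0 < 3 * ‖v 0‖ ^ 2 := by positivity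
  have h2 := decay_rate_le hΛ1 hs0 (m := ‖v t‖ ^ 2 / (3 * ‖v 0‖ ^ 2))
    (by rw [div_le_one hv0]; exact h1.1) (by
      rw [div_le_iff₀ hv0, ← hdΛ]
      refine h1.2.trans_eq ?_
      rw [hs]
      ring_nf)
  rw [div_le_iff₀ hv0] at h2
  have h3 : s / Λ = rate ν k * t := by
    rw [rate, hs]; ring
  rw [h3] at h2
  refine abs_le_of_sq_le_sq' ?_ (by positivity) |>.2
  refine h2.trans_eq ?_
  rw [mul_pow, mul_pow, ← Real.exp_nat_mul]
  have h4 : -(1 / 10 * (rate ν k * t)) = ((2 : ℕ) : ℝ) * (-(1 / 20) * rate ν k * t) := by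
    push_cast; ring
  rw [h4]
  ring

/-! ### Fourier decomposition of the space `X` -/

theorem measurable_weight : Measurable fun y : ℝ => ENNReal.ofReal (1 + y ^ 2) := by fun_prop

theorem weight_eq_prod : weight = (volume : Measure Torus).prod lineWeight := by
  rw [weight, lineWeight, prod_withDensity_right measurable_weight]
  rfl

theorem integral_fourier (n : ℤ) :
    ∫ x : Torus, fourier n x = if n = 0 then ((2 * Real.pi : ℝ) : ℂ) else 0 := by
  have h1 := congrFun (fourierCoeff_fourier (T := 2 * Real.pi) n) 0
  rw [fourierCoeff, AddCircle.integral_haarAddCircle] at h1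
  simp only [neg_zero, fourier_zero, one_smul] at h1
  have h2 : (2 * Real.pi : ℝ) ≠ 0 := Real.two_pi_pos.ne'
  split_ifs with hn
  · subst hn
    rw [Pi.single_eq_same, inv_smul_eq_iff₀ h2] at h1
    rw [h1, Complex.real_smul, mul_one]
  · rw [Pi.single_eq_of_ne (Ne.symm hn)] at h1
    simpa [Real.pi_ne_zero] using h1

/-- The normalisation constant `(2π)^{-1/2}`. -/
def normC : ℝ := (√(2 * Real.pi))⁻¹

theorem normC_sq : normC * normC * (2 * Real.pi) = 1 := by
  have h := Real.mul_self_sqrt Real.two_pi_pos.le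
  have h0 : √(2 * Real.pi) ≠ 0 := (Real.sqrt_pos.2 Real.two_pi_pos).ne'
  rw [normC]
  field_simp
  nlinarith

theorem normC_ne_zero : (normC : ℂ) ≠ 0 := by
  have := normC_sq
  intro h
  rw [Complex.ofReal_eq_zero] at h
  rw [h] at this
  simp at this

theorem norm_fourier_apply (j : ℤ) (x : Torus) : ‖fourier j x‖ = 1 := by
  rw [fourier_apply]; exact Circle.norm_coe _

/-- The function `(2π)^{-1/2} e^{ijx} v(y)`. -/
def modeFun (j : ℤ) (v : ℝ → ℂ) (p : Torus × ℝ) : ℂ := normC * fourier j p.1 * v p.2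

theorem memLp_modeFun (j : ℤ) {v : ℝ → ℂ} (hv : MemLp v 2 lineWeight) :
    MemLp (modeFun j v) 2 weight := by
  rw [weight_eq_prod]
  have h1 : MemLp (fun p : Torus × ℝ => (normC : ℂ) * v p.2) 2
      ((volume : Measure Torus).prod lineWeight) := (hv.comp_snd _).const_mul _
  have h2 : AEStronglyMeasurable (fun p : Torus × ℝ => fourier j p.1)
      ((volume : Measure Torus).prod lineWeight) :=
    ((fourier j).continuous.comp continuous_fst).aestronglyMeasurable
  have h3 : modeFun j v = fun p => fourier j p.1 * ((normC : ℂ) * v p.2) := by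
    ext p; rw [modeFun]; ring
  rw [h3]
  refine h1.of_le (h2.mul h1.1) (Eventually.of_forall fun p => ?_)
  rw [norm_mul, norm_fourier_apply, one_mul]

theorem modeFun_congr (j : ℤ) {v w : ℝ → ℂ} (h : v =ᵐ[lineWeight] w) :
    modeFun j v =ᵐ[weight] modeFun j w := by
  rw [weight_eq_prod]
  have := Measure.quasiMeasurePreserving_snd (μ := (volume : Measure Torus)) (ν := lineWeight)
    |>.ae h
  filter_upwards [this] with p hp
  rw [modeFun, modeFun, hp]

/-- The linear map `v ↦ (2π)^{-1/2} e^{ijx} v(y)`. -/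
def modeLin (j : ℤ) : Y →ₗ[ℂ] X where
  toFun v := (memLp_modeFun j (Lp.memLp v)).toLp _
  map_add' u v := by
    rw [← MemLp.toLp_add]
    refine MemLp.toLp_congr _ _ ((modeFun_congr j (Lp.coeFn_add u v)).trans (.of_forall fun p => ?_))
    simp only [modeFun, Pi.add_apply]; ring
  map_smul' c v := by
    rw [← MemLp.toLp_const_smul]
    refine MemLp.toLp_congr _ _ ((modeFun_congr j (Lp.coeFn_smul c v)).trans
      (.of_forall fun p => ?_))
    simp only [modeFun, Pi.smul_apply, smul_eq_mul, RingHom.id_apply]; ring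

theorem coeFn_modeLin (j : ℤ) (v : Y) : modeLin j v =ᵐ[weight] modeFun j v :=
  (memLp_modeFun j (Lp.memLp v)).coeFn_toLp

theorem inner_modeLin (i j : ℤ) (u v : Y) :
    inner ℂ (modeLin i u) (modeLin j v) = if i = j then inner ℂ u v else 0 := by
  rw [L2.inner_def, L2.inner_def]
  have h1 : (fun p => inner ℂ (modeLin i u p) (modeLin j v p)) =ᵐ[weight]
      fun p => (normC * normC * fourier (j - i) p.1 : ℂ) * inner ℂ (u p.2) (v p.2) := by
    filter_upwards [coeFn_modeLin i u, coeFn_modeLin j v] with p h1 h2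
    rw [h1, h2, modeFun, modeFun]
    simp only [RCLike.inner_apply, map_mul, Complex.conj_ofReal]
    rw [sub_eq_add_neg, fourier_add, fourier_neg]
    ring
  rw [integral_congr_ae h1, weight_eq_prod,
    integral_prod_mul (fun x : Torus => (normC * normC * fourier (j - i) x : ℂ))
      (fun y => inner ℂ (u y) (v y)), integral_const_mul, integral_fourier]
  by_cases h : i = j
  · rw [if_pos h, if_pos (by rw [h, sub_self])]
    have := normC_sq
    rw [show (normC * normC * ((2 * Real.pi : ℝ) : ℂ) : ℂ) = ((normC * normC * (2 * Real.pi) : ℝ) : ℂ)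
      by push_cast; ring, this, Complex.ofReal_one, one_mul]
  · rw [if_neg h, if_neg (by rw [sub_eq_zero]; exact fun h' => h h'.symm), mul_zero, zero_mul]

/-- The isometric embedding `v ↦ (2π)^{-1/2} e^{ijx} v(y)` of the `j`-th Fourier mode. -/
def modeEmb (j : ℤ) : Y →ₗᵢ[ℂ] X where
  toLinearMap := modeLin j
  norm_map' v := by
    have h := inner_modeLin j j v v
    rw [if_pos rfl, inner_self_eq_norm_sq_to_K, inner_self_eq_norm_sq_to_K] at h
    have h2 : ‖modeLin j v‖ ^ 2 = ‖v‖ ^ 2 := by exact_mod_cast h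
    exact (pow_left_inj₀ (norm_nonneg _) (norm_nonneg _) two_ne_zero).1 h2

theorem coeFn_modeEmb (j : ℤ) (v : Y) : modeEmb j v =ᵐ[weight] modeFun j v := coeFn_modeLin j v

/-- The profile of the `j`-th Fourier mode of `f`. -/
def coeff (j : ℤ) : X →L[ℂ] Y := ContinuousLinearMap.adjoint (modeEmb j).toContinuousLinearMap

theorem inner_coeff (j : ℤ) (v : Y) (f : X) : inner ℂ v (coeff j f) = inner ℂ (modeEmb j v) f :=
  ContinuousLinearMap.adjoint_inner_right _ _ _

theorem orthogonalFamily_modeEmb : OrthogonalFamily ℂ (fun _ : ℤ => Y) modeEmb := by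
  intro i j hij u v
  have := inner_modeLin i j u v
  rwa [if_neg hij] at this

theorem coeff_modeEmb (i j : ℤ) (v : Y) : coeff i (modeEmb j v) = if i = j then v else 0 := by
  refine ext_inner_left ℂ fun u => ?_
  rw [inner_coeff]
  refine (inner_modeLin i j u v).trans ?_
  split_ifs <;> simp

theorem ae_eq_zero_of_fourierCoeff {g : Torus → ℂ} (hg : MemLp g 2 volume)
    (h : ∀ j : ℤ, ∫ x, fourier (-j) x * g x = 0) : g =ᵐ[volume] 0 := by
  have hm := memLp_haarAddCircle_iff.2 hg
  have h1 : hm.toLp g = 0 := by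
    apply (fourierBasis (T := 2 * Real.pi)).repr.injective
    ext j
    rw [fourierBasis_repr, map_zero, fourierCoeff_congr_ae hm.coeFn_toLp, fourierCoeff,
      AddCircle.integral_haarAddCircle]
    simp only [smul_eq_mul]
    rw [h j, smul_zero]
    rfl
  have h2 : g =ᵐ[AddCircle.haarAddCircle] 0 := by
    have h3 := hm.coeFn_toLp
    rw [h1] at h3
    exact h3.symm.trans (Lp.coeFn_zero _ _ _)
  rw [AddCircle.volume_eq_smul_haarAddCircle]
  exact Measure.ae_smul_measure h2 _

theorem integrable_inner_modeEmb (j : ℤ) (v : Y) (f : X) :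
    Integrable (fun p => (normC * fourier (-j) p.1 * starRingEnd ℂ (v p.2)) * f p) weight ∧
      inner ℂ (modeEmb j v) f =
        ∫ p, (normC * fourier (-j) p.1 * starRingEnd ℂ (v p.2)) * f p ∂weight := by
  have h1 : (fun p => inner ℂ (modeEmb j v p) (f p)) =ᵐ[weight]
      fun p => (normC * fourier (-j) p.1 * starRingEnd ℂ (v p.2)) * f p := by
    filter_upwards [coeFn_modeEmb j v] with p h1
    rw [h1, modeFun]
    simp only [RCLike.inner_apply, map_mul, Complex.conj_ofReal]
    rw [fourier_neg]
    ring
  exact ⟨(L2.integrable_inner (𝕜 := ℂ) (modeEmb j v) f).congr h1, by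
    rw [L2.inner_def, integral_congr_ae h1]⟩

/-- Completeness of the Fourier modes: the profiles vanish exactly when, on almost every horizontal
line, all Fourier coefficients do. -/
theorem eq_zero_of_coeff {f : X} (h : ∀ j, coeff j f = 0) : f = 0 := by
  set F : Torus × ℝ → ℂ := ⇑f with hF
  have hFm : StronglyMeasurable F := Lp.stronglyMeasurable f
  have hF2 : Integrable (fun p => ‖F p‖ ^ 2) ((volume : Measure Torus).prod lineWeight) := by
    rw [← weight_eq_prod]
    exact (memLp_two_iff_integrable_sq_norm (Lp.memLp f).1).1 (Lp.memLp f)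
  -- The Fourier coefficients in `x` vanish for almost every `y`.
  have h1 : ∀ j : ℤ, ∀ᵐ y ∂lineWeight, ∫ x : Torus, fourier (-j) x * F (x, y) = 0 := by
    intro j
    have key : ∀ s : Set ℝ, MeasurableSet s → lineWeight s < ⊤ →
        Integrable (s.indicator fun y => ∫ x : Torus, fourier (-j) x * F (x, y)) lineWeight ∧
        ∫ y in s, (∫ x : Torus, fourier (-j) x * F (x, y)) ∂lineWeight = 0 := by
      intro s hs hμs
      obtain ⟨hi, he⟩ := integrable_inner_modeEmb j (indicatorConstLp 2 hs hμs.ne (1 : ℂ)) f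
      have hz : (fun p : Torus × ℝ => (normC * fourier (-j) p.1 *
          starRingEnd ℂ (indicatorConstLp 2 hs hμs.ne (1 : ℂ) p.2)) * F p) =ᵐ[weight]
          fun p => normC * s.indicator (fun y => fourier (-j) p.1 * F (p.1, y)) p.2 := by
        rw [weight_eq_prod]
        filter_upwards [Measure.quasiMeasurePreserving_snd (μ := (volume : Measure Torus))
          (ν := lineWeight) |>.ae (indicatorConstLp_coeFn (p := 2) (hs := hs) (hμs := hμs.ne)
            (c := (1 : ℂ)))] with p hp
        rw [hp]
        by_cases hps : p.2 ∈ s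
        · simp [hps, mul_assoc]
        · simp [hps]
      have hsl : ∀ y, ∫ x : Torus, normC * s.indicator (fun y => fourier (-j) x * F (x, y)) y =
          normC * s.indicator (fun y => ∫ x : Torus, fourier (-j) x * F (x, y)) y := by
        intro y
        rw [integral_const_mul]
        by_cases hps : y ∈ s <;> simp [hps]
      have hi' := hi.congr hz
      rw [integral_congr_ae hz, ← inner_coeff, h j, inner_zero_right] at he
      rw [weight_eq_prod] at hi' he
      have hi2 := hi'.integral_prod_right
      rw [integral_prod_symm _ hi'] at he
      simp only [hsl] at hi2 he
      rw [integral_const_mul, integral_indicator hs] at he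
      exact ⟨(integrable_const_mul_iff (IsUnit.mk0 _ normC_ne_zero) _).1 hi2,
        (mul_eq_zero.1 he.symm).resolve_left normC_ne_zero⟩
    exact ae_eq_zero_of_forall_setIntegral_eq_of_sigmaFinite
      (fun s hs hμs => (integrable_indicator_iff hs).1 (key s hs hμs).1)
      (fun s hs hμs => (key s hs hμs).2)
  have h2 : ∀ᵐ y ∂lineWeight, ∀ᵐ x : Torus, F (x, y) = 0 := by
    filter_upwards [ae_all_iff.2 h1, hF2.prod_left_ae] with y hy hy2
    exact ae_eq_zero_of_fourierCoeff ((memLp_two_iff_integrable_sq_norm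
      (hFm.comp_measurable measurable_prodMk_right).aestronglyMeasurable).2 hy2) hy
  have hms : MeasurableSet {p : Torus × ℝ | F (p.1, p.2) = 0} :=
    hFm.measurable (measurableSet_singleton 0)
  have h3 : ∀ᵐ p ∂weight, F p = 0 := by
    rw [weight_eq_prod]
    exact (Measure.ae_prod_iff_ae_ae hms).2 ((Measure.ae_ae_comm hms).2 h2)
  exact (Lp.eq_zero_iff_ae_eq_zero).2 h3

theorem isHilbertSum_modeEmb : IsHilbertSum ℂ (fun _ : ℤ => Y) modeEmb := by
  refine IsHilbertSum.mk orthogonalFamily_modeEmb ?_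
  rw [top_le_iff, Submodule.topologicalClosure_eq_top_iff, Submodule.eq_bot_iff]
  intro f hf
  refine eq_zero_of_coeff fun j => ext_inner_left ℂ fun v => ?_
  rw [inner_coeff, inner_zero_right]
  exact hf _ (Submodule.mem_iSup_of_mem j ⟨v, rfl⟩)

theorem coeff_of_hasSum {f : X} {v : ℤ → Y} (h : HasSum (fun j => modeEmb j (v j)) f) (j : ℤ) :
    coeff j f = v j := by
  have h1 := h.mapL (coeff j)
  refine h1.unique ?_
  simp only [coeff_modeEmb]
  convert hasSum_ite_eq j (v j) using 2 with i
  split_ifs with h1 h2 h2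
  · rw [h1]
  · exact absurd h1.symm h2
  · exact absurd h2.symm h1
  · rfl

theorem hasSum_modeEmb_coeff (f : X) : HasSum (fun j => modeEmb j (coeff j f)) f := by
  obtain ⟨w, hw⟩ := isHilbertSum_modeEmb.surjective_isometry f
  have h1 := isHilbertSum_modeEmb.OrthogonalFamily.hasSum_linearIsometry w
  rw [hw] at h1
  simpa only [coeff_of_hasSum h1] using h1

theorem hasSum_norm_sq_coeff (f : X) : HasSum (fun j => ‖coeff j f‖ ^ 2) (‖f‖ ^ 2) := by
  have h1 := ((hasSum_modeEmb_coeff f).mapL (innerSL ℂ f)).mapL Complex.reCLM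
  have h2 : Complex.reCLM (innerSL ℂ f f) = ‖f‖ ^ 2 := by
    rw [innerSL_apply_apply, Complex.reCLM_apply, ← RCLike.re_eq_complex_re, inner_self_eq_norm_sq]
  have h3 : ∀ j, Complex.reCLM (innerSL ℂ f (modeEmb j (coeff j f))) = ‖coeff j f‖ ^ 2 := fun j => by
    rw [innerSL_apply_apply, Complex.reCLM_apply, ← inner_conj_symm, ← inner_coeff, Complex.conj_re,
      ← RCLike.re_eq_complex_re, inner_self_eq_norm_sq]
  rw [h2] at h1
  simpa only [h3] using h1

theorem norm_le_of_coeff_le {f g : X} {C : ℝ} (hC : 0 ≤ C)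
    (h : ∀ j, ‖coeff j f‖ ≤ C * ‖coeff j g‖) : ‖f‖ ≤ C * ‖g‖ := by
  refine abs_le_of_sq_le_sq' ?_ (by positivity) |>.2
  rw [mul_pow]
  refine hasSum_le (fun j => ?_) (hasSum_norm_sq_coeff f)
    ((hasSum_norm_sq_coeff g).mul_left (C ^ 2))
  rw [← mul_pow]
  exact pow_le_pow_left₀ (norm_nonneg _) (h j) 2

/-- Profiles dominated by the Fourier profiles of an element of `X` can be summed. -/
theorem exists_hasSum_modeEmb {g : X} {C : ℝ} {v : ℤ → Y}
    (h : ∀ j, ‖v j‖ ≤ C * ‖coeff j g‖) : ∃ f, HasSum (fun j => modeEmb j (v j)) f := by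
  refine (orthogonalFamily_modeEmb.summable_iff_norm_sq_summable v).2 ?_
  refine Summable.of_nonneg_of_le (fun _ => sq_nonneg _) (fun j => ?_)
    ((hasSum_norm_sq_coeff g).summable.mul_left (C ^ 2))
  rw [← mul_pow]
  exact pow_le_pow_left₀ (norm_nonneg _) (h j) 2

/-! ### Test functions on `𝕋 × ℝ` -/

/-- The lift of a function on `𝕋 × ℝ` to `ℝ × ℝ`. -/
def lift (Φ : Torus × ℝ → ℂ) (q : ℝ × ℝ) : ℂ := Φ ((q.1 : Torus), q.2)

theorem exists_rep (p : Torus × ℝ) : ∃ q : ℝ × ℝ, ((q.1 : Torus), q.2) = p := by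
  obtain ⟨x, y⟩ := p
  obtain ⟨a, rfl⟩ := QuotientAddGroup.mk_surjective x
  exact ⟨(a, y), rfl⟩

namespace IsTest

variable {Φ Ψ : Torus × ℝ → ℂ}

theorem contDiff_lift (h : IsTest Φ) : ContDiff ℝ ∞ (lift Φ) := h.1

theorem continuous (h : IsTest Φ) : Continuous Φ := by
  have hq : IsOpenQuotientMap (fun q : ℝ × ℝ => ((q.1 : Torus), q.2)) :=
    QuotientAddGroup.isOpenQuotientMap_mk.prodMap IsOpenQuotientMap.id
  exact hq.continuous_comp_iff.1 h.1.continuous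

theorem hasFDerivAt (h : IsTest Φ) (q : ℝ × ℝ) :
    HasFDerivAt (lift Φ) (fderiv ℝ (lift Φ) q) q :=
  (h.contDiff_lift.differentiable (by simp) q).hasFDerivAt

theorem hasDerivAt_fst (h : IsTest Φ) (q : ℝ × ℝ) (s : ℝ) :
    HasDerivAt (fun s => lift Φ (q.1 + s, q.2)) (fderiv ℝ (lift Φ) (q.1 + s, q.2) (1, 0)) s := by
  have h1 : HasDerivAt (fun s : ℝ => (q.1 + s, q.2)) ((1, 0) : ℝ × ℝ) s :=
    ((hasDerivAt_id s).const_add q.1).prodMk (hasDerivAt_const s q.2)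
  exact (h.hasFDerivAt _).comp_hasDerivAt s h1

theorem hasDerivAt_snd (h : IsTest Φ) (x s : ℝ) :
    HasDerivAt (fun s => lift Φ (x, s)) (fderiv ℝ (lift Φ) (x, s) (0, 1)) s := by
  have h1 : HasDerivAt (fun s : ℝ => (x, s)) ((0, 1) : ℝ × ℝ) s :=
    (hasDerivAt_const s x).prodMk (hasDerivAt_id s)
  exact (h.hasFDerivAt _).comp_hasDerivAt s h1

theorem lift_dx (h : IsTest Φ) (q : ℝ × ℝ) : lift (dx Φ) q = fderiv ℝ (lift Φ) q (1, 0) := by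
  have h1 := (h.hasDerivAt_fst q 0).deriv
  rw [add_zero] at h1
  exact h1

theorem lift_dy (h : IsTest Φ) (q : ℝ × ℝ) : lift (dy Φ) q = fderiv ℝ (lift Φ) q (0, 1) :=
  (h.hasDerivAt_snd q.1 q.2).deriv

theorem contDiff_fderiv_apply (h : IsTest Φ) (w : ℝ × ℝ) :
    ContDiff ℝ ∞ fun q => fderiv ℝ (lift Φ) q w :=
  (h.contDiff_lift.fderiv_right (m := ∞) (by simp)).clm_apply contDiff_const

theorem dx (h : IsTest Φ) : IsTest (dx Φ) := by
  refine ⟨?_, h.2.mono' fun p hp => ?_⟩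
  · have h1 : lift (Poiseuille.dx Φ) = fun q => fderiv ℝ (lift Φ) q (1, 0) := funext h.lift_dx
    change ContDiff ℝ ∞ (lift (Poiseuille.dx Φ))
    rw [h1]
    exact h.contDiff_fderiv_apply _
  · by_contra hn
    rw [notMem_tsupport_iff_eventuallyEq] at hn
    have h2 : Tendsto (fun s : ℝ => (p.1 + (s : Torus), p.2)) (𝓝 0) (𝓝 p) := by
      have : Continuous fun s : ℝ => (p.1 + (s : Torus), p.2) := by
        have := AddCircle.continuous_mk' (2 * Real.pi)
        fun_prop
      have h3 := this.tendsto 0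
      simpa using h3
    have h3 : (fun s : ℝ => Φ (p.1 + (s : Torus), p.2)) =ᶠ[𝓝 0] fun _ => 0 := h2.eventually hn
    exact hp (h3.deriv_eq.trans (deriv_const _ _))

theorem dy (h : IsTest Φ) : IsTest (dy Φ) := by
  refine ⟨?_, h.2.mono' fun p hp => ?_⟩
  · have h1 : lift (Poiseuille.dy Φ) = fun q => fderiv ℝ (lift Φ) q (0, 1) := funext h.lift_dy
    change ContDiff ℝ ∞ (lift (Poiseuille.dy Φ))
    rw [h1]
    exact h.contDiff_fderiv_apply _
  · by_contra hn
    rw [notMem_tsupport_iff_eventuallyEq] at hn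
    have h2 : Tendsto (fun s : ℝ => (p.1, s)) (𝓝 p.2) (𝓝 p) :=
      (by fun_prop : Continuous fun s : ℝ => (p.1, s)).tendsto p.2
    have h3 : (fun s : ℝ => Φ (p.1, s)) =ᶠ[𝓝 p.2] fun _ => 0 := h2.eventually hn
    exact hp (h3.deriv_eq.trans (deriv_const _ _))

theorem add (h : IsTest Φ) (h' : IsTest Ψ) : IsTest (fun p => Φ p + Ψ p) :=
  ⟨h.1.add h'.1, h.2.add h'.2⟩

theorem mul (h : IsTest Φ) (h' : IsTest Ψ) : IsTest (fun p => Φ p * Ψ p) :=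
  ⟨h.1.mul h'.1, h'.2.mul_left⟩

theorem lap (h : IsTest Φ) : IsTest (lap Φ) := h.dx.dx.add h.dy.dy

theorem dx_mul (h : IsTest Φ) (h' : IsTest Ψ) (p : Torus × ℝ) :
    Poiseuille.dx (fun p => Φ p * Ψ p) p = Poiseuille.dx Φ p * Ψ p + Φ p * Poiseuille.dx Ψ p := by
  obtain ⟨q, rfl⟩ := exists_rep p
  have h1 := ((h.hasDerivAt_fst q 0).mul (h'.hasDerivAt_fst q 0)).deriv
  rw [add_zero, ← h.lift_dx, ← h'.lift_dx] at h1
  exact h1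

theorem dy_mul (h : IsTest Φ) (h' : IsTest Ψ) (p : Torus × ℝ) :
    Poiseuille.dy (fun p => Φ p * Ψ p) p = Poiseuille.dy Φ p * Ψ p + Φ p * Poiseuille.dy Ψ p := by
  obtain ⟨q, rfl⟩ := exists_rep p
  have h1 := ((h.hasDerivAt_snd q.1 q.2).mul (h'.hasDerivAt_snd q.1 q.2)).deriv
  rw [← h.lift_dy, ← h'.lift_dy] at h1
  exact h1

theorem integrable (h : IsTest Φ) : Integrable Φ := by
  have : IsFiniteMeasureOnCompacts (volume : Measure (Torus × ℝ)) := by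
    rw [Measure.volume_eq_prod]; infer_instance
  exact h.continuous.integrable_of_hasCompactSupport h.2

theorem integral_dx (h : IsTest Φ) : ∫ p, Poiseuille.dx Φ p = 0 := by
  have hi := h.dx.integrable
  rw [Measure.volume_eq_prod] at hi ⊢
  rw [integral_prod_symm _ hi]
  refine integral_eq_zero_of_ae (.of_forall fun y => ?_)
  simp only [Pi.zero_apply]
  rw [← AddCircle.intervalIntegral_preimage (2 * Real.pi) 0]
  have h1 : ∀ s : ℝ, HasDerivAt (fun s => lift Φ (s, y)) (Poiseuille.dx Φ ((s : Torus), y)) s := by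
    intro s
    have h2 := h.hasDerivAt_fst (0, y) s
    simp only [zero_add] at h2
    rw [← h.lift_dx] at h2
    exact h2
  rw [intervalIntegral.integral_eq_sub_of_hasDerivAt (fun s _ => h1 s)]
  · simp only [lift, AddCircle.coe_period, zero_add]
    rw [show ((0 : ℝ) : Torus) = 0 from rfl, sub_self]
  · refine Continuous.intervalIntegrable ?_ _ _
    have := AddCircle.continuous_mk' (2 * Real.pi)
    have := h.dx.continuous
    fun_prop

theorem hasCompactSupport_slice (h : IsTest Φ) (x : Torus) :
    HasCompactSupport fun y => Φ (x, y) := by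
  have h1 : IsClosedEmbedding (fun y : ℝ => (x, y)) := by
    refine ⟨isEmbedding_prodMkRight x, ?_⟩
    have h2 : Set.range (fun y : ℝ => (x, y)) = {x} ×ˢ Set.univ := by
      ext p
      simp [Prod.ext_iff, eq_comm]
    rw [h2]
    exact isClosed_singleton.prod isClosed_univ
  exact h.2.comp_isClosedEmbedding h1

theorem integral_dy (h : IsTest Φ) : ∫ p, Poiseuille.dy Φ p = 0 := by
  have hi := h.dy.integrable
  rw [Measure.volume_eq_prod] at hi ⊢
  rw [integral_prod _ hi]
  refine integral_eq_zero_of_ae (.of_forall fun x => ?_)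
  simp only [Pi.zero_apply]
  obtain ⟨a, rfl⟩ := QuotientAddGroup.mk_surjective x
  have hc := h.continuous
  have hc' := h.dy.continuous
  refine integral_eq_zero_of_hasDerivAt_of_integrable (f := fun y => Φ ((a : Torus), y))
    (fun y => ?_) ?_ ?_
  · have h1 := h.hasDerivAt_snd a y
    rw [← h.lift_dy] at h1
    exact h1
  · exact (by fun_prop : Continuous _).integrable_of_hasCompactSupport (h.dy.hasCompactSupport_slice _)
  · exact (by fun_prop : Continuous _).integrable_of_hasCompactSupport (h.hasCompactSupport_slice _)

theorem integral_mul_dx (h : IsTest Φ) (h' : IsTest Ψ) :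
    ∫ p, Φ p * Poiseuille.dx Ψ p = -∫ p, Poiseuille.dx Φ p * Ψ p := by
  have h1 := (h.mul h').integral_dx
  simp only [h.dx_mul h'] at h1
  rw [integral_add (h.dx.mul h').integrable (h.mul h'.dx).integrable] at h1
  exact eq_neg_of_add_eq_zero_right h1

theorem integral_mul_dy (h : IsTest Φ) (h' : IsTest Ψ) :
    ∫ p, Φ p * Poiseuille.dy Ψ p = -∫ p, Poiseuille.dy Φ p * Ψ p := by
  have h1 := (h.mul h').integral_dy
  simp only [h.dy_mul h'] at h1
  rw [integral_add (h.dy.mul h').integrable (h.mul h'.dy).integrable] at h1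
  exact eq_neg_of_add_eq_zero_right h1

theorem integral_mul_lap (h : IsTest Φ) (h' : IsTest Ψ) :
    ∫ p, Φ p * Poiseuille.lap Ψ p = ∫ p, Poiseuille.lap Φ p * Ψ p := by
  simp only [Poiseuille.lap, mul_add, add_mul]
  rw [integral_add (h.mul h'.dx.dx).integrable (h.mul h'.dy.dy).integrable,
    integral_add (h.dx.dx.mul h').integrable (h.dy.dy.mul h').integrable,
    h.integral_mul_dx h'.dx, h.dx.integral_mul_dx h', h.integral_mul_dy h'.dy,
    h.dy.integral_mul_dy h', neg_neg, neg_neg]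

end IsTest

/-! ### Tensor products of a character and a test function -/

/-- The function `e^{ijx} φ(y)`. -/
def tens (j : ℤ) (φ : TestFn) (p : Torus × ℝ) : ℂ := fourier j p.1 * φ.1 p.2

theorem hasDerivAt_fourier_two_pi (j : ℤ) (a : ℝ) :
    HasDerivAt (fun a : ℝ => fourier j (a : Torus)) (Complex.I * j * fourier j (a : Torus)) a := by
  have h := hasDerivAt_fourier (2 * Real.pi) j a
  convert h using 1
  have : (Real.pi : ℂ) ≠ 0 := by exact_mod_cast Real.pi_ne_zero
  push_cast
  field_simp

theorem isTest_tens (j : ℤ) (φ : TestFn) : IsTest (tens j φ) := by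
  constructor
  · have h1 : (fun q : ℝ × ℝ => tens j φ ((q.1 : Torus), q.2)) =
        fun q : ℝ × ℝ => Complex.exp (Complex.I * j * q.1) * φ.1 q.2 := by
      ext q
      rw [tens, fourier_coe_apply]
      congr 2
      have : (Real.pi : ℂ) ≠ 0 := by exact_mod_cast Real.pi_ne_zero
      push_cast
      field_simp
    rw [h1]
    have h2 : ContDiff ℝ ∞ fun q : ℝ × ℝ => Complex.exp (Complex.I * j * q.1) :=
      ((contDiff_const.mul (Complex.ofRealCLM.contDiff.comp contDiff_fst))).cexp
    exact h2.mul (φ.contDiff.comp contDiff_snd)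
  · refine HasCompactSupport.intro (K := Set.univ ×ˢ tsupport φ.1) (isCompact_univ.prod φ.compact)
      fun p hp => ?_
    have : p.2 ∉ tsupport φ.1 := fun h => hp ⟨trivial, h⟩
    rw [tens, image_eq_zero_of_notMem_tsupport this, mul_zero]

theorem dx_tens (j : ℤ) (φ : TestFn) (p : Torus × ℝ) :
    dx (tens j φ) p = Complex.I * j * tens j φ p := by
  obtain ⟨q, rfl⟩ := exists_rep p
  have h1 : HasDerivAt (fun s : ℝ => fourier j ((q.1 + s : ℝ) : Torus) * φ.1 q.2)
      (Complex.I * j * fourier j (q.1 : Torus) * φ.1 q.2) 0 := by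
    have h2 := hasDerivAt_fourier_two_pi j (q.1 + 0)
    have h3 := (h2.comp_const_add q.1 0).mul_const (φ.1 q.2)
    rwa [add_zero] at h3
  exact h1.deriv.trans (mul_assoc _ _ _)

theorem dy_tens (j : ℤ) (φ : TestFn) (p : Torus × ℝ) : dy (tens j φ) p = tens j (φ.D) p :=
  ((φ.differentiable p.2).hasDerivAt.const_mul (fourier j p.1)).deriv

theorem lap_tens (j : ℤ) (φ : TestFn) (p : Torus × ℝ) :
    lap (tens j φ) p = tens j (lapMode j φ) p := by
  have h1 : dx (tens j φ) = fun p => Complex.I * j * tens j φ p := funext (dx_tens j φ)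
  have h2 : dy (tens j φ) = tens j φ.D := funext (dy_tens j φ)
  have h3 : dx (fun p => Complex.I * j * tens j φ p) p = Complex.I * j * dx (tens j φ) p := by
    simp only [dx, deriv_const_mul_field]
  rw [lap, h2, dy_tens, h1, h3, dx_tens, lapMode_apply]
  change _ = fourier j p.1 * ((TestFn.D (TestFn.D φ)).1 p.2 - (j : ℂ) ^ 2 * φ.1 p.2)
  rw [tens, tens]
  linear_combination (j : ℂ) ^ 2 * fourier j p.1 * φ.1 p.2 * Complex.I_sq

/-! ### The operator on `X` and its Fourier modes -/

theorem integral_weight (g : Torus × ℝ → ℂ) :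
    ∫ p, g p ∂weight = ∫ p, ((1 + p.2 ^ 2 : ℝ) : ℂ) * g p := by
  have h1 := integral_withDensity_eq_integral_smul (μ := (volume : Measure (Torus × ℝ)))
    (f := fun p : Torus × ℝ => (1 + p.2 ^ 2).toNNReal) (by fun_prop) g
  have h2 : (fun p : Torus × ℝ => (1 + p.2 ^ 2).toNNReal • g p) =
      fun p => ((1 + p.2 ^ 2 : ℝ) : ℂ) * g p := by
    ext p
    rw [NNReal.smul_def, Real.coe_toNNReal _ (one_add_sq_pos p.2).le, Complex.real_smul]
  rw [h2] at h1
  exact h1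

theorem volume_absolutelyContinuous_weight : (volume : Measure (Torus × ℝ)) ≪ weight :=
  withDensity_absolutelyContinuous' (by fun_prop)
    (.of_forall fun p => by simpa using one_add_sq_pos p.2)

/-- Integration against a continuous compactly supported function is continuous on `X`. -/
theorem exists_pairing {Φ : Torus × ℝ → ℂ} (hΦ : Continuous Φ) (hc : HasCompactSupport Φ) :
    ∃ L : X →L[ℂ] ℂ, ∀ f : X, L f = ∫ p, f p * Φ p := by
  have hfin : IsFiniteMeasureOnCompacts weight := by
    rw [weight_eq_prod]; infer_instance
  have hw : ∀ p : Torus × ℝ, ((1 + p.2 ^ 2 : ℝ) : ℂ) ≠ 0 := fun p => by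
    exact_mod_cast (one_add_sq_pos p.2).ne'
  have hΨ : Continuous fun p : Torus × ℝ =>
      (((1 + p.2 ^ 2 : ℝ) : ℂ))⁻¹ * starRingEnd ℂ (Φ p) :=
    ((by fun_prop : Continuous fun p : Torus × ℝ => ((1 + p.2 ^ 2 : ℝ) : ℂ)).inv₀ hw).mul
      (Complex.continuous_conj.comp hΦ)
  have hm : MemLp (fun p : Torus × ℝ => (((1 + p.2 ^ 2 : ℝ) : ℂ))⁻¹ * starRingEnd ℂ (Φ p)) 2
      weight :=
    hΨ.memLp_of_hasCompactSupport ((hc.comp_left (map_zero (starRingEnd ℂ))).mul_left)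
  refine ⟨innerSL ℂ (hm.toLp _), fun f => ?_⟩
  rw [innerSL_apply_apply, L2.inner_def]
  have h1 : (fun p => inner ℂ (hm.toLp _ p) (f p)) =ᵐ[weight]
      fun p => (((1 + p.2 ^ 2 : ℝ) : ℂ))⁻¹ * (f p * Φ p) := by
    filter_upwards [hm.coeFn_toLp] with p hp
    rw [hp, RCLike.inner_apply, map_mul, map_inv₀, Complex.conj_ofReal, Complex.conj_conj]
    ring
  rw [integral_congr_ae h1, integral_weight]
  refine integral_congr_ae (.of_forall fun p => ?_)
  exact mul_inv_cancel_left₀ (hw p) _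

/-- Division of a test function by the weight. -/
def divWeight (φ : TestFn) : TestFn :=
  ⟨fun y => ((1 + y ^ 2 : ℝ) : ℂ)⁻¹ * φ.1 y, by
    refine ContDiff.mul (ContDiff.inv (Complex.ofRealCLM.contDiff.comp
      (contDiff_const.add (contDiff_id.pow 2))) fun y => ?_)
      φ.contDiff
    exact_mod_cast (one_add_sq_pos y).ne', φ.compact.mul_left⟩

theorem divWeight_add (φ : TestFn) : divWeight φ + M (M (divWeight φ)) = φ := by
  ext y
  have : ((1 + y ^ 2 : ℝ) : ℂ) ≠ 0 := by exact_mod_cast (one_add_sq_pos y).ne'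
  change ((1 + y ^ 2 : ℝ) : ℂ)⁻¹ * φ.1 y + (y : ℂ) * ((y : ℂ) * (((1 + y ^ 2 : ℝ) : ℂ)⁻¹ * φ.1 y)) =
    φ.1 y
  field_simp
  push_cast
  ring

theorem inner_toZ_J0 (φ : TestFn) (u : Y) :
    inner ℂ (toZ φ) (J0 u) = inner ℂ (toY (divWeight φ)) u := by
  rw [inner_Y, J0_toY, J1_toY, ← inner_toZ_M, ← inner_add_left, ← map_add, divWeight_add]

/-- Unweighted pairing of the `j`-th Fourier profile with a test function. -/
theorem inner_toZ_coeff (j : ℤ) (φ : TestFn) (f : X) :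
    inner ℂ (toZ φ) (J0 (coeff j f)) = normC * ∫ p, f p * tens (-j) φ.conj p := by
  rw [inner_toZ_J0, inner_coeff, (integrable_inner_modeEmb _ _ _).2, integral_weight,
    ← integral_const_mul]
  have h1 := volume_absolutelyContinuous_weight.ae_le
    (show ∀ᵐ p ∂weight, toY (divWeight φ) p.2 = (divWeight φ).1 p.2 by
      rw [weight_eq_prod]
      exact Measure.quasiMeasurePreserving_snd.ae (coeFn_toL2 lineWeight (divWeight φ)))
  refine integral_congr_ae ?_
  filter_upwards [h1] with p hp
  have hw : ((1 + p.2 ^ 2 : ℝ) : ℂ) ≠ 0 := by exact_mod_cast (one_add_sq_pos p.2).ne'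
  have h2 : (divWeight φ).1 p.2 = ((1 + p.2 ^ 2 : ℝ) : ℂ)⁻¹ * φ.1 p.2 := rfl
  have h3 : φ.conj.1 p.2 = starRingEnd ℂ (φ.1 p.2) := rfl
  rw [hp, h2, tens, h3, map_mul, map_inv₀, Complex.conj_ofReal]
  field_simp

theorem conj_D (φ : TestFn) : D φ.conj = (D φ).conj := by
  ext y
  exact ((Complex.conjCLE : ℂ →L[ℝ] ℂ).hasFDerivAt.comp_hasDerivAt y
    (φ.differentiable y).hasDerivAt).deriv

theorem conj_lapMode (j : ℤ) (φ : TestFn) : lapMode (-j) φ.conj = (lapMode j φ).conj := by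
  rw [lapMode_apply, lapMode_apply, conj_D, conj_D]
  ext y
  change starRingEnd ℂ ((D (D φ)).1 y) - ((-j : ℤ) : ℂ) ^ 2 * starRingEnd ℂ (φ.1 y) =
    starRingEnd ℂ ((D (D φ)).1 y - (j : ℂ) ^ 2 * φ.1 y)
  simp

theorem isDxInvLap_coeff {f h : X} (H : IsDxInvLap f h) (j : ℤ) (φ : TestFn) :
    inner ℂ (toZ (lapMode j φ)) (J0 (coeff j h)) =
      (Complex.I * j) * inner ℂ (toZ φ) (J0 (coeff j f)) := by
  rw [inner_toZ_coeff, inner_toZ_coeff, ← conj_lapMode]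
  have h1 := H _ (isTest_tens (-j) φ.conj)
  simp only [lap_tens, dx_tens] at h1
  rw [h1]
  have h2 : ∀ p, f p * (Complex.I * ((-j : ℤ) : ℂ) * tens (-j) φ.conj p) =
      -(Complex.I * j) * (f p * tens (-j) φ.conj p) := fun p => by push_cast; ring
  simp only [h2]
  rw [integral_const_mul]
  ring

/-- The Fourier modes of `g = 𝓛 f`. -/
theorem IsLinOp.modeRel {ν : ℝ} {f g : X} (H : IsLinOp ν f g) (j : ℤ) :
    ∃ h, ModeRel ν j (coeff j f) h (coeff j g) := by
  obtain ⟨h, H1, H2⟩ := H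
  refine ⟨coeff j h, isDxInvLap_coeff H1 j, fun φ => ?_⟩
  have h1 := H2 _ (isTest_tens (-j) φ.conj)
  simp only [lap_tens, dx_tens] at h1
  have h2 : ∀ p : Torus × ℝ, f p * ((p.2 : ℂ) ^ 2 * (Complex.I * ((-j : ℤ) : ℂ) *
      tens (-j) φ.conj p)) = -(Complex.I * j) * (f p * tens (-j) (M (M φ)).conj p) := fun p => by
    have h3 : (M (M φ)).conj.1 p.2 = starRingEnd ℂ ((p.2 : ℂ) * ((p.2 : ℂ) * φ.1 p.2)) := rfl
    have h4 : φ.conj.1 p.2 = starRingEnd ℂ (φ.1 p.2) := rfl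
    rw [tens, tens, h3, h4]
    simp only [map_mul, Complex.conj_ofReal]
    push_cast
    ring
  simp only [h2] at h1
  rw [integral_const_mul] at h1
  rw [map_add toZ, map_smul toZ, map_smul toZ, inner_add_left, inner_smul_left, inner_smul_left,
    inner_toZ_coeff, inner_toZ_coeff, inner_toZ_coeff, inner_toZ_coeff, h1, ← conj_lapMode]
  simp only [map_mul, Complex.conj_I, Complex.conj_ofReal, map_intCast]
  ring

theorem integral_modeEmb_toY (j : ℤ) (φ : TestFn) (Φ : Torus × ℝ → ℂ) :
    ∫ p, modeEmb j (toY φ) p * Φ p = normC * ∫ p, tens j φ p * Φ p := by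
  rw [← integral_const_mul]
  refine integral_congr_ae (volume_absolutelyContinuous_weight.ae_le ?_)
  filter_upwards [coeFn_modeEmb j (toY φ), modeFun_congr j (coeFn_toL2 lineWeight φ)] with p h1 h2
  rw [h1, h2, modeFun, tens]
  ring

theorem integral_tens_mul_dx (j : ℤ) (φ : TestFn) {Φ : Torus × ℝ → ℂ} (hΦ : IsTest Φ) :
    ∫ p, tens j φ p * dx Φ p = -(Complex.I * j) * ∫ p, tens j φ p * Φ p := by
  rw [(isTest_tens j φ).integral_mul_dx hΦ, ← integral_neg, ← integral_const_mul]
  refine integral_congr_ae (.of_forall fun p => ?_)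
  simp only [dx_tens]
  ring

theorem integral_tens_mul_lap (j : ℤ) (φ : TestFn) {Φ : Torus × ℝ → ℂ} (hΦ : IsTest Φ) :
    ∫ p, tens j φ p * lap Φ p = ∫ p, tens j (lapMode j φ) p * Φ p := by
  rw [(isTest_tens j φ).integral_mul_lap hΦ]
  simp only [lap_tens]

theorem IsTest.continuous_sq_mul_dx {Φ : Torus × ℝ → ℂ} (hΦ : IsTest Φ) :
    Continuous (fun p : Torus × ℝ => (p.2 : ℂ) ^ 2 * Poiseuille.dx Φ p) ∧
      HasCompactSupport fun p : Torus × ℝ => (p.2 : ℂ) ^ 2 * Poiseuille.dx Φ p := by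
  have := hΦ.dx.continuous
  exact ⟨by fun_prop, hΦ.dx.2.mul_left⟩

theorem isDxInvLap_modeEmb (j : ℤ) (f : Y) :
    IsDxInvLap (modeEmb j f) (modeEmb j (velMode j f)) := by
  intro Φ hΦ
  obtain ⟨L, hL⟩ := exists_pairing hΦ.lap.continuous hΦ.lap.2
  obtain ⟨L', hL'⟩ := exists_pairing hΦ.dx.continuous hΦ.dx.2
  rw [← hL, ← hL']
  have hclosed : IsClosed {f | L (modeEmb j (velMode j f)) = -L' (modeEmb j f)} :=
    isClosed_eq (by fun_prop) (by fun_prop)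
  by_cases hj : j = 0
  · refine denseRange_toY.induction (P := fun f => L (modeEmb j (velMode j f)) = -L' (modeEmb j f))
      (fun _ ⟨φ, hφ⟩ => hφ ▸ ?_) hclosed f
    rw [hL', integral_modeEmb_toY, integral_tens_mul_dx _ _ hΦ, velMode, if_pos hj, hj]
    simp
  · refine lapMode_induction hj hclosed (fun φ => ?_) f
    rw [velMode, if_neg hj, smul_apply, stream_lapMode hj, map_smul, map_smul, hL, hL',
      integral_modeEmb_toY, integral_modeEmb_toY, integral_tens_mul_dx _ _ hΦ,
      integral_tens_mul_lap _ _ hΦ, smul_eq_mul]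
    ring

/-- The equation `g = 𝓛 f` on a single Fourier mode, parametrised by the resolvent. -/
theorem modeEmb_weak {ν : ℝ} (hν : 0 < ν) (hν1 : ν < 1) {l : ℝ} (hl : 1 < l) (j : ℤ) (x : Y)
    {Φ : Torus × ℝ → ℂ} (hΦ : IsTest Φ) :
    ∫ p, modeEmb j ((l : ℂ) • resMode ν j l x - x) p * Φ p =
      (∫ p, modeEmb j (resMode ν j l x) p * ((p.2 : ℂ) ^ 2 * dx Φ p)) +
        ν * ∫ p, modeEmb j (resMode ν j l x) p * lap Φ p := by
  obtain ⟨L, hL⟩ := exists_pairing hΦ.lap.continuous hΦ.lap.2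
  obtain ⟨L', hL'⟩ := exists_pairing hΦ.continuous_sq_mul_dx.1 hΦ.continuous_sq_mul_dx.2
  obtain ⟨L'', hL''⟩ := exists_pairing hΦ.continuous hΦ.2
  rw [← hL, ← hL', ← hL'']
  refine shiftMode_induction hν (by linarith) j (P := fun x =>
    L'' (modeEmb j ((l : ℂ) • resMode ν j l x - x)) =
      L' (modeEmb j (resMode ν j l x)) + ν * L (modeEmb j (resMode ν j l x)))
    (isClosed_eq (by fun_prop) (by fun_prop)) (fun φ => ?_) x
  have h1 : (l : ℂ) • toY φ - toY (shiftMode ν j l φ) = toY (locMode ν j φ) := by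
    rw [shiftMode_apply, map_sub, map_smul]
    module
  have h2 : ∀ p : Torus × ℝ, tens j φ p * ((p.2 : ℂ) ^ 2 * dx Φ p) =
      tens j (M (M φ)) p * dx Φ p := fun p => by
    have h3 : (M (M φ)).1 p.2 = (p.2 : ℂ) * ((p.2 : ℂ) * φ.1 p.2) := rfl
    rw [tens, tens, h3]; ring
  have h4 : ∀ p : Torus × ℝ, tens j (locMode ν j φ) p * Φ p = ν * (tens j (lapMode j φ) p * Φ p) -
      (Complex.I * j) * (tens j (M (M φ)) p * Φ p) := fun p => by
    have h3 : (locMode ν j φ).1 p.2 = ν * (lapMode j φ).1 p.2 -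
      (Complex.I * j) * (M (M φ)).1 p.2 := rfl
    rw [tens, tens, tens, h3]; ring
  rw [resMode_shiftMode hν hν1 hl, h1, hL, hL', hL'', integral_modeEmb_toY, integral_modeEmb_toY,
    integral_modeEmb_toY, integral_tens_mul_lap _ _ hΦ]
  simp only [h2, h4]
  rw [integral_tens_mul_dx _ _ hΦ, integral_sub, integral_const_mul, integral_const_mul]
  · ring
  · exact ((isTest_tens j _).mul hΦ).integrable.const_mul _
  · exact ((isTest_tens j _).mul hΦ).integrable.const_mul _

/-- Fourier synthesis: a sum of modes `f = ∑ⱼ e^{ijx} uⱼ` with `uⱼ` in the domain of the `j`-th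
mode lies in the domain of `𝓛`. -/
theorem isLinOp_of_hasSum {ν : ℝ} (hν : 0 < ν) (hν1 : ν < 1) {l : ℝ} (hl : 1 < l) {x : ℤ → Y}
    {f h g : X} (hf : HasSum (fun j => modeEmb j (resMode ν j l (x j))) f)
    (hh : HasSum (fun j => modeEmb j (velMode j (resMode ν j l (x j)))) h)
    (hg : HasSum (fun j => modeEmb j ((l : ℂ) • resMode ν j l (x j) - x j +
      (2 : ℂ) • velMode j (resMode ν j l (x j)))) g) : IsLinOp ν f g := by
  refine ⟨h, fun Φ hΦ => ?_, fun Φ hΦ => ?_⟩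
  · obtain ⟨L, hL⟩ := exists_pairing hΦ.lap.continuous hΦ.lap.2
    obtain ⟨L', hL'⟩ := exists_pairing hΦ.dx.continuous hΦ.dx.2
    rw [← hL, ← hL']
    have h1 : ∀ j, L (modeEmb j (velMode j (resMode ν j l (x j)))) =
        -L' (modeEmb j (resMode ν j l (x j))) := fun j => by
      rw [hL, hL']
      exact isDxInvLap_modeEmb j _ Φ hΦ
    have h2 := hh.mapL L
    simp only [h1] at h2
    exact h2.unique (hf.mapL L').neg
  · obtain ⟨L, hL⟩ := exists_pairing hΦ.lap.continuous hΦ.lap.2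
    obtain ⟨L', hL'⟩ := exists_pairing hΦ.continuous_sq_mul_dx.1 hΦ.continuous_sq_mul_dx.2
    obtain ⟨L'', hL''⟩ := exists_pairing hΦ.continuous hΦ.2
    rw [← hL, ← hL', ← hL'', ← hL'']
    have h1 : ∀ j, L'' (modeEmb j ((l : ℂ) • resMode ν j l (x j) - x j +
        (2 : ℂ) • velMode j (resMode ν j l (x j)))) = L' (modeEmb j (resMode ν j l (x j))) +
        2 * L'' (modeEmb j (velMode j (resMode ν j l (x j)))) +
        ν * L (modeEmb j (resMode ν j l (x j))) := fun j => by
      have h2 := modeEmb_weak hν hν1 hl j (x j) hΦ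
      rw [← hL, ← hL', ← hL''] at h2
      rw [map_add, map_add, h2, map_smul, map_smul, smul_eq_mul]
      ring
    have h2 := hg.mapL L''
    simp only [h1] at h2
    exact h2.unique (((hf.mapL L').add ((hh.mapL L'').mul_left 2)).add
      ((hf.mapL L).mul_left (ν : ℂ)))

/-- The graph of `𝓛`. -/
def linOpGraph (ν : ℝ) : Submodule ℂ (X × X) where
  carrier := {p | IsLinOp ν p.1 p.2}
  zero_mem' := by
    refine ⟨0, fun Φ hΦ => ?_, fun Φ hΦ => ?_⟩
    · obtain ⟨L, hL⟩ := exists_pairing hΦ.lap.continuous hΦ.lap.2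
      obtain ⟨L', hL'⟩ := exists_pairing hΦ.dx.continuous hΦ.dx.2
      rw [← hL, ← hL']
      simp
    · obtain ⟨L, hL⟩ := exists_pairing hΦ.lap.continuous hΦ.lap.2
      obtain ⟨L', hL'⟩ := exists_pairing hΦ.continuous_sq_mul_dx.1 hΦ.continuous_sq_mul_dx.2
      obtain ⟨L'', hL''⟩ := exists_pairing hΦ.continuous hΦ.2
      rw [← hL, ← hL', ← hL'', ← hL'']
      simp
  add_mem' := by
    rintro ⟨f, g⟩ ⟨f', g'⟩ ⟨h, H1, H2⟩ ⟨h', H1', H2'⟩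
    refine ⟨h + h', fun Φ hΦ => ?_, fun Φ hΦ => ?_⟩
    · obtain ⟨L, hL⟩ := exists_pairing hΦ.lap.continuous hΦ.lap.2
      obtain ⟨L', hL'⟩ := exists_pairing hΦ.dx.continuous hΦ.dx.2
      have e1 := H1 Φ hΦ
      have e2 := H1' Φ hΦ
      rw [← hL, ← hL'] at e1 e2 ⊢
      change L (h + h') = -L' (f + f')
      rw [map_add, map_add, e1, e2]
      ring
    · obtain ⟨L, hL⟩ := exists_pairing hΦ.lap.continuous hΦ.lap.2
      obtain ⟨L', hL'⟩ := exists_pairing hΦ.continuous_sq_mul_dx.1 hΦ.continuous_sq_mul_dx.2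
      obtain ⟨L'', hL''⟩ := exists_pairing hΦ.continuous hΦ.2
      have e1 := H2 Φ hΦ
      have e2 := H2' Φ hΦ
      rw [← hL, ← hL', ← hL'', ← hL''] at e1 e2 ⊢
      change L'' (g + g') = L' (f + f') + 2 * L'' (h + h') + ν * L (f + f')
      simp only [map_add, e1, e2]
      ring
  smul_mem' := by
    rintro c ⟨f, g⟩ ⟨h, H1, H2⟩
    refine ⟨c • h, fun Φ hΦ => ?_, fun Φ hΦ => ?_⟩
    · obtain ⟨L, hL⟩ := exists_pairing hΦ.lap.continuous hΦ.lap.2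
      obtain ⟨L', hL'⟩ := exists_pairing hΦ.dx.continuous hΦ.dx.2
      have e1 := H1 Φ hΦ
      rw [← hL, ← hL'] at e1 ⊢
      change L (c • h) = -L' (c • f)
      rw [map_smul, map_smul, e1, smul_neg]
    · obtain ⟨L, hL⟩ := exists_pairing hΦ.lap.continuous hΦ.lap.2
      obtain ⟨L', hL'⟩ := exists_pairing hΦ.continuous_sq_mul_dx.1 hΦ.continuous_sq_mul_dx.2
      obtain ⟨L'', hL''⟩ := exists_pairing hΦ.continuous hΦ.2
      have e1 := H2 Φ hΦ
      rw [← hL, ← hL', ← hL'', ← hL''] at e1 ⊢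
      change L'' (c • g) = L' (c • f) + 2 * L'' (c • h) + ν * L (c • f)
      simp only [map_smul, e1, smul_eq_mul]
      ring

/-! ### Generation and decay -/

section Generation

variable {ν : ℝ} (hν : 0 < ν) (hν1 : ν < 1)

include hν hν1

theorem isQuasiDissipative_linOpGraph : IsQuasiDissipative (linOpGraph ν) 5 where
  bound := by
    intro l hl f g hfg
    have h1 : ‖f‖ ≤ (l - 5)⁻¹ * ‖(l : ℂ) • f - g‖ := by
      refine norm_le_of_coeff_le (by rw [inv_nonneg]; linarith) fun j => ?_
      obtain ⟨h, hh⟩ := IsLinOp.modeRel hfg j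
      have h2 := hh.norm_le hν hν1 hl j
      rw [map_sub, map_smul, inv_mul_eq_div, le_div_iff₀ (by linarith), mul_comm]
      exact h2
    rwa [inv_mul_eq_div, le_div_iff₀ (by linarith), mul_comm] at h1
  surj := by
    intro l hl g
    have hl1 : 1 < l := by linarith
    choose x hx hxn using fun j => exists_resMode_eq hν hν1 hl j (coeff j g)
    have hxn' : ∀ j, ‖resMode ν j l (x j)‖ ≤ (l - 5)⁻¹ * ‖coeff j g‖ := fun j => by
      rw [inv_mul_eq_div, le_div_iff₀ (by linarith), mul_comm]
      exact hxn j
    obtain ⟨f, hf⟩ := exists_hasSum_modeEmb hxn'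
    obtain ⟨h, hh⟩ := exists_hasSum_modeEmb (g := g) (C := 2 * (l - 5)⁻¹)
      (v := fun j => velMode j (resMode ν j l (x j))) (fun j => by
        have h1 := norm_velMode_le j (resMode ν j l (x j))
        have h2 := hxn' j
        rw [mul_assoc]
        linarith)
    refine ⟨f, isLinOp_of_hasSum hν hν1 hl1 hf hh ?_⟩
    have h1 : ∀ j, modeEmb j ((l : ℂ) • resMode ν j l (x j) - x j +
        (2 : ℂ) • velMode j (resMode ν j l (x j))) =
        (l : ℂ) • modeEmb j (resMode ν j l (x j)) - modeEmb j (coeff j g) := fun j => by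
      rw [← hx j]
      simp only [map_sub, map_add, map_smul]
      abel
    simp only [h1]
    exact (hf.const_smul (l : ℂ)).sub (hasSum_modeEmb_coeff g)

theorem modeEmb_toY_mem_domain (j : ℤ) (φ : TestFn) :
    modeEmb j (toY φ) ∈ (linOpGraph ν).map (LinearMap.fst ℂ X X) := by
  set x : ℤ → Y := Pi.single j (toY (shiftMode ν j 2 φ)) with hx
  have hxj : x j = toY (shiftMode ν j 2 φ) := Pi.single_eq_same _ _
  have hxi : ∀ i, i ≠ j → x i = 0 := fun i hi => Pi.single_eq_of_ne hi _
  have hl : (1 : ℝ) < 2 := by norm_num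
  refine ⟨(_, _), isLinOp_of_hasSum hν hν1 hl (x := x)
    (hasSum_single j fun i hi => by simp [hxi i hi])
    (hasSum_single j fun i hi => by simp [hxi i hi])
    (hasSum_single j fun i hi => by simp [hxi i hi]), ?_⟩
  change modeEmb j (resMode ν j 2 (x j)) = _
  rw [hxj, resMode_shiftMode hν hν1 hl]

theorem dense_linOp_domain : Dense {f : X | ∃ g, (f, g) ∈ linOpGraph ν} := by
  have h1 : {f : X | ∃ g, (f, g) ∈ linOpGraph ν} =
      ((linOpGraph ν).map (LinearMap.fst ℂ X X) : Set X) := by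
    ext f
    simp
  rw [h1, Submodule.dense_iff_topologicalClosure_eq_top, Submodule.topologicalClosure_eq_top_iff,
    Submodule.eq_bot_iff]
  intro f hf
  refine eq_zero_of_coeff fun j => ext_inner_left ℂ fun v => ?_
  rw [inner_zero_right]
  refine denseRange_toY.induction (P := fun v => inner ℂ v (coeff j f) = 0)
    (fun _ ⟨φ, hφ⟩ => hφ ▸ ?_) (isClosed_eq (by fun_prop) (by fun_prop)) v
  rw [inner_coeff]
  exact hf _ (modeEmb_toY_mem_domain hν hν1 j φ)

end Generation

theorem coeff_eq_zero_of_mem_modes {k : ℕ} {f : X} (hf : f ∈ modes k) {j : ℤ} (h1 : j ≠ k)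
    (h2 : j ≠ -k) : coeff j f = 0 := by
  obtain ⟨a, b, hab⟩ := hf
  refine ext_inner_left ℂ fun v => ?_
  rw [inner_coeff, inner_zero_right]
  obtain ⟨hi, he⟩ := integrable_inner_modeEmb j v f
  have h3 : (fun p : Torus × ℝ => (normC * fourier (-j) p.1 * starRingEnd ℂ (v p.2)) * f p) =ᵐ[weight]
      fun p => (normC * starRingEnd ℂ (v p.2) * a p.2) * fourier (k - j) p.1 +
        (normC * starRingEnd ℂ (v p.2) * b p.2) * fourier (-k - j) p.1 := by
    filter_upwards [hab] with p hp
    rw [hp, sub_eq_add_neg, sub_eq_add_neg, fourier_add, fourier_add]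
    ring
  have hi' := hi.congr h3
  rw [he, integral_congr_ae h3]
  rw [weight_eq_prod] at hi' ⊢
  rw [integral_prod_symm _ hi']
  refine integral_eq_zero_of_ae (.of_forall fun y => ?_)
  have hint : ∀ (c : ℂ) (n : ℤ), Integrable fun x : Torus => c * fourier n x := fun c n =>
    (by fun_prop : Continuous fun x : Torus => c * fourier n x).integrable_of_hasCompactSupport
      (HasCompactSupport.of_compactSpace _)
  simp only [Pi.zero_apply]
  rw [integral_add (hint _ _) (hint _ _), integral_const_mul, integral_const_mul, integral_fourier,
    integral_fourier, if_neg (by omega), if_neg (by omega), mul_zero, mul_zero, add_zero]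

theorem coeff_proj_eq_zero {k : ℕ} (f : X) {j : ℤ} (h1 : j ≠ k) (h2 : j ≠ -k) :
    coeff j (proj k f) = 0 := by
  have h3 : proj k f ∈ (modes k).topologicalClosure :=
    Submodule.starProjection_apply_mem _ _
  have h4 : (modes k).topologicalClosure ≤ LinearMap.ker (coeff j : X →ₗ[ℂ] Y) :=
    Submodule.topologicalClosure_minimal _ (fun f hf => coeff_eq_zero_of_mem_modes hf h1 h2)
      (coeff j).isClosed_ker
  exact h4 h3

theorem isModeSolution_coeff {ν : ℝ} {S : ℝ≥0 → X →L[ℂ] X} (hS : IsGeneratedBy S (IsLinOp ν))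
    {f g : X} (hfg : IsLinOp ν f g) (j : ℤ) :
    IsModeSolution ν j (fun t => coeff j (S t.toNNReal f)) (fun t => coeff j (S t.toNNReal g)) where
  cont := (coeff j).continuous.comp ((hS.1.continuous f).comp continuous_real_toNNReal)
  cont' := (coeff j).continuous.comp ((hS.1.continuous g).comp continuous_real_toNNReal)
  deriv t ht := ((coeff j).restrictScalars ℝ).hasFDerivAt.comp_hasDerivWithinAt t
    (hS.1.hasDerivWithinAt ((hS.2 f g).2 hfg) t ht)
  rel t := IsLinOp.modeRel ((hS.2 _ _).1 (hS.1.tendsto_orbit ((hS.2 f g).2 hfg) t.toNNReal)) j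

section Decay

variable {ν : ℝ} (hν : 0 < ν) (hν1 : ν < 1) {S : ℝ≥0 → X →L[ℂ] X}
  (hS : IsGeneratedBy S (IsLinOp ν))

include hν hν1 hS

theorem norm_coeff_semigroup_le {k : ℕ} (hk : k ≠ 0) {j : ℤ} (hjk : j = k ∨ j = -k) (t : ℝ≥0)
    (f : X) : ‖coeff j (S t f)‖ ≤
      9 * Real.exp (-(1 / 20) * rate ν k * t) * ‖coeff j f‖ := by
  refine (dense_linOp_domain hν hν1).induction
    (P := fun f => ‖coeff j (S t f)‖ ≤ 9 * Real.exp (-(1 / 20) * rate ν k * t) * ‖coeff j f‖)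
    (fun f ⟨g, hg⟩ => ?_) (isClosed_le (by fun_prop) (by fun_prop)) f
  have h1 := (isModeSolution_coeff hS hg j).norm_le hν hν1 hk hjk t.2
  simpa [hS.1.map_zero] using h1

/-- A mode that is absent initially remains absent. -/
theorem coeff_semigroup_eq_zero (j : ℤ) (t : ℝ≥0) {f : X} (hf : coeff j f = 0) :
    coeff j (S t f) = 0 := by
  have h1 : ‖coeff j (S t f)‖ ^ 2 ≤ Real.exp (10 * t) * ‖coeff j f‖ ^ 2 := by
    refine (dense_linOp_domain hν hν1).induction
      (P := fun f => ‖coeff j (S t f)‖ ^ 2 ≤ Real.exp (10 * t) * ‖coeff j f‖ ^ 2)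
      (fun f ⟨g, hg⟩ => ?_) (isClosed_le (by fun_prop) (by fun_prop)) f
    have h1 := (isModeSolution_coeff hS hg j).norm_sq_le_exp hν hν1 t.2
    simpa [hS.1.map_zero] using h1
  rw [hf, norm_zero] at h1
  simpa using h1

theorem norm_semigroup_proj_le {k : ℕ} (hk : k ≠ 0) (t : ℝ≥0) :
    ‖(S t).comp (proj k)‖ ≤ 9 * Real.exp (-(1 / 20) * rate ν k * t) := by
  refine ContinuousLinearMap.opNorm_le_bound _ (by positivity) fun f => ?_
  have h1 : ‖S t (proj k f)‖ ≤ 9 * Real.exp (-(1 / 20) * rate ν k * t) * ‖proj k f‖ := by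
    refine norm_le_of_coeff_le (by positivity) fun j => ?_
    by_cases hj : j = k ∨ j = -k
    · exact norm_coeff_semigroup_le hν hν1 hS hk hj t _
    · push Not at hj
      have h2 := coeff_proj_eq_zero f hj.1 hj.2
      rw [coeff_semigroup_eq_zero hν hν1 hS j t h2, h2, norm_zero, mul_zero]
  refine h1.trans ?_
  gcongr
  exact Submodule.norm_starProjection_apply_le _ _

end Decay

end Poiseuille

end

theorem theorem1p1 :
    ∃ ε₀ C₀ : ℝ, 1 / 20 ≤ ε₀ ∧ 1 < C₀ ∧ C₀ < 10 ∧
      ∀ ν : ℝ, 0 < ν → ν < 1 →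
        (∃ S : ℝ≥0 → Poiseuille.X →L[ℂ] Poiseuille.X,
          Poiseuille.IsGeneratedBy S (Poiseuille.IsLinOp ν)) ∧
        ∀ S : ℝ≥0 → Poiseuille.X →L[ℂ] Poiseuille.X,
          Poiseuille.IsGeneratedBy S (Poiseuille.IsLinOp ν) →
            ∀ k : ℕ, k ≠ 0 → ∀ t : ℝ≥0,
              ‖(S t).comp (Poiseuille.proj k)‖ ≤
                C₀ * Real.exp (-ε₀ * Poiseuille.rate ν k * t) := by
  refine ⟨1 / 20, 9, le_rfl, by norm_num, by norm_num, fun ν hν hν1 => ⟨?_, ?_⟩⟩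
  · exact (Poiseuille.isQuasiDissipative_linOpGraph hν hν1).exists_semigroup (by norm_num)
      (Poiseuille.dense_linOp_domain hν hν1)
  · intro S hS k hk t
    exact Poiseuille.norm_semigroup_proj_le hν hν1 hS hk t
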